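/- **Theorem.** Let $\mathfrak g$ be a finite-dimensional complex semisimple Lie algebra, $\mathfrak h$ a Cartan subalgebra with a chosen base of simple roots, and $\alpha$ a simple root. Let $\mathfrak p=\mathfrak r\oplus\mathfrak u^+$ be the standard maximal parabolic subalgebra whose only noncompact simple root is $\alpha$: $\mathfrak r$ (resp. $\mathfrak u^+$, $\mathfrak u^-$) is the sum of the root spaces (and of $\mathfrak h$, for $\mathfrak r$) of the roots whose coefficient along $\alpha$ is $0$ (resp. positive, negative). Assume that $\mathfrak p$ is Hermitian symmetric, i.e. that $\mathfrak u^+$ is abelian. Put $\mathfrak g_S=[\mathfrak r,\mathfrak r]$, let $\operatorname{pr}:\mathfrak p\to\mathfrak p/(\mathfrak u^+\oplus\mathfrak g_S)=\mathfrak h/(\mathfrak h\cap\mathfrak g_S)$ be the natural projection, let $\rho^S$ be half the sum of the roots of $\mathfrak h$ in $\mathfrak u^+$, let $h_\alpha\in[\mathfrak g_\alpha,\mathfrak g_{-\alpha}]$ be the coroot of $\alpha$, and let $\omega_\alpha$ be the linear form on $\mathfrak h/(\mathfrak h\cap\mathfrak g_S)$ that is $1$ on the image of $h_\alpha$. For a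 linear form $\lambda$ on $\mathfrak h/(\mathfrak h\cap\mathfrak g_S)$, a vector $v$ of a $U(\mathfrak g)$-module is said to satisfy (Hol wt $\lambda$) if $Xv=\lambda(\operatorname{pr}X)\,v$ for all $X\in\mathfrak p$; let $\mathbb C e_\lambda$ be the one-dimensional $U(\mathfrak p)$-module on which $\mathfrak p$ acts by $\lambda\circ\operatorname{pr}$, and $M(\lambda)=U(\mathfrak g)\otimes_{U(\mathfrak p)}\mathbb C e_\lambda$. Let $U(\mathfrak u^-)^{\mathfrak g_S}$ be the algebra of elements of $U(\mathfrak u^-)$ that are invariant under the adjoint action of $\mathfrak g_S$. Let $\lambda\neq\lambda'$ be two linear forms on $\mathfrak h/(\mathfrak h\cap\mathfrak g_S)$. The following are equivalent: 1. there is a $U(\mathfrak g)$-module $V$ generated by a vector $e$ satisfying (Hol wt $\lambda$) that contains a nonzero vector $e'$ satisfying (Hol wt $\lambda'$); 2. there is a nonzero $U(\mathfrak g)$-module homomorphism $M(\lambda')\to M(\lambda)$; 3. $U(\mathfrak u^-)^{\mathfrak g_S}$ is a polynomial algebra $\mathbb C[u]$ in one generator, and there is an integer $k\ge 0$ with $$\lambda=(k-\rho^S(h_\alpha))\,\omega_\alpha,\qquad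 \lambda'=(-k-\rho^S(h_\alpha))\,\omega_\alpha .$$ Moreover, if $U(\mathfrak u^-)^{\mathfrak g_S}$ is a polynomial algebra in one generator, then it has a generator $u_r$ that is a weight vector of weight $-2\omega_\alpha$ for the adjoint action of $\mathfrak h$. For every such generator $u_r$, if $\lambda,\lambda'$ are as in (3) with the integer $k$, then: for every $U(\mathfrak g)$-module $V$ generated by a vector $e$ satisfying (Hol wt $\lambda$), every $e'\in V$ satisfying (Hol wt $\lambda'$) is a scalar multiple of $u_r^k e$; and every homomorphism $M(\lambda')\to M(\lambda)$ sends $1\otimes e_{\lambda'}$ to a scalar multiple of $u_r^k\otimes e_\lambda$ and is determined by its value on $1\otimes e_{\lambda'}$. -/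

import Mathlib

open LieAlgebra LieModule Module
open scoped TensorProduct

attribute [local instance 100] LieRing.ofAssociativeRing

universe u v

noncomputable section

namespace HermitianParabolic

variable {L : Type u} [LieRing L] [LieAlgebra ℂ L] [FiniteDimensional ℂ L]
  [LieAlgebra.IsSemisimple ℂ L]
  {H : LieSubalgebra ℂ L} [H.IsCartanSubalgebra]

/-! ### The standard maximal parabolic attached to a simple root -/

/-- The set of linear forms on `H` whose coefficient along the simple root `i` (in the basis of
simple roots) is an integer belonging to `A`. -/
def levels (b : (IsKilling.rootSystem H).Base) (i : b.support) (A : Set ℤ) : Set (H → ℂ) :=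
  {χ | ∃ f : Dual ℂ H, ⇑f = χ ∧ ∃ n ∈ A, b.toWeightBasis.coord i f = (n : ℂ)}

/-- The sum of the root spaces (including the zero root space `H`, if `0 ∈ A`) of those roots whose
coefficient along the simple root `i` lies in `A`. -/
def gradedPart (b : (IsKilling.rootSystem H).Base) (i : b.support) (A : Set ℤ) :
    LieSubmodule ℂ H L :=
  ⨆ χ : H → ℂ, ⨆ (_ : χ ∈ levels b i A), rootSpace H χ

variable (b : (IsKilling.rootSystem H).Base) (i : b.support)

lemma levels_add {A B C : Set ℤ} (h : ∀ m ∈ A, ∀ n ∈ B, m + n ∈ C) {χ₁ χ₂ : H → ℂ}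
    (h₁ : χ₁ ∈ levels b i A) (h₂ : χ₂ ∈ levels b i B) : χ₁ + χ₂ ∈ levels b i C := by
  obtain ⟨f, rfl, m, hm, hf⟩ := h₁
  obtain ⟨g, rfl, n, hn, hg⟩ := h₂
  refine ⟨f + g, rfl, m + n, h m hm n hn, ?_⟩
  rw [map_add, hf, hg]; push_cast; rfl

lemma lie_mem_gradedPart {A B C : Set ℤ} (h : ∀ m ∈ A, ∀ n ∈ B, m + n ∈ C) {x y : L}
    (hx : x ∈ gradedPart b i A) (hy : y ∈ gradedPart b i B) : ⁅x, y⁆ ∈ gradedPart b i C := by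
  unfold gradedPart at hx hy
  induction hx using LieSubmodule.iSup_induction' with
  | zero => simp
  | add _ _ _ _ hu hv => rw [add_lie]; exact add_mem hu hv
  | mem χ₁ u hu =>
    by_cases hχ₁ : χ₁ ∈ levels b i A; swap
    · simp_all
    replace hu : u ∈ rootSpace H χ₁ := by simpa [hχ₁] using hu
    induction hy using LieSubmodule.iSup_induction' with
    | zero => simp
    | add _ _ _ _ hv hw => rw [lie_add]; exact add_mem hv hw
    | mem χ₂ v hv =>
      by_cases hχ₂ : χ₂ ∈ levels b i B; swap
      · simp_all
      replace hv : v ∈ rootSpace H χ₂ := by simpa [hχ₂] using hv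
      apply LieSubmodule.mem_iSup_of_mem (χ₁ + χ₂)
      simpa [levels_add b i h hχ₁ hχ₂] using lie_mem_genWeightSpace_of_mem_genWeightSpace hu hv

lemma gradedPart_mono {A B : Set ℤ} (h : A ⊆ B) : gradedPart b i A ≤ gradedPart b i B :=
  biSup_mono fun _ ⟨f, hf, n, hn, e⟩ ↦ ⟨f, hf, n, h hn, e⟩

lemma gradedPart_union (A B : Set ℤ) :
    gradedPart b i (A ∪ B) ≤ gradedPart b i A ⊔ gradedPart b i B := by
  refine iSup₂_le ?_
  rintro χ ⟨f, hf, n, hn | hn, e⟩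
  · exact le_sup_of_le_left (le_iSup₂_of_le χ ⟨f, hf, n, hn, e⟩ le_rfl)
  · exact le_sup_of_le_right (le_iSup₂_of_le χ ⟨f, hf, n, hn, e⟩ le_rfl)

lemma gradedPart_disjoint {A B : Set ℤ} (h : Disjoint A B) :
    Disjoint (gradedPart b i A) (gradedPart b i B) := by
  refine iSupIndep.disjoint_biSup_biSup (iSupIndep_genWeightSpace ℂ H L) ?_
  rw [Set.disjoint_left]
  rintro χ ⟨f, rfl, n, hn, e⟩ ⟨g, hg, m, hm, e'⟩
  obtain rfl : g = f := DFunLike.coe_injective hg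
  obtain rfl : n = m := by exact_mod_cast e.symm.trans e'
  exact Set.disjoint_left.1 h hn hm

/-- The Lie subalgebra attached to a set of levels that is closed under addition. -/
def gradedSubalgebra (A : Set ℤ) (h : ∀ m ∈ A, ∀ n ∈ A, m + n ∈ A) : LieSubalgebra ℂ L where
  __ := (gradedPart b i A).toSubmodule
  lie_mem' := fun hx hy ↦ lie_mem_gradedPart b i h hx hy

/-- The standard maximal parabolic subalgebra `𝔭 = 𝔯 ⊕ 𝔲⁺` whose only noncompact simple root
is `i`: its Levi factor contains `H` and the root spaces of all other simple roots. -/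
def parabolic : LieSubalgebra ℂ L :=
  gradedSubalgebra b i (Set.Ici 0) fun m (hm : 0 ≤ m) n (hn : 0 ≤ n) ↦ show 0 ≤ m + n from add_nonneg hm hn

/-- The nilradical `𝔲⁺` of the parabolic subalgebra. -/
def uPlus : LieSubalgebra ℂ L :=
  gradedSubalgebra b i (Set.Ioi 0) fun m (hm : 0 < m) n (hn : 0 < n) ↦ show 0 < m + n from add_pos hm hn

/-- The nilradical `𝔲⁻` of the opposite parabolic subalgebra. -/
def uMinus : LieSubalgebra ℂ L :=
  gradedSubalgebra b i (Set.Iio 0) fun m (hm : m < 0) n (hn : n < 0) ↦ show m + n < 0 from add_neg hm hn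

/-- The Levi factor `𝔯` (containing `H`) of the parabolic subalgebra. -/
def levi : LieSubalgebra ℂ L :=
  gradedSubalgebra b i {0} (by simp)

/-- The parabolic subalgebra is of Hermitian symmetric type: its nilradical is abelian. -/
def IsHermitianSymmetric : Prop := IsLieAbelian (uPlus b i)

/-- The derived subalgebra `𝔤_S = [𝔯, 𝔯]` of the Levi factor, as a subspace of `L`. -/
def gS : Submodule ℂ L :=
  Submodule.span ℂ {z | ∃ x ∈ levi b i, ∃ y ∈ levi b i, ⁅x, y⁆ = z}

lemma gS_le_levi : gS b i ≤ (levi b i).toSubmodule := by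
  refine Submodule.span_le.2 ?_
  rintro _ ⟨x, hx, y, hy, rfl⟩
  exact (levi b i).lie_mem hx hy

lemma cartan_le_levi : H ≤ levi b i := by
  intro x hx
  change x ∈ gradedPart b i {0}
  have h0 : (0 : H → ℂ) ∈ levels b i {0} := ⟨0, rfl, 0, rfl, by simp⟩
  have : rootSpace H (0 : H → ℂ) ≤ gradedPart b i {0} := le_iSup₂_of_le 0 h0 le_rfl
  apply this
  rw [rootSpace_zero_eq]
  exact hx

lemma levi_le_parabolic : levi b i ≤ parabolic b i :=
  fun _ hx ↦ gradedPart_mono b i (A := {0}) (B := Set.Ici 0) (by simp) hx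

/-- The quotient `H / (H ∩ 𝔤_S)`. -/
abbrev CartanQuot : Type u := H ⧸ (gS b i).comap (H.incl : H →ₗ[ℂ] L)

/-- The image in `H / (H ∩ 𝔤_S)` of an element of `H`. -/
def toQuot : H →ₗ[ℂ] CartanQuot b i := Submodule.mkQ _

/-- The kernel `𝔲⁺ ⊕ 𝔤_S` of the projection from `𝔭` to `H / (H ∩ 𝔤_S)`. -/
def prKer : Submodule ℂ L := (uPlus b i).toSubmodule ⊔ gS b i

lemma mem_gS_of_mem_prKer {x : L} (hx : x ∈ prKer b i) (hr : x ∈ levi b i) : x ∈ gS b i := by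
  obtain ⟨u, hu, s, hs, rfl⟩ := Submodule.mem_sup.1 hx
  have hu' : u ∈ levi b i := by simpa using sub_mem hr (gS_le_levi b i hs)
  have hd : Disjoint (gradedPart b i {0}) (gradedPart b i (Set.Ioi 0)) :=
    gradedPart_disjoint b i (by simp)
  have h0 : u ∈ gradedPart b i {0} ⊓ gradedPart b i (Set.Ioi 0) := ⟨hu', hu⟩
  rw [hd.eq_bot] at h0
  obtain rfl : u = 0 := by simpa using h0
  simpa using hs

/-- The map `H → L / (𝔲⁺ ⊕ 𝔤_S)`. -/
def cartanToQuot : H →ₗ[ℂ] L ⧸ prKer b i := (prKer b i).mkQ ∘ₗ (H.incl : H →ₗ[ℂ] L)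

lemma ker_cartanToQuot :
    LinearMap.ker (cartanToQuot b i) = (gS b i).comap (H.incl : H →ₗ[ℂ] L) := by
  ext x
  simp only [cartanToQuot, LinearMap.mem_ker, LinearMap.comp_apply, Submodule.mkQ_apply,
    Submodule.Quotient.mk_eq_zero, Submodule.mem_comap]
  exact ⟨fun h ↦ mem_gS_of_mem_prKer b i h (cartan_le_levi b i x.2),
    fun h ↦ Submodule.mem_sup_right h⟩

lemma levi_le : (levi b i).toSubmodule ≤ H.toSubmodule ⊔ gS b i := by
  intro x hx
  change x ∈ gradedPart b i {0} at hx
  unfold gradedPart at hx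
  induction hx using LieSubmodule.iSup_induction' with
  | zero => simp
  | add _ _ _ _ hu hv => exact add_mem hu hv
  | mem χ u hu =>
    by_cases hχ : χ ∈ levels b i {0}; swap
    · simp_all
    replace hu : u ∈ rootSpace H χ := by simpa [hχ] using hu
    have hul : u ∈ levi b i := by
      have : rootSpace H χ ≤ gradedPart b i {0} := le_iSup₂_of_le χ hχ le_rfl
      exact this hu
    by_cases h0 : χ = 0
    · subst h0
      rw [rootSpace_zero_eq] at hu
      exact Submodule.mem_sup_left hu
    · obtain ⟨h, hh⟩ : ∃ h, χ h ≠ 0 := by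
        by_contra! hc
        exact h0 (funext hc)
      refine Submodule.mem_sup_right ?_
      have e : ⁅(h : L), u⁆ = χ h • u := IsKilling.lie_eq_smul_of_mem_rootSpace hu h
      have : u = (χ h)⁻¹ • ⁅(h : L), u⁆ := by rw [e, smul_smul, inv_mul_cancel₀ hh, one_smul]
      rw [this]
      exact Submodule.smul_mem _ _
        (Submodule.subset_span ⟨h, cartan_le_levi b i h.2, u, hul, rfl⟩)

lemma parabolic_le : (parabolic b i).toSubmodule ≤
    (uPlus b i).toSubmodule ⊔ (levi b i).toSubmodule := by
  intro x hx
  have h1 : x ∈ gradedPart b i (Set.Ioi 0 ∪ {0}) :=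
    gradedPart_mono b i (A := Set.Ici 0)
      (fun n (hn : 0 ≤ n) ↦ hn.lt_or_eq.imp id (fun h ↦ h.symm)) hx
  have h2 := gradedPart_union b i _ _ h1
  rw [← LieSubmodule.mem_toSubmodule, LieSubmodule.sup_toSubmodule] at h2
  exact h2

lemma mkQ_mem_range {x : L} (hx : x ∈ parabolic b i) :
    (prKer b i).mkQ x ∈ LinearMap.range (cartanToQuot b i) := by
  obtain ⟨u, hu, r, hr, rfl⟩ := Submodule.mem_sup.1 (parabolic_le b i hx)
  obtain ⟨h, hh, s, hs, rfl⟩ := Submodule.mem_sup.1 (levi_le b i hr)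
  refine ⟨⟨h, hh⟩, ?_⟩
  symm
  rw [← sub_eq_zero]
  change (prKer b i).mkQ (u + (h + s)) - (prKer b i).mkQ h = 0
  rw [← map_sub, Submodule.mkQ_apply, Submodule.Quotient.mk_eq_zero]
  have : u + (h + s) - h = u + s := by abel
  rw [this]
  exact Submodule.add_mem_sup hu hs

/-- The natural projection `pr : 𝔭 → 𝔭 / (𝔲⁺ ⊕ 𝔤_S) = H / (H ∩ 𝔤_S)`. -/
def pr : parabolic b i →ₗ[ℂ] CartanQuot b i :=
  (Submodule.quotEquivOfEq _ _ (ker_cartanToQuot b i)).toLinearMap ∘ₗ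
    (cartanToQuot b i).quotKerEquivRange.symm.toLinearMap ∘ₗ
      LinearMap.codRestrict (LinearMap.range (cartanToQuot b i))
        ((prKer b i).mkQ ∘ₗ (parabolic b i).toSubmodule.subtype) fun x ↦ mkQ_mem_range b i x.2

/-- `pr` restricts to the quotient map on `H`. -/
lemma pr_cartan (h : H) :
    pr b i ⟨h, levi_le_parabolic b i (cartan_le_levi b i h.2)⟩ = toQuot b i h := by
  change Submodule.quotEquivOfEq _ _ (ker_cartanToQuot b i)
    ((cartanToQuot b i).quotKerEquivRange.symm ⟨cartanToQuot b i h, _⟩) = _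
  exact congrArg (Submodule.quotEquivOfEq _ _ (ker_cartanToQuot b i))
    (LinearMap.quotKerEquivRange_symm_apply_image (cartanToQuot b i) h _)

/-- `pr` vanishes on `𝔲⁺ ⊕ 𝔤_S`. -/
lemma pr_eq_zero (x : parabolic b i) (hx : (x : L) ∈ prKer b i) : pr b i x = 0 := by
  change Submodule.quotEquivOfEq _ _ (ker_cartanToQuot b i)
    ((cartanToQuot b i).quotKerEquivRange.symm ⟨(prKer b i).mkQ (x : L), _⟩) = _
  rw [LinearEquiv.map_eq_zero_iff, LinearEquiv.map_eq_zero_iff, Subtype.ext_iff]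
  simpa using hx

lemma lie_mem_prKer {x y : L} (hx : x ∈ parabolic b i) (hy : y ∈ parabolic b i) :
    ⁅x, y⁆ ∈ prKer b i := by
  obtain ⟨u, hu, r, hr, rfl⟩ := Submodule.mem_sup.1 (parabolic_le b i hx)
  obtain ⟨v, hv, s, hs, rfl⟩ := Submodule.mem_sup.1 (parabolic_le b i hy)
  have h1 : ⁅u, v + s⁆ ∈ uPlus b i :=
    lie_mem_gradedPart b i (A := Set.Ioi 0) (B := Set.Ici 0) (C := Set.Ioi 0)
      (fun m (hm : 0 < m) n (hn : 0 ≤ n) ↦ show 0 < m + n from add_pos_of_pos_of_nonneg hm hn) hu hy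
  have h2 : ⁅r, v⁆ ∈ uPlus b i :=
    lie_mem_gradedPart b i (A := {0}) (B := Set.Ioi 0) (C := Set.Ioi 0) (by simp) hr hv
  have h3 : ⁅r, s⁆ ∈ gS b i := Submodule.subset_span ⟨r, hr, s, hs, rfl⟩
  rw [add_lie, lie_add r]
  exact add_mem (Submodule.mem_sup_left h1)
    (add_mem (Submodule.mem_sup_left h2) (Submodule.mem_sup_right h3))

/-! ### The weights `ω_α` and `ρ^S` -/

/-- The coroot `h_α` of the noncompact simple root `α`. -/
def hAlpha : H := IsKilling.coroot (i : H.root).1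

/-- The fundamental weight of the noncompact simple root, as a linear form on `H`: it is `1` on
`h_α` and `0` on the coroots of the other simple roots. -/
def fundWeight : Dual ℂ H := b.toCoweightBasis.coord i

lemma fundWeight_root_eq_zero {χ : H → ℂ} (hχ : χ ∈ levels b i {0}) :
    χ ((IsKilling.cartanEquivDual H).symm (fundWeight b i)) = 0 := by
  obtain ⟨f, rfl, n, rfl, hn⟩ := hχ
  have key : ∀ j : b.support, j ≠ i → b.toWeightBasis j
      ((IsKilling.cartanEquivDual H).symm (fundWeight b i)) = 0 := by
    intro j hj
    have hw : fundWeight b i (IsKilling.coroot (j : H.root).1) = 0 := by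
      have : IsKilling.coroot (j : H.root).1 = b.toCoweightBasis j := by simp
      rw [this, fundWeight, Basis.coord_apply, Basis.repr_self, Finsupp.single_eq_of_ne hj.symm]
    have ht := IsKilling.traceForm_coroot (j : H.root).1
      ((IsKilling.cartanEquivDual H).symm (fundWeight b i))
    have hd : traceForm ℂ H L ((IsKilling.cartanEquivDual H).symm (fundWeight b i))
        (IsKilling.coroot (j : H.root).1) = 0 := by
      change IsKilling.cartanEquivDual H _ _ = 0
      rw [LinearEquiv.apply_symm_apply, hw]
    rw [LieModule.traceForm_comm ℂ H L, hd] at ht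
    have hne := IsKilling.root_apply_cartanEquivDual_symm_ne_zero
      (LieSubalgebra.isNonZero_coe_root (j : H.root))
    have hr : b.toWeightBasis j = (IsKilling.rootSystem H).root j := by simp
    rw [hr]
    simpa [hne] using ht.symm
  rw [← b.toWeightBasis.sum_repr f, LinearMap.sum_apply]
  refine Finset.sum_eq_zero fun j _ ↦ ?_
  by_cases hj : j = i
  · subst hj
    rw [Basis.coord_apply] at hn
    simp [hn]
  · rw [LinearMap.smul_apply, key j hj, smul_zero]

lemma fundWeight_eq_zero {h : H} (hh : (h : L) ∈ gS b i) : fundWeight b i h = 0 := by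
  set t := (IsKilling.cartanEquivDual H).symm (fundWeight b i) with ht
  have hcomm : ∀ x ∈ levi b i, ⁅(t : L), x⁆ = 0 := by
    intro x hx
    change x ∈ gradedPart b i {0} at hx
    unfold gradedPart at hx
    induction hx using LieSubmodule.iSup_induction' with
    | zero => simp
    | add _ _ _ _ hu hv => rw [lie_add, hu, hv, add_zero]
    | mem χ u hu =>
      by_cases hχ : χ ∈ levels b i {0}; swap
      · simp_all
      replace hu : u ∈ rootSpace H χ := by simpa [hχ] using hu
      have e : ⁅(t : L), u⁆ = χ t • u := IsKilling.lie_eq_smul_of_mem_rootSpace hu t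
      rw [e, fundWeight_root_eq_zero b i hχ, zero_smul]
  have hk : ∀ z ∈ gS b i, killingForm ℂ L t z = 0 := by
    intro z hz
    induction hz using Submodule.span_induction with
    | mem z hz =>
      obtain ⟨x, hx, y, hy, rfl⟩ := hz
      have := LieModule.traceForm_apply_lie_apply ℂ L L (t : L) x y
      rw [killingForm, ← this, hcomm x hx, map_zero, LinearMap.zero_apply]
    | zero => simp
    | add _ _ _ _ h₁ h₂ => rw [map_add, h₁, h₂, add_zero]
    | smul c _ _ h₁ => rw [map_smul, h₁, smul_zero]
  have e : fundWeight b i h = IsKilling.cartanEquivDual H t h := by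
    rw [ht, LinearEquiv.apply_symm_apply]
  rw [e]
  exact hk _ hh

/-- The linear form `ω_α` on `H / (H ∩ 𝔤_S)` that sends the image of `h_α` to `1`. -/
def omega : Dual ℂ (CartanQuot b i) :=
  Submodule.liftQ _ (fundWeight b i) fun _ hh ↦ fundWeight_eq_zero b i hh

lemma omega_hAlpha : omega b i (toQuot b i (hAlpha b i)) = 1 := by
  change b.toCoweightBasis.coord i (IsKilling.coroot (i : H.root).1) = 1
  have : IsKilling.coroot (i : H.root).1 = b.toCoweightBasis i := by simp
  rw [this, Basis.coord_apply, Basis.repr_self, Finsupp.single_eq_same]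

open scoped Classical in
/-- `ρ^S`: half the sum of the roots of `H` in `𝔲⁺`. -/
def rhoS : Dual ℂ H :=
  (1 / 2 : ℂ) • ∑ β ∈ H.root.filter (fun β : Weight ℂ H L ↦ (β : H → ℂ) ∈ levels b i (Set.Ioi 0)),
    Weight.toLinear ℂ H L β

/-! ### Vectors of type (Hol wt `λ`) and scalar generalized Verma modules -/

/-- The universal enveloping algebra of a complex Lie algebra. -/
abbrev U (M : Type*) [LieRing M] [LieAlgebra ℂ M] := UniversalEnvelopingAlgebra ℂ M

/-- The canonical map `L → U(L)`. -/
abbrev inj (x : L) : U L := UniversalEnvelopingAlgebra.ι ℂ x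

/-- The canonical map `U(K) → U(L)` for a Lie subalgebra `K` of `L`. -/
def envIncl (K : LieSubalgebra ℂ L) : U K →ₐ[ℂ] U L :=
  UniversalEnvelopingAlgebra.lift ℂ ((UniversalEnvelopingAlgebra.ι ℂ).comp K.incl)

/-- `v` satisfies (Hol wt `lam`): `X v = lam (pr X) v` for all `X ∈ 𝔭`. -/
def IsHolWt (lam : Dual ℂ (CartanQuot b i)) {V : Type*} [AddCommGroup V] [Module (U L) V]
    (v : V) : Prop :=
  ∀ X : parabolic b i, inj (X : L) • v = algebraMap ℂ (U L) (lam (pr b i X)) • v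

/-- The character `lam ∘ pr` of the Lie algebra `𝔭`. -/
def character (lam : Dual ℂ (CartanQuot b i)) : LieCharacter ℂ (parabolic b i) where
  toLinearMap := lam ∘ₗ pr b i
  map_lie' := by
    intro x y
    change lam (pr b i ⁅x, y⁆) = ⁅lam (pr b i x), lam (pr b i y)⁆
    rw [pr_eq_zero b i _ (lie_mem_prKer b i x.2 y.2), map_zero,
      LieRing.of_associative_ring_bracket, mul_comm, sub_self]

/-- The action of `U(𝔭)` on the one-dimensional module `ℂ e_lam`, on which `𝔭` acts by
`lam ∘ pr`. -/
def scalarAction (lam : Dual ℂ (CartanQuot b i)) : U (parabolic b i) →ₐ[ℂ] ℂ :=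
  UniversalEnvelopingAlgebra.lift ℂ (character b i lam)

/-- The relations `a p ⊗ z = a ⊗ p z` (`a ∈ U(L)`, `p ∈ U(𝔭)`, `z ∈ ℂ e_lam`) which define the
tensor product over `U(𝔭)` as a quotient of the tensor product over `ℂ`. -/
def vermaRel (lam : Dual ℂ (CartanQuot b i)) : Submodule (U L) (U L ⊗[ℂ] ℂ) :=
  Submodule.span (U L) {t | ∃ (a : U L) (p : U (parabolic b i)) (z : ℂ),
    t = (a * envIncl _ p) ⊗ₜ[ℂ] z - a ⊗ₜ[ℂ] (scalarAction b i lam p * z)}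

/-- The scalar generalized Verma module `U(L) ⊗_{U(𝔭)} ℂ e_lam`, a left `U(L)`-module. -/
abbrev ScalarVerma (lam : Dual ℂ (CartanQuot b i)) : Type u :=
  (U L ⊗[ℂ] ℂ) ⧸ vermaRel b i lam

/-- The element `a ⊗ e_lam` of the scalar generalized Verma module. -/
def tens (lam : Dual ℂ (CartanQuot b i)) (a : U L) : ScalarVerma b i lam :=
  (vermaRel b i lam).mkQ (a ⊗ₜ[ℂ] 1)

/-! ### The invariants of `𝔤_S` in `U(𝔲⁻)` -/

/-- The algebra `U(𝔲⁻)^{𝔤_S}` of invariants for the adjoint action: the elements of `U(𝔲⁻)` which,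
in `U(L)`, commute with all elements of `𝔤_S`. -/
def invariants : Subalgebra ℂ (U (uMinus b i)) :=
  (Subalgebra.centralizer ℂ (inj '' (gS b i : Set L))).comap (envIncl (uMinus b i))

/-- `U(𝔲⁻)^{𝔤_S} = ℂ[w]` is the polynomial algebra in the single generator `w`. -/
def IsPolyGenerator (w : U (uMinus b i)) : Prop :=
  Transcendental ℂ w ∧ invariants b i = Algebra.adjoin ℂ {w}

/-- `w` is a weight vector of weight `-2 ω_α` for the adjoint action of `H` on `U(𝔲⁻)`. -/
def HasWeightNegTwoOmega (w : U (uMinus b i)) : Prop :=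
  ∀ h : H, inj (h : L) * envIncl _ w - envIncl _ w * inj (h : L) =
    (-2 * omega b i (toQuot b i h)) • envIncl _ w

end HermitianParabolic

end

open HermitianParabolic

/-!
The grading element `z` of `𝔥`, on which a root takes as value its coefficient along `α`, defines a
grading of `𝔤` with parts `𝔲⁻`, `𝔯`, `𝔲⁺` in degrees `-1`, `0`, `1`: a root with a larger coefficient
would contradict the commutativity of `𝔲⁺` (`root_level`). With `κ` the Killing form, `𝔤_S` is the
orthogonal complement of `z` in `𝔯`, so that a form `λ` on `𝔥 / (𝔥 ∩ 𝔤_S)` amounts to the number `a`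
with `λ ∘ pr = a κ(z, ·)` (`charParam`). The argument takes place in the structure `ShortGrading`.

*The polynomial model.* `U(𝔲⁻)` is an algebra of polynomials in `n = dim 𝔲⁻` variables. On it `𝔤`
acts as on `M(λ)`: `𝔲⁻` by multiplication, `𝔯` by derivations plus the character `a κ(z, ·)`, and `𝔲⁺`
by differential operators of order two (`rho`). That this is a representation (`compat`) holds because
an operator that kills `1` and commutes with the variables is zero. The model shows that `U(𝔲⁻)` acts
freely on the generator of `M(λ)`, without the Poincaré–Birkhoff–Witt theorem, and it maps onto every
module generated by a vector `e` of type (Hol wt `λ`), by `p ↦ p e`.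

*The weights.* A vector `e'` of type (Hol wt `λ'`) in such a module comes from a homogeneous polynomial,
by the action of `z`, and even from one that is invariant under `𝔤_S`
(`PositiveFrame.exists_invariant`). Instead of complete reducibility this uses the generalized kernel
of the Casimir operator of `𝔤_S`, on which `𝔤_S` acts by zero since the traces of the terms of the
Casimir operator are nonnegative. On an invariant `q` of degree `m`, an element `x` of `𝔲⁺` acts by the
scalar `a - (m - n) / (2 κ(z, z))` times the derivative of `q` along `x` (`IsVacuum.rho_semiInv`). Hence
`𝔲⁺` kills `q e ≠ 0`, with `m ≠ 0`, if and only if `a = (m - n) / (2 κ(z, z))`; in the other cases all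
derivatives of `q` kill `e`, and so does `q`, by the Euler identity. Moreover `λ'` belongs to
`a - m / κ(z, z)`.

*The invariants.* If `q` is a nonconstant homogeneous invariant and `q(x) ≠ 0` for a point `x` of `𝔲⁺`,
then the gradient of `q` at `x` is, up to scaling, an element `y` of `𝔲⁻` with `[x, y] = z`
(`SemiInv.exists_lie_eq_z`). So the orbit of `x` is open, and a homogeneous invariant is determined by
its degree and its value at `x` (`SemiInv.exists_eq_smul`). Since irreducible factors of homogeneous
invariants are again such, all of them are powers of a single irreducible one, `w`, up to scalars
(`exists_generator`). Its weight under `h_α` is `-2` (`IsDiagonal.weight_eq_two`): on the coordinates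
where `h_α` has even eigenvalues, `w` is a monomial in the coordinate of `α` times a polynomial in the
others, and an exponent larger than `1` contradicts the irreducibility of `w`.

If `d` is the degree of `w`, then `m = k d`, and as `d κ(z, h_α) = 2 κ(z, z)` and
`ρ^S(h_α) = n κ(z, h_α) / (2 κ(z, z))`, the values of `a` above are those of the weights
`(±k - ρ^S(h_α)) ω_α`. Conversely, for these weights `w ^ k ⊗ e_λ` is killed by `𝔲⁺` and defines a
homomorphism, and uniqueness follows from that of the invariants of given degree.
-/

/-! ### Polynomials and derivations -/

namespace MvPolynomial

variable {σ : Type*}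

theorem pderiv_comm' (i j : σ) (f : MvPolynomial σ ℂ) :
    pderiv i (pderiv j f) = pderiv j (pderiv i f) := by
  classical
  have h : ⁅(pderiv i : Derivation ℂ (MvPolynomial σ ℂ) (MvPolynomial σ ℂ)),
      (pderiv j : Derivation ℂ (MvPolynomial σ ℂ) (MvPolynomial σ ℂ))⁆ = 0 := by
    refine derivation_ext fun k ↦ ?_
    rw [Derivation.commutator_apply, pderiv_X, pderiv_X]
    rcases eq_or_ne k j with rfl | h1 <;> rcases eq_or_ne k i with rfl | h2 <;> simp [*]
  have := congrArg (fun D ↦ D f) h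
  simpa [Derivation.commutator_apply, sub_eq_zero] using this

theorem derivation_apply_eq_sum [Fintype σ] (D : Derivation ℂ (MvPolynomial σ ℂ) (MvPolynomial σ ℂ))
    (f : MvPolynomial σ ℂ) : D f = ∑ j, D (X j) * pderiv j f := by
  classical
  induction f using MvPolynomial.induction_on with
  | C a => simp
  | add p q hp hq => simp only [map_add, hp, hq, mul_add, Finset.sum_add_distrib]
  | mul_X p k hp =>
    rw [Derivation.leibniz, hp, smul_eq_mul, smul_eq_mul, Finset.mul_sum]
    simp only [pderiv_mul, pderiv_X, mul_add, Finset.sum_add_distrib]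
    have : ∑ j, D (X j) * (p * (Pi.single j 1 : σ → MvPolynomial σ ℂ) k) = D (X k) * p := by
      rw [Finset.sum_eq_single k]
      · simp
      · intro j _ hj
        simp [Pi.single_eq_of_ne hj.symm]
      · simp
    rw [this, add_comm]
    congr 1
    · exact Finset.sum_congr rfl fun _ _ ↦ by ring
    · ring

/-- In characteristic zero, a polynomial killed by `∂/∂xₖ` does not involve `xₖ`. -/
theorem apply_eq_zero_of_pderiv_eq_zero {k : σ} {f : MvPolynomial σ ℂ} (h : pderiv k f = 0)
    {m : σ →₀ ℕ} (hm : coeff m f ≠ 0) : m k = 0 := by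
  classical
  by_contra hk
  have h1 := congrArg (coeff (m - Finsupp.single k 1)) h
  have h2 : m - Finsupp.single k 1 + Finsupp.single k 1 = m :=
    tsub_add_cancel_of_le (by simpa [Nat.one_le_iff_ne_zero] using hk)
  rw [coeff_pderiv, h2, coeff_zero, mul_eq_zero] at h1
  rcases h1 with h1 | h1
  · exact hm h1
  · norm_cast at h1

theorem eq_C_of_pderiv_eq_zero {f : MvPolynomial σ ℂ} (h : ∀ k, pderiv k f = 0) :
    ∃ c, f = C c := by
  classical
  refine ⟨coeff 0 f, ?_⟩
  ext m
  rw [coeff_C]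
  split_ifs with hm
  · rw [hm]
  · by_contra hc
    refine hm (Finsupp.ext fun k ↦ ?_)
    exact (apply_eq_zero_of_pderiv_eq_zero (h k) hc).symm

theorem totalDegree_pderiv_lt {k : σ} {f : MvPolynomial σ ℂ} (h : pderiv k f ≠ 0) :
    (pderiv k f).totalDegree < f.totalDegree := by
  classical
  obtain ⟨m, hm, hd⟩ := Finset.exists_mem_eq_sup _ (support_nonempty.2 h)
    (fun s : σ →₀ ℕ ↦ s.sum fun _ e ↦ e)
  have h1 : coeff (m + Finsupp.single k 1) f ≠ 0 := by
    intro hc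
    rw [mem_support_iff, coeff_pderiv, hc, zero_mul] at hm
    exact hm rfl
  have h2 := le_totalDegree (mem_support_iff.2 h1)
  rw [totalDegree, hd]
  refine lt_of_lt_of_le ?_ h2
  rw [Finsupp.sum_add_index' (by simp) (by simp)]
  simp

/-- The polynomials all of whose partial derivatives of order at most `n` are killed by `φ`. -/
noncomputable def vanishing {A : Type*} [CommRing A] [Algebra ℂ A] (φ : MvPolynomial σ ℂ →ₐ[ℂ] A) :
    ℕ → Submodule ℂ (MvPolynomial σ ℂ)
  | 0 => LinearMap.ker φ.toLinearMap
  | n + 1 => vanishing φ n ⊓ ⨅ k, (vanishing φ n).comap (pderiv k).toLinearMap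

section vanishing

variable {A : Type*} [CommRing A] [Algebra ℂ A] {φ : MvPolynomial σ ℂ →ₐ[ℂ] A}

theorem mem_vanishing_zero {f : MvPolynomial σ ℂ} : f ∈ vanishing φ 0 ↔ φ f = 0 := by
  simp [vanishing]

theorem mem_vanishing_succ {n : ℕ} {f : MvPolynomial σ ℂ} :
    f ∈ vanishing φ (n + 1) ↔ f ∈ vanishing φ n ∧ ∀ k, pderiv k f ∈ vanishing φ n := by
  simp [vanishing]

theorem pderiv_mem_vanishing {k : σ} (hk : ∀ e, φ e = 0 → φ (pderiv k e) = 0) :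
    ∀ {n : ℕ} {f : MvPolynomial σ ℂ}, f ∈ vanishing φ n → pderiv k f ∈ vanishing φ n
  | 0, f, hf => by
    rw [mem_vanishing_zero] at hf ⊢
    exact hk f hf
  | n + 1, f, hf => by
    rw [mem_vanishing_succ] at hf ⊢
    refine ⟨hf.2 k, fun l ↦ ?_⟩
    rw [pderiv_comm']
    exact pderiv_mem_vanishing hk (hf.2 l)

/-- A polynomial that vanishes to infinite order along `φ` is zero. -/
theorem eq_zero_of_forall_mem_vanishing (K : Set σ)
    (h4 : ∀ g : MvPolynomial σ ℂ, (∀ k ∈ K, pderiv k g = 0) → φ g = 0 → g = 0)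
    (g : MvPolynomial σ ℂ) (hg : ∀ n, g ∈ vanishing φ n) : g = 0 := by
  induction hd : g.totalDegree using Nat.strong_induction_on generalizing g with
  | _ d ih =>
    refine h4 g (fun k _ ↦ ?_) (mem_vanishing_zero.1 (hg 0))
    by_contra h
    exact h (ih _ (hd ▸ totalDegree_pderiv_lt h) _
      (fun n ↦ (mem_vanishing_succ.1 (hg (n + 1))).2 k) rfl)

/-- Let `D z` be derivations with linear coefficients whose values, seen through `φ`, control the
derivatives in the directions `K`. Then a common eigenvector of all `D z` that is killed by `φ` is
zero: its vanishing order along `φ` can be increased indefinitely. -/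
theorem eq_zero_of_common_eigenvector [Fintype σ] {Z : Type*}
    (D : Z → Derivation ℂ (MvPolynomial σ ℂ) (MvPolynomial σ ℂ))
    (hD : ∀ z j k, ∃ c : ℂ, pderiv k (D z (X j)) = C c) (K : Set σ)
    (h1 : ∀ j ∉ K, ∀ e, φ e = 0 → φ (pderiv j e) = 0)
    (h3 : ∀ e, (∀ z, φ (D z e) = 0) → (∀ j ∉ K, φ (pderiv j e) = 0) →
      ∀ k ∈ K, φ (pderiv k e) = 0)
    (h4 : ∀ g : MvPolynomial σ ℂ, (∀ k ∈ K, pderiv k g = 0) → φ g = 0 → g = 0)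
    (g : MvPolynomial σ ℂ) (χ : Z → ℂ) (hg : ∀ z, D z g = C (χ z) * g) (h0 : φ g = 0) : g = 0 := by
  choose c hc using hD
  have hcomm (z : Z) (k : σ) (e : MvPolynomial σ ℂ) :
      D z (pderiv k e) = pderiv k (D z e) - ∑ j, c z j k • pderiv j e := by
    rw [derivation_apply_eq_sum (D z) e, map_sum, ← Finset.sum_sub_distrib,
      derivation_apply_eq_sum (D z) (pderiv k e)]
    refine Finset.sum_congr rfl fun j _ ↦ ?_
    rw [pderiv_mul, hc, pderiv_comm' k j, smul_eq_C_mul]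
    ring
  have key : ∀ (n : ℕ) (e : MvPolynomial σ ℂ), e ∈ vanishing φ n → (∀ z, D z e ∈ vanishing φ n) →
      e ∈ vanishing φ (n + 1) := by
    intro n
    induction n with
    | zero =>
      intro e he hz
      simp only [mem_vanishing_succ, mem_vanishing_zero] at he hz ⊢
      refine ⟨he, fun k ↦ ?_⟩
      by_cases hk : k ∈ K
      · exact h3 e hz (fun j hj ↦ h1 j hj e he) k hk
      · exact h1 k hk e he
    | succ n ih =>
      intro e he hz
      rw [mem_vanishing_succ]
      refine ⟨he, fun k ↦ ?_⟩
      by_cases hk : k ∈ K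
      · refine ih _ ((mem_vanishing_succ.1 he).2 k) fun z ↦ ?_
        rw [hcomm]
        exact sub_mem ((mem_vanishing_succ.1 (hz z)).2 k)
          (sum_mem fun j _ ↦ Submodule.smul_mem _ _ ((mem_vanishing_succ.1 he).2 j))
      · exact pderiv_mem_vanishing (h1 k hk) he
  refine eq_zero_of_forall_mem_vanishing K h4 g fun n ↦ ?_
  induction n with
  | zero => exact mem_vanishing_zero.2 h0
  | succ n ih =>
    refine key n g ih fun z ↦ ?_
    rw [hg, ← smul_eq_C_mul]
    exact Submodule.smul_mem _ _ ih

end vanishing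

/-- The algebra endomorphism that sets the variables in `K` to zero. -/
noncomputable def restrictZero (K : Set σ) : MvPolynomial σ ℂ →ₐ[ℂ] MvPolynomial σ ℂ :=
  open scoped Classical in aeval fun j ↦ if j ∈ K then 0 else X j

section restrictZero

variable {K : Set σ}

theorem restrictZero_C (a : ℂ) : restrictZero K (C a) = C a := AlgHom.commutes _ a

theorem restrictZero_X_of_mem {j : σ} (h : j ∈ K) : restrictZero K (X j) = 0 := by
  simp [restrictZero, h]

theorem restrictZero_X_of_notMem {j : σ} (h : j ∉ K) : restrictZero K (X j) = X j := by
  simp [restrictZero, h]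

theorem restrictZero_pderiv {j : σ} (hj : j ∉ K) (f : MvPolynomial σ ℂ) :
    restrictZero K (pderiv j f) = pderiv j (restrictZero K f) := by
  classical
  induction f using MvPolynomial.induction_on with
  | C a => simp
  | add p q hp hq => simp [hp, hq]
  | mul_X p k hp =>
    have e : restrictZero K (pderiv j (X k)) = pderiv j (restrictZero K (X k)) := by
      by_cases hk : k ∈ K
      · have : k ≠ j := fun h ↦ hj (h ▸ hk)
        rw [restrictZero_X_of_mem hk, pderiv_X_of_ne this, map_zero, map_zero]
      · rw [restrictZero_X_of_notMem hk, pderiv_X]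
        rcases eq_or_ne k j with rfl | h
        · simp
        · rw [Pi.single_eq_of_ne h, map_zero]
    simp only [pderiv_mul, map_add, map_mul (restrictZero K), hp, e]

theorem restrictZero_eq_self {f : MvPolynomial σ ℂ} (h : ∀ k ∈ K, pderiv k f = 0) :
    restrictZero K f = f := by
  conv_lhs => rw [f.as_sum]
  conv_rhs => rw [f.as_sum]
  rw [map_sum]
  refine Finset.sum_congr rfl fun m hm ↦ ?_
  rw [mem_support_iff] at hm
  rw [monomial_eq, map_mul, map_finsuppProd]
  simp only [map_pow]
  congr 1
  · exact restrictZero_C _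
  refine Finset.prod_congr rfl fun j hj ↦ ?_
  by_cases hjK : j ∈ K
  · exact absurd (apply_eq_zero_of_pderiv_eq_zero (h j hjK) hm) (Finsupp.mem_support_iff.1 hj)
  · exact congrArg (· ^ m j) (restrictZero_X_of_notMem hjK)

theorem eval_restrictZero {v : σ → ℂ} (hv : ∀ k ∈ K, v k = 0) (f : MvPolynomial σ ℂ) :
    eval v (restrictZero K f) = eval v f := by
  induction f using MvPolynomial.induction_on with
  | C a => simp
  | add p q hp hq => simp [hp, hq]
  | mul_X p k hp =>
    rw [map_mul, map_mul, map_mul, hp]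
    congr 1
    by_cases hk : k ∈ K
    · simp [restrictZero_X_of_mem hk, hv k hk]
    · simp [restrictZero_X_of_notMem hk]

open scoped Classical in
theorem eval_restrictZero' (v : σ → ℂ) (f : MvPolynomial σ ℂ) :
    eval v (restrictZero K f) = eval (fun j ↦ if j ∈ K then 0 else v j) f := by
  induction f using MvPolynomial.induction_on with
  | C a => simp
  | add p q hp hq => simp [hp, hq]
  | mul_X p k hp =>
    rw [map_mul, map_mul, map_mul, hp]
    congr 1
    by_cases hk : k ∈ K
    · simp [restrictZero_X_of_mem hk, hk]
    · simp [restrictZero_X_of_notMem hk, hk]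

end restrictZero

/-- A linear operator on polynomials that commutes with multiplication by the variables and kills
`1` is zero. -/
theorem linearMap_eq_zero {T : MvPolynomial σ ℂ →ₗ[ℂ] MvPolynomial σ ℂ} (h1 : T 1 = 0)
    (hX : ∀ j f, T (X j * f) = X j * T f) : T = 0 := by
  refine LinearMap.ext fun f ↦ ?_
  induction f using MvPolynomial.induction_on with
  | C a => rw [← mul_one (C a), ← smul_eq_C_mul, map_smul, h1, smul_zero, LinearMap.zero_apply]
  | add p q hp hq => rw [map_add, hp, hq, map_add]
  | mul_X p k hp => rw [mul_comm, hX, hp, LinearMap.zero_apply, mul_zero, LinearMap.zero_apply]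

end MvPolynomial

/-! ### Short gradings and the polynomial model of scalar generalized Verma modules -/

/-- A `{-1, 0, 1}`-grading of a Lie algebra with Killing form `κ`, given by its grading element `z`,
together with a basis `f` of the part of degree `-1` and the dual family `e` in degree `1`. The part
of degree `0` is required to be spanned by `z` and by commutators. -/
structure ShortGrading (ι L : Type*) [Fintype ι] [DecidableEq ι] [LieRing L] [LieAlgebra ℂ L] where
  /-- the grading element -/
  z : L
  /-- the basis of the part of degree `-1` -/
  f : ι → L
  /-- the dual family in degree `1` -/
  e : ι → L
  lie_z_cube : ∀ x : L, ⁅z, ⁅z, ⁅z, x⁆⁆⁆ = ⁅z, x⁆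
  lie_z_f : ∀ j, ⁅z, f j⁆ = -f j
  lie_z_e : ∀ j, ⁅z, e j⁆ = e j
  killing_e_f : ∀ j k, killingForm ℂ L (e j) (f k) = if j = k then 1 else 0
  expand : ∀ y : L, ⁅z, y⁆ = -y → y = ∑ j, killingForm ℂ L (e j) y • f j
  killing_z_z : killingForm ℂ L z z ≠ 0
  mem_span_of_killing_z : ∀ x : L, ⁅z, x⁆ = 0 → killingForm ℂ L z x = 0 →
    x ∈ Submodule.span ℂ {t | ∃ a b : L, ⁅z, a⁆ = 0 ∧ ⁅z, b⁆ = 0 ∧ ⁅a, b⁆ = t}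

namespace ShortGrading

open MvPolynomial

variable {ι L : Type*} [Fintype ι] [DecidableEq ι] [LieRing L] [LieAlgebra ℂ L]
  (S : ShortGrading ι L)

local notation "κ" => killingForm ℂ L

theorem killing_lie (x y w : L) : κ ⁅x, y⁆ w = κ x ⁅y, w⁆ :=
  LieModule.traceForm_apply_lie_apply ℂ L L x y w

theorem killing_lie' (x y w : L) : κ ⁅x, y⁆ w = -κ y ⁅x, w⁆ := by
  rw [← lie_skew, map_neg, LinearMap.neg_apply, killing_lie]

theorem killing_comm (x y : L) : κ x y = κ y x := LieModule.traceForm_comm ℂ L L x y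

/-- The part of degree `n` of a short grading. -/
noncomputable def lev (n : ℤ) : Submodule ℂ L := Module.End.eigenspace (ad ℂ L S.z) (n : ℂ)

variable {S}

theorem mem_lev {n : ℤ} {x : L} : x ∈ S.lev n ↔ ⁅S.z, x⁆ = (n : ℂ) • x := by
  rw [lev, Module.End.mem_eigenspace_iff, ad_apply]

theorem mem_lev_zero {x : L} : x ∈ S.lev 0 ↔ ⁅S.z, x⁆ = 0 := by simp [mem_lev]

theorem mem_lev_one {x : L} : x ∈ S.lev 1 ↔ ⁅S.z, x⁆ = x := by simp [mem_lev]

theorem mem_lev_neg_one {x : L} : x ∈ S.lev (-1) ↔ ⁅S.z, x⁆ = -x := by simp [mem_lev]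

theorem lie_mem_lev {m n : ℤ} {x y : L} (hx : x ∈ S.lev m) (hy : y ∈ S.lev n) :
    ⁅x, y⁆ ∈ S.lev (m + n) := by
  rw [mem_lev] at hx hy ⊢
  rw [leibniz_lie, hx, hy, smul_lie, lie_smul, ← add_smul]
  push_cast; rfl

theorem lie_mem_lev_of_eq {m n k : ℤ} (h : m + n = k) {x y : L} (hx : x ∈ S.lev m)
    (hy : y ∈ S.lev n) : ⁅x, y⁆ ∈ S.lev k :=
  h ▸ lie_mem_lev hx hy

theorem eq_zero_of_mem_lev {n : ℤ} (hn : (n ^ 3 - n : ℤ) ≠ 0) {x : L} (hx : x ∈ S.lev n) :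
    x = 0 := by
  have h := S.lie_z_cube x
  rw [mem_lev] at hx
  simp only [hx, lie_smul, smul_smul] at h
  rw [← sub_eq_zero, ← sub_smul, smul_eq_zero] at h
  refine h.resolve_left fun h ↦ hn ?_
  have : ((n ^ 3 - n : ℤ) : ℂ) = 0 := by push_cast; rw [← h]; ring
  exact_mod_cast this

theorem f_mem (j : ι) : S.f j ∈ S.lev (-1) := mem_lev_neg_one.2 (S.lie_z_f j)

theorem e_mem (j : ι) : S.e j ∈ S.lev 1 := mem_lev_one.2 (S.lie_z_e j)

theorem z_mem : S.z ∈ S.lev 0 := mem_lev_zero.2 (lie_self _)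

theorem lie_eq_zero_of_mem_neg_one {x y : L} (hx : x ∈ S.lev (-1)) (hy : y ∈ S.lev (-1)) :
    ⁅x, y⁆ = 0 :=
  eq_zero_of_mem_lev (n := -1 + -1) (by norm_num) (lie_mem_lev hx hy)

theorem lie_eq_zero_of_mem_one {x y : L} (hx : x ∈ S.lev 1) (hy : y ∈ S.lev 1) :
    ⁅x, y⁆ = 0 :=
  eq_zero_of_mem_lev (n := 1 + 1) (by norm_num) (lie_mem_lev hx hy)

theorem killing_eq_zero {m n : ℤ} (h : m + n ≠ 0) {x y : L} (hx : x ∈ S.lev m)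
    (hy : y ∈ S.lev n) : κ x y = 0 := by
  rw [mem_lev] at hx hy
  have h1 := killing_lie' S.z x y
  rw [hx, hy, map_smul, LinearMap.smul_apply, map_smul, smul_eq_mul, smul_eq_mul] at h1
  have h2 : ((m + n : ℤ) : ℂ) * κ x y = 0 := by push_cast; linear_combination h1
  exact (mul_eq_zero.1 h2).resolve_left (by exact_mod_cast h)

variable (S) in
theorem exists_add (x : L) : ∃ a ∈ S.lev (-1), ∃ b ∈ S.lev 0, ∃ c ∈ S.lev 1, x = a + b + c := by
  refine ⟨(2⁻¹ : ℂ) • (⁅S.z, ⁅S.z, x⁆⁆ - ⁅S.z, x⁆), ?_, x - ⁅S.z, ⁅S.z, x⁆⁆, ?_,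
    (2⁻¹ : ℂ) • (⁅S.z, ⁅S.z, x⁆⁆ + ⁅S.z, x⁆), ?_, ?_⟩
  · rw [mem_lev_neg_one, lie_smul, lie_sub, S.lie_z_cube, ← smul_neg, neg_sub]
  · rw [mem_lev_zero, lie_sub, S.lie_z_cube, sub_self]
  · rw [mem_lev_one, lie_smul, lie_add, S.lie_z_cube, add_comm]
  · module

theorem lev_induction {p : L → Prop} (hadd : ∀ x y, p x → p y → p (x + y))
    (h1 : ∀ x ∈ S.lev (-1), p x) (h2 : ∀ x ∈ S.lev 0, p x) (h3 : ∀ x ∈ S.lev 1, p x) (x : L) :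
    p x := by
  obtain ⟨a, ha, b, hb, c, hc, rfl⟩ := S.exists_add x
  exact hadd _ _ (hadd _ _ (h1 a ha) (h2 b hb)) (h3 c hc)

theorem eq_sum_of_mem {y : L} (hy : y ∈ S.lev (-1)) : y = ∑ j, κ (S.e j) y • S.f j :=
  S.expand y (mem_lev_neg_one.1 hy)

theorem eq_zero_of_killing [IsKilling ℂ L] {x : L} {n : ℤ} (hx : x ∈ S.lev n)
    (h : ∀ y ∈ S.lev (-n), κ y x = 0) : x = 0 := by
  have h0 : ∀ y, κ y x = 0 := by
    refine S.lev_induction (p := fun y ↦ κ y x = 0) (fun a b ha hb ↦ ?_) ?_ ?_ ?_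
    · rw [map_add, LinearMap.add_apply, ha, hb, add_zero]
    all_goals
      intro a ha
      by_contra hc
      refine hc (h _ ?_)
      convert ha using 2
      by_contra hne
      exact hc (killing_eq_zero (by omega) ha hx)
  have := IsKilling.killingForm_nondegenerate ℂ L
  exact this.1 x fun y ↦ by rw [killing_comm]; exact h0 y

theorem exists_of_eq_killing (v : ι → ℂ) : ∃ x ∈ S.lev 1, ∀ j, κ x (S.f j) = v j := by
  refine ⟨∑ j, v j • S.e j, sum_mem fun j _ ↦ Submodule.smul_mem _ _ (e_mem j), fun k ↦ ?_⟩
  simp [S.killing_e_f]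

variable (S)

/-- The coordinate map onto the part of degree `-1`, with values in linear polynomials. -/
noncomputable def ell : L →ₗ[ℂ] MvPolynomial ι ℂ :=
  ∑ j, (κ (S.e j)).smulRight (X j)

theorem ell_apply (x : L) : S.ell x = ∑ j, κ (S.e j) x • X j := by
  simp [ell]

theorem ell_f (j : ι) : S.ell (S.f j) = X j := by
  simp [ell_apply, S.killing_e_f]

variable {S}

theorem ell_eq_zero {n : ℤ} (hn : n ≠ -1) {x : L} (hx : x ∈ S.lev n) : S.ell x = 0 := by
  rw [ell_apply]
  refine Finset.sum_eq_zero fun j _ ↦ ?_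
  rw [killing_eq_zero (by omega) (e_mem j) hx, zero_smul]

variable (S)

theorem pderiv_ell (k : ι) (x : L) : pderiv k (S.ell x) = C (κ (S.e k) x) := by
  rw [ell_apply, map_sum, Finset.sum_eq_single k]
  · rw [Derivation.map_smul, pderiv_X_self, smul_eq_C_mul, mul_one]
  · intro j _ hj
    rw [Derivation.map_smul, pderiv_X_of_ne hj, smul_zero]
  · simp

/-- The adjoint action of an element of degree `0` on polynomials; elements of degree `±1` act by
zero. -/
noncomputable def der : L →ₗ[ℂ] Derivation ℂ (MvPolynomial ι ℂ) (MvPolynomial ι ℂ) where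
  toFun x := mkDerivation ℂ fun j ↦ S.ell ⁅x, S.f j⁆
  map_add' x y := derivation_ext fun j ↦ by simp
  map_smul' c x := derivation_ext fun j ↦ by simp

theorem der_X (x : L) (j : ι) : S.der x (X j) = S.ell ⁅x, S.f j⁆ := mkDerivation_X _ _ _

theorem der_apply (x : L) (p : MvPolynomial ι ℂ) :
    S.der x p = ∑ j, S.ell ⁅x, S.f j⁆ * pderiv j p := by
  simp_rw [derivation_apply_eq_sum (S.der x) p, der_X]

theorem der_ell (x : L) {y : L} (hy : y ∈ S.lev (-1)) : S.der x (S.ell y) = S.ell ⁅x, y⁆ := by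
  conv_lhs => rw [eq_sum_of_mem hy]
  conv_rhs => rw [eq_sum_of_mem hy]
  simp [ell_f, der_X, lie_sum]

theorem der_eq_zero {n : ℤ} (hn : n ≠ 0) {x : L} (hx : x ∈ S.lev n) : S.der x = 0 := by
  refine derivation_ext fun j ↦ ?_
  rw [der_X, ell_eq_zero (n := n + -1) (by omega) (lie_mem_lev hx (f_mem j))]
  simp

theorem der_lie {x y : L} (hx : x ∈ S.lev 0) (hy : y ∈ S.lev 0) (p : MvPolynomial ι ℂ) :
    S.der ⁅x, y⁆ p = S.der x (S.der y p) - S.der y (S.der x p) := by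
  have h : S.der ⁅x, y⁆ = ⁅S.der x, S.der y⁆ := by
    refine derivation_ext fun j ↦ ?_
    have h1 := lie_mem_lev hx (f_mem j)
    have h2 := lie_mem_lev hy (f_mem j)
    rw [Derivation.commutator_apply, der_X, der_X, der_X, der_ell _ _ h1, der_ell _ _ h2,
      ← map_sub, lie_lie]
  rw [h, Derivation.commutator_apply]

/-- The second order differential operator by which an element of degree `1` acts. -/
noncomputable def sec (a : ℂ) : L →ₗ[ℂ] MvPolynomial ι ℂ →ₗ[ℂ] MvPolynomial ι ℂ where
  toFun x := ∑ j, (a * κ S.z ⁅x, S.f j⁆) • (pderiv j).toLinearMap +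
    (2⁻¹ : ℂ) • ∑ j, ∑ k, LinearMap.mulLeft ℂ (S.ell ⁅⁅x, S.f j⁆, S.f k⁆) ∘ₗ
      (pderiv j).toLinearMap ∘ₗ (pderiv k).toLinearMap
  map_add' x y := by
    refine LinearMap.ext fun p ↦ ?_
    simp [mul_add, add_mul, add_smul, Finset.sum_add_distrib]
    abel
  map_smul' c x := by
    refine LinearMap.ext fun p ↦ ?_
    simp [Finset.smul_sum, smul_smul]
    congr 1
    · exact Finset.sum_congr rfl fun _ _ ↦ by congr 1; ring
    · exact Finset.sum_congr rfl fun _ _ ↦ Finset.sum_congr rfl fun _ _ ↦ by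
        rw [mul_comm]

theorem sec_apply (a : ℂ) (x : L) (p : MvPolynomial ι ℂ) :
    S.sec a x p = ∑ j, (a * κ S.z ⁅x, S.f j⁆) • pderiv j p +
      (2⁻¹ : ℂ) • ∑ j, ∑ k, S.ell ⁅⁅x, S.f j⁆, S.f k⁆ * pderiv j (pderiv k p) := by
  simp only [sec, LinearMap.coe_mk, AddHom.coe_mk, LinearMap.add_apply, LinearMap.smul_apply,
    LinearMap.sum_apply, LinearMap.comp_apply, LinearMap.mulLeft_apply]
  rfl

theorem sec_eq_zero (a : ℂ) {n : ℤ} (hn : n ≠ 1) {x : L} (hx : x ∈ S.lev n) : S.sec a x = 0 := by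
  refine LinearMap.ext fun p ↦ ?_
  rw [sec_apply, LinearMap.zero_apply]
  have h (j : ι) := lie_mem_lev hx (f_mem (S := S) j)
  have h1 (j : ι) : κ S.z ⁅x, S.f j⁆ = 0 := killing_eq_zero (by omega) z_mem (h j)
  have h2 (j k : ι) : S.ell ⁅⁅x, S.f j⁆, S.f k⁆ = 0 :=
    ell_eq_zero (by omega) (lie_mem_lev (h j) (f_mem k))
  simp only [h1, h2, mul_zero, zero_smul, zero_mul, Finset.sum_const_zero, smul_zero, add_zero]

/-- The operator by which `x` acts on the polynomial model of the scalar generalized Verma module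
whose highest weight is `a κ(z, ·)`. -/
noncomputable def rho (a : ℂ) : L →ₗ[ℂ] Module.End ℂ (MvPolynomial ι ℂ) :=
  LinearMap.mul ℂ (MvPolynomial ι ℂ) ∘ₗ S.ell +
    { toFun := fun x ↦ (S.der x).toLinearMap
      map_add' := fun x y ↦ by rw [map_add]; rfl
      map_smul' := fun c x ↦ by rw [map_smul]; rfl } +
    (a • κ S.z).smulRight LinearMap.id + S.sec a

theorem rho_apply (a : ℂ) (x : L) (p : MvPolynomial ι ℂ) :
    S.rho a x p = S.ell x * p + S.der x p + (a * κ S.z x) • p + S.sec a x p := by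
  simp [rho]

variable {S}

theorem rho_neg_one (a : ℂ) {x : L} (hx : x ∈ S.lev (-1)) (p : MvPolynomial ι ℂ) :
    S.rho a x p = S.ell x * p := by
  rw [rho_apply, S.der_eq_zero (by norm_num) hx, S.sec_eq_zero a (by norm_num) hx,
    killing_eq_zero (by norm_num) z_mem hx]
  simp

theorem rho_zero (a : ℂ) {x : L} (hx : x ∈ S.lev 0) (p : MvPolynomial ι ℂ) :
    S.rho a x p = S.der x p + (a * κ S.z x) • p := by
  rw [rho_apply, S.sec_eq_zero a (by norm_num) hx, ell_eq_zero (by norm_num) hx]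
  simp

theorem rho_one (a : ℂ) {x : L} (hx : x ∈ S.lev 1) (p : MvPolynomial ι ℂ) :
    S.rho a x p = S.sec a x p := by
  rw [rho_apply, S.der_eq_zero (by norm_num) hx, ell_eq_zero (by norm_num) hx,
    killing_eq_zero (by norm_num) z_mem hx]
  simp

theorem rho_f (a : ℂ) (j : ι) (p : MvPolynomial ι ℂ) : S.rho a (S.f j) p = X j * p := by
  rw [rho_neg_one a (f_mem j), ell_f]

theorem lie_lie_f_comm (x : L) (i j : ι) : ⁅⁅x, S.f i⁆, S.f j⁆ = ⁅⁅x, S.f j⁆, S.f i⁆ := by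
  rw [lie_lie x, lie_eq_zero_of_mem_neg_one (f_mem i) (f_mem j), lie_zero, zero_sub, lie_skew]

theorem sec_X_mul (a : ℂ) (x : L) (i : ι) (p : MvPolynomial ι ℂ) :
    S.sec a x (X i * p) = X i * S.sec a x p + S.der ⁅x, S.f i⁆ p + (a * κ S.z ⁅x, S.f i⁆) • p := by
  have h1 (j : ι) : pderiv j (X i * p) = X i * pderiv j p + if j = i then p else 0 := by
    rw [pderiv_mul, pderiv_X]
    split_ifs with h
    · subst h; simp [add_comm]
    · simp [Pi.single_eq_of_ne (Ne.symm h)]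
  have h2 (j k : ι) : pderiv j (pderiv k (X i * p)) = X i * pderiv j (pderiv k p) +
      (if j = i then pderiv k p else 0) + if k = i then pderiv j p else 0 := by
    rw [h1, map_add, pderiv_mul, pderiv_X]
    split_ifs with h h' h'
    · subst h; subst h'; simp; ring
    · subst h; simp [Pi.single_eq_of_ne (Ne.symm h')]
    · subst h'; simp; ring
    · simp [Pi.single_eq_of_ne (Ne.symm h')]
  simp only [sec_apply, h2]
  simp only [h1, smul_add, mul_add, Finset.sum_add_distrib, mul_ite, mul_zero,
    smul_ite, smul_zero, Finset.sum_ite_eq', Finset.mem_univ, if_true, Finset.mul_sum]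
  have h3 : ∑ j, ∑ k, (if j = i then S.ell ⁅⁅x, S.f j⁆, S.f k⁆ * pderiv k p else 0) =
      S.der ⁅x, S.f i⁆ p := by
    rw [Finset.sum_eq_single i (fun j _ hj ↦ by simp [hj]) (by simp), der_apply]
    simp
  have h4 : ∑ j, S.ell ⁅⁅x, S.f j⁆, S.f i⁆ * pderiv j p = S.der ⁅x, S.f i⁆ p := by
    rw [der_apply]
    exact Finset.sum_congr rfl fun j _ ↦ by rw [lie_lie_f_comm]
  rw [h3, h4]
  have h5 : ∀ j k, S.ell ⁅⁅x, S.f j⁆, S.f k⁆ * (X i * pderiv j (pderiv k p)) =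
    X i * (S.ell ⁅⁅x, S.f j⁆, S.f k⁆ * pderiv j (pderiv k p)) := fun _ _ ↦ by ring
  simp only [h5, ← Finset.mul_sum, mul_smul_comm]
  have h6 : ∀ q : MvPolynomial ι ℂ, q = (2⁻¹ : ℂ) • q + (2⁻¹ : ℂ) • q := fun q ↦ by module
  conv_rhs => rw [h6 (S.der ⁅x, S.f i⁆ p)]
  abel

/-- The relation `ρ([x, y]) = [ρ(x), ρ(y)]`. -/
def Compat (S : ShortGrading ι L) (a : ℂ) (x y : L) : Prop :=
  ∀ p, S.rho a ⁅x, y⁆ p = S.rho a x (S.rho a y p) - S.rho a y (S.rho a x p)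

theorem Compat.symm {a : ℂ} {x y : L} (h : Compat S a x y) : Compat S a y x := fun p ↦ by
  rw [← lie_skew, map_neg, LinearMap.neg_apply, h, neg_sub]

theorem Compat.add {a : ℂ} {x y y' : L} (h : Compat S a x y) (h' : Compat S a x y') :
    Compat S a x (y + y') := fun p ↦ by
  rw [lie_add, map_add, LinearMap.add_apply, h, h', map_add, LinearMap.add_apply, map_add,
    LinearMap.add_apply]
  abel

theorem Compat.smul {a : ℂ} {x y : L} (h : Compat S a x y) (c : ℂ) :
    Compat S a x (c • y) := fun p ↦ by
  rw [lie_smul, map_smul, LinearMap.smul_apply, h, map_smul, LinearMap.smul_apply, map_smul,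
    LinearMap.smul_apply, smul_sub]

theorem compat_f (a : ℂ) (x : L) (i : ι) : Compat S a x (S.f i) := by
  refine S.lev_induction (p := fun x ↦ Compat S a x (S.f i))
    (fun x y hx hy ↦ (hx.symm.add hy.symm).symm) ?_ ?_ ?_ x
  all_goals
    intro x hx p
    have hl := lie_mem_lev hx (f_mem (S := S) i)
    rw [rho_f, rho_f]
  · rw [lie_eq_zero_of_mem_neg_one hx (f_mem i), rho_neg_one a hx, rho_neg_one a hx, map_zero,
      LinearMap.zero_apply]
    ring
  · rw [rho_neg_one a hl, rho_zero a hx, rho_zero a hx, Derivation.leibniz, der_X, smul_eq_mul,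
      smul_eq_mul, mul_add, mul_smul_comm]
    ring
  · rw [rho_zero a (by simpa using hl), rho_one a hx, rho_one a hx, sec_X_mul]
    ring

theorem compat_neg_one (a : ℂ) (x : L) {y : L} (hy : y ∈ S.lev (-1)) : Compat S a x y := by
  rw [eq_sum_of_mem hy]
  refine Finset.sum_induction _ (Compat S a x) (fun _ _ ↦ Compat.add) (fun p ↦ by simp)
    fun j _ ↦ (compat_f a x j).smul _

theorem rho_apply_one (a : ℂ) (x : L) : S.rho a x 1 = S.ell x + C (a * κ S.z x) := by
  rw [rho_apply, sec_apply]
  simp [smul_eq_C_mul]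

/-- The relation for `x` and `y` follows from those for `x, [y, f i]` and for `y, [x, f i]`: by the
Jacobi identity these say that the defect `ρ([x, y]) - [ρ(x), ρ(y)]` commutes with multiplication by
the variables, and it kills `1`. -/
theorem compat_step {a : ℂ} {x y : L} {m n : ℤ} (hm : 0 ≤ m) (hn : 0 ≤ n) (hx : x ∈ S.lev m)
    (hy : y ∈ S.lev n) (h1 : ∀ i, Compat S a x ⁅y, S.f i⁆) (h2 : ∀ i, Compat S a y ⁅x, S.f i⁆) :
    Compat S a x y := by
  have hk : κ S.z ⁅x, y⁆ = 0 := by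
    rw [← killing_lie, mem_lev.1 hx, map_smul, LinearMap.smul_apply]
    by_cases h : m = 0
    · simp [h]
    · rw [killing_eq_zero (by omega) hx hy, smul_zero]
  have hsub : S.rho a ⁅x, y⁆ - (S.rho a x ∘ₗ S.rho a y - S.rho a y ∘ₗ S.rho a x) = 0 := by
    apply linearMap_eq_zero
    · simp only [LinearMap.sub_apply, LinearMap.comp_apply, rho_apply_one, hk,
        ell_eq_zero (show m + n ≠ -1 by omega) (lie_mem_lev hx hy),
        ell_eq_zero (show m ≠ -1 by omega) hx, ell_eq_zero (show n ≠ -1 by omega) hy, mul_zero,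
        zero_add, C_0]
      rw [← mul_one (C (a * κ S.z y)), ← mul_one (C (a * κ S.z x)), ← smul_eq_C_mul,
        ← smul_eq_C_mul, map_smul, map_smul, rho_apply_one, rho_apply_one,
        ell_eq_zero (show m ≠ -1 by omega) hx, ell_eq_zero (show n ≠ -1 by omega) hy]
      simp only [smul_eq_C_mul]
      ring
    · intro j p
      simp only [LinearMap.sub_apply, LinearMap.comp_apply]
      have hf (w : L) (q : MvPolynomial ι ℂ) :
          S.rho a w (X j * q) = X j * S.rho a w q + S.rho a ⁅w, S.f j⁆ q := by
        have := compat_f (S := S) a w j q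
        rw [rho_f, rho_f] at this
        rw [this]; ring
      rw [hf, hf, hf, map_add, map_add, hf, hf, lie_lie, map_sub, LinearMap.sub_apply, h1 j, h2 j]
      ring
  intro p
  have := LinearMap.congr_fun hsub p
  simpa [sub_eq_zero] using this

theorem compat (a : ℂ) (x y : L) : Compat S a x y := by
  have h00 : ∀ x ∈ S.lev 0, ∀ y ∈ S.lev 0, Compat S a x y := fun x hx y hy ↦
    compat_step (m := 0) (n := 0) le_rfl le_rfl hx hy
      (fun i ↦ compat_neg_one a _ (lie_mem_lev_of_eq (by norm_num) hy (f_mem i)))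
      fun i ↦ compat_neg_one a _ (lie_mem_lev_of_eq (by norm_num) hx (f_mem i))
  have h10 : ∀ x ∈ S.lev 1, ∀ y ∈ S.lev 0, Compat S a x y := fun x hx y hy ↦
    compat_step (m := 1) (n := 0) zero_le_one le_rfl hx hy
      (fun i ↦ compat_neg_one a _ (lie_mem_lev_of_eq (by norm_num) hy (f_mem i)))
      fun i ↦ h00 _ hy _ (lie_mem_lev_of_eq (by norm_num) hx (f_mem i))
  have h11 : ∀ x ∈ S.lev 1, ∀ y ∈ S.lev 1, Compat S a x y := fun x hx y hy ↦
    compat_step (m := 1) (n := 1) zero_le_one zero_le_one hx hy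
      (fun i ↦ h10 _ hx _ (lie_mem_lev_of_eq (by norm_num) hy (f_mem i)))
      fun i ↦ h10 _ hy _ (lie_mem_lev_of_eq (by norm_num) hx (f_mem i))
  refine S.lev_induction (p := fun y ↦ Compat S a x y) (fun _ _ ↦ Compat.add)
    (fun y hy ↦ compat_neg_one a x hy) (fun y hy ↦ Compat.symm ?_) (fun y hy ↦ Compat.symm ?_) y
  · exact S.lev_induction (p := fun x ↦ Compat S a y x) (fun _ _ ↦ Compat.add)
      (fun x hx ↦ compat_neg_one a y hx) (fun x hx ↦ h00 y hy x hx)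
      (fun x hx ↦ (h10 x hx y hy).symm) x
  · exact S.lev_induction (p := fun x ↦ Compat S a y x) (fun _ _ ↦ Compat.add)
      (fun x hx ↦ compat_neg_one a y hx) (fun x hx ↦ h10 y hy x hx)
      (fun x hx ↦ h11 y hy x hx) x

variable (S) in
/-- The polynomial model of the scalar generalized Verma module, as a Lie algebra morphism. -/
noncomputable def rhoHom (a : ℂ) : L →ₗ⁅ℂ⁆ Module.End ℂ (MvPolynomial ι ℂ) where
  __ := S.rho a
  map_lie' {x y} := LinearMap.ext fun p ↦ compat a x y p

/-- The trace of the action of the part of degree `0` on the part of degree `-1`. -/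
theorem sum_killing_lie {x : L} (hx : x ∈ S.lev 0) :
    ∑ j, κ (S.e j) ⁅x, S.f j⁆ = -(Fintype.card ι / κ S.z S.z) * κ S.z x := by
  set T : L →ₗ[ℂ] ℂ := -∑ j, κ (S.e j) ∘ₗ ad ℂ L (S.f j) with hT
  have hTa (x : L) : T x = ∑ j, κ (S.e j) ⁅x, S.f j⁆ := by
    simp only [hT, LinearMap.neg_apply, LinearMap.sum_apply, LinearMap.comp_apply, ad_apply,
      ← Finset.sum_neg_distrib, ← map_neg, lie_skew]
  have hTz : T S.z = -Fintype.card ι := by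
    simp [hTa, S.lie_z_f, S.killing_e_f]
  have hcomm : ∀ a b : L, ⁅S.z, a⁆ = 0 → ⁅S.z, b⁆ = 0 → T ⁅a, b⁆ = 0 := by
    intro a b ha hb
    rw [← mem_lev_zero] at ha hb
    have h (a b : L) (hb : b ∈ S.lev 0) : ∑ j, κ (S.e j) ⁅a, ⁅b, S.f j⁆⁆ =
        ∑ j, ∑ k, κ (S.e k) ⁅b, S.f j⁆ * κ (S.e j) ⁅a, S.f k⁆ := by
      refine Finset.sum_congr rfl fun j _ ↦ ?_
      conv_lhs =>
        rw [eq_sum_of_mem (lie_mem_lev_of_eq (k := -1) (by norm_num) hb (f_mem (S := S) j))]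
      simp [lie_sum]
    simp only [hTa, lie_lie, map_sub, Finset.sum_sub_distrib]
    rw [h a b hb, h b a ha, sub_eq_zero, Finset.sum_comm]
    exact Finset.sum_congr rfl fun _ _ ↦ Finset.sum_congr rfl fun _ _ ↦ mul_comm _ _
  have h0 : T (x - (κ S.z x / κ S.z S.z) • S.z) = 0 := by
    set x' := x - (κ S.z x / κ S.z S.z) • S.z with hx'
    have hmem := S.mem_span_of_killing_z x'
      (by rw [hx', lie_sub, lie_smul, lie_self, mem_lev_zero.1 hx]; simp)
      (by rw [hx', map_sub, map_smul, smul_eq_mul, div_mul_cancel₀ _ S.killing_z_z, sub_self])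
    clear_value x'
    clear hx'
    induction hmem using Submodule.span_induction with
    | mem t ht => obtain ⟨a, b, ha, hb, rfl⟩ := ht; exact hcomm a b ha hb
    | zero => exact map_zero _
    | add _ _ _ _ h1 h2 => rw [map_add, h1, h2, add_zero]
    | smul c _ _ h1 => rw [map_smul, h1, smul_zero]
  rw [map_sub, map_smul, hTz, sub_eq_zero] at h0
  rw [← hTa, h0, smul_eq_mul]
  ring

/-- On a polynomial on which the part of degree `0` acts by a character, the second order operators
reduce to a scalar multiple of first order ones: differentiate the equations that express this for
the elements `[x, f k]` and sum over `k`. The trace in `sum_killing_lie` produces the number of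
variables in the scalar. -/
theorem sec_eq_smul_sum (a c : ℂ) {p : MvPolynomial ι ℂ}
    (hp : ∀ x ∈ S.lev 0, S.der x p = (c * κ S.z x) • p) {x : L} (hx : x ∈ S.lev 1) :
    S.sec a x p =
      (a + (c + Fintype.card ι / κ S.z S.z) / 2) • ∑ j, κ x (S.f j) • pderiv j p := by
  have hxf (j : ι) : ⁅x, S.f j⁆ ∈ S.lev 0 := by simpa using lie_mem_lev hx (f_mem (S := S) j)
  have hz (j : ι) : κ S.z ⁅x, S.f j⁆ = κ x (S.f j) := by
    rw [← killing_lie, mem_lev_one.1 hx]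
  have h1 : ∑ k, pderiv k (S.der ⁅x, S.f k⁆ p) = c • ∑ k, κ x (S.f k) • pderiv k p := by
    rw [Finset.smul_sum]
    refine Finset.sum_congr rfl fun k _ ↦ ?_
    rw [hp _ (hxf k), Derivation.map_smul, hz, smul_smul]
  have h2 : ∑ k, pderiv k (S.der ⁅x, S.f k⁆ p) =
      ∑ k, ∑ j, κ (S.e k) ⁅⁅x, S.f k⁆, S.f j⁆ • pderiv j p +
        ∑ k, ∑ j, S.ell ⁅⁅x, S.f k⁆, S.f j⁆ * pderiv k (pderiv j p) := by
    simp only [der_apply, map_sum, pderiv_mul, pderiv_ell, Finset.sum_add_distrib, smul_eq_C_mul]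
  have h3 : ∑ k, ∑ j, κ (S.e k) ⁅⁅x, S.f k⁆, S.f j⁆ • pderiv j p =
      -(Fintype.card ι / κ S.z S.z) • ∑ j, κ x (S.f j) • pderiv j p := by
    rw [Finset.sum_comm, Finset.smul_sum]
    refine Finset.sum_congr rfl fun j _ ↦ ?_
    simp only [lie_lie_f_comm x _ j]
    rw [← Finset.sum_smul, sum_killing_lie (hxf j), hz, smul_smul]
  rw [h1, h3] at h2
  have h4 : ∑ k, ∑ j, S.ell ⁅⁅x, S.f k⁆, S.f j⁆ * pderiv k (pderiv j p) =
      (c + Fintype.card ι / κ S.z S.z) • ∑ j, κ x (S.f j) • pderiv j p := by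
    rw [add_smul, h2]
    module
  rw [sec_apply, h4]
  simp only [hz, mul_smul, ← Finset.smul_sum]
  module

end ShortGrading

/-! ### The algebra of semi-invariants -/

namespace ShortGrading

open MvPolynomial

variable {ι L : Type*} [Fintype ι] [DecidableEq ι] [LieRing L] [LieAlgebra ℂ L]
  (S : ShortGrading ι L)

local notation "κ" => killingForm ℂ L

/-- If the basis vectors are eigenvectors of `ad h`, then monomials are eigenvectors of `h`. -/
theorem coeff_der_of_diagonal {h : L} {w : ι → ℂ} (hw : ∀ j, ⁅h, S.f j⁆ = w j • S.f j)
    (p : MvPolynomial ι ℂ) (s : ι →₀ ℕ) :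
    coeff s (S.der h p) = (∑ j, s j * w j) * coeff s p := by
  have hm (t : ι →₀ ℕ) (c : ℂ) :
      S.der h (monomial t c) = (∑ j, t j * w j) • monomial t c := by
    rw [der_apply, Finset.sum_smul]
    refine Finset.sum_congr rfl fun j _ ↦ ?_
    rw [hw, map_smul, ell_f, smul_mul_assoc, X_mul_pderiv_monomial, ← Nat.cast_smul_eq_nsmul ℂ,
      smul_smul, mul_comm]
  induction p using MvPolynomial.induction_on' with
  | monomial t c =>
    rw [hm, coeff_smul, smul_eq_mul, coeff_monomial]
    split_ifs with h
    · rw [h]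
    · simp
  | add p q hp hq => rw [map_add, coeff_add, hp, hq, coeff_add, mul_add]

theorem coeff_der_z (p : MvPolynomial ι ℂ) (s : ι →₀ ℕ) :
    coeff s (S.der S.z p) = -(s.degree : ℂ) * coeff s p := by
  rw [S.coeff_der_of_diagonal (w := fun _ ↦ -1) (fun j ↦ by simp [S.lie_z_f]),
    Finsupp.degree_eq_sum]
  simp

theorem isHomogeneous_iff_der_z {n : ℕ} {p : MvPolynomial ι ℂ} :
    p.IsHomogeneous n ↔ S.der S.z p = (-n : ℂ) • p := by
  constructor
  · intro hp
    ext s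
    rw [coeff_der_z, coeff_smul, smul_eq_mul]
    by_cases hs : coeff s p = 0
    · simp [hs]
    · rw [not_imp_comm.1 hp.coeff_eq_zero hs]
  · intro h s hs
    have h1 := congrArg (coeff s) h
    rw [coeff_der_z, coeff_smul, smul_eq_mul] at h1
    have h2 := mul_right_cancel₀ hs h1
    have h3 : Finsupp.weight 1 s = s.degree := by rw [Finsupp.degree_eq_weight_one]; rfl
    rw [h3]
    exact_mod_cast neg_injective h2

theorem exists_isHomogeneous_of_der_z {c : ℂ} {p : MvPolynomial ι ℂ} (hp : p ≠ 0)
    (h : S.der S.z p = c • p) : ∃ n : ℕ, c = -n ∧ p.IsHomogeneous n := by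
  obtain ⟨s, hs⟩ := ne_zero_iff.1 hp
  have h1 := congrArg (coeff s) h
  rw [coeff_der_z, coeff_smul, smul_eq_mul] at h1
  have h2 := mul_right_cancel₀ hs h1
  exact ⟨s.degree, h2.symm, (S.isHomogeneous_iff_der_z).2 (by rw [h, h2])⟩

/-- Semi-invariants of degree `n`: the polynomials on which the part of degree `0` acts by the
character by which it would act on an invariant, under its derived algebra, of degree `n`. -/
def SemiInv (n : ℕ) (p : MvPolynomial ι ℂ) : Prop :=
  ∀ x ∈ S.lev 0, S.der x p = (-(n / κ S.z S.z) * κ S.z x) • p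

variable {S}

theorem SemiInv.isHomogeneous {n : ℕ} {p : MvPolynomial ι ℂ} (h : S.SemiInv n p) :
    p.IsHomogeneous n := by
  rw [S.isHomogeneous_iff_der_z, h _ z_mem, neg_mul, div_mul_cancel₀ _ S.killing_z_z]

theorem SemiInv.der_eq_zero {n : ℕ} {p : MvPolynomial ι ℂ} (h : S.SemiInv n p) {x : L}
    (hx : x ∈ S.lev 0) (hzx : κ S.z x = 0) : S.der x p = 0 := by
  rw [h x hx, hzx, mul_zero, zero_smul]

/-- The part of degree `0` is spanned by the grading element, which acts on `p` by its degree, and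
the orthogonal complement of the latter. -/
theorem semiInv_of_isHomogeneous {n : ℕ} {p : MvPolynomial ι ℂ} (hp : p.IsHomogeneous n)
    (h : ∀ x ∈ S.lev 0, κ S.z x = 0 → S.der x p = 0) : S.SemiInv n p := by
  intro x hx
  have h1 := h (x - (κ S.z x / κ S.z S.z) • S.z)
    (sub_mem hx (Submodule.smul_mem _ _ z_mem))
    (by rw [map_sub, map_smul, smul_eq_mul, div_mul_cancel₀ _ S.killing_z_z, sub_self])
  rw [map_sub, map_smul, Derivation.sub_apply, Derivation.smul_apply,
    S.isHomogeneous_iff_der_z.1 hp, sub_eq_zero] at h1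
  rw [h1, smul_smul]
  congr 1
  ring

theorem SemiInv.mul {m n : ℕ} {p q : MvPolynomial ι ℂ} (hp : S.SemiInv m p) (hq : S.SemiInv n q) :
    S.SemiInv (m + n) (p * q) := by
  intro x hx
  rw [Derivation.leibniz, hp x hx, hq x hx, smul_eq_mul, smul_eq_mul, mul_smul_comm, mul_smul_comm,
    mul_comm q p, ← add_smul]
  congr 1
  push_cast
  ring

theorem semiInv_one : S.SemiInv 0 1 := fun x _ ↦ by simp

theorem SemiInv.pow {m : ℕ} {p : MvPolynomial ι ℂ} (hp : S.SemiInv m p) (n : ℕ) :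
    S.SemiInv (n * m) (p ^ n) := by
  induction n with
  | zero => simpa using semiInv_one
  | succ n ih => rw [pow_succ, add_mul, one_mul]; exact ih.mul hp

theorem SemiInv.of_mul_right {m n : ℕ} {p q : MvPolynomial ι ℂ} (hp : S.SemiInv m p)
    (hpq : S.SemiInv n (p * q)) (hp0 : p ≠ 0) (hq0 : q ≠ 0) : m ≤ n ∧ S.SemiInv (n - m) q := by
  have hmn : m ≤ n := by
    rw [← hpq.isHomogeneous.totalDegree (mul_ne_zero hp0 hq0), totalDegree_mul_of_isDomain hp0 hq0,
      hp.isHomogeneous.totalDegree hp0]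
    exact Nat.le_add_right _ _
  refine ⟨hmn, fun x hx ↦ mul_left_cancel₀ hp0 ?_⟩
  have h1 := hpq x hx
  rw [Derivation.leibniz, hp x hx, smul_eq_mul, smul_eq_mul, mul_smul_comm, mul_comm q p,
    ← eq_sub_iff_add_eq, ← sub_smul] at h1
  rw [h1, mul_smul_comm]
  congr 1
  push_cast [hmn]
  ring

variable (S)

/-- The point of affine space with coordinates `κ x (f j)`, at which polynomials are evaluated. -/
noncomputable def pt (x : L) : ι → ℂ := fun j ↦ κ x (S.f j)

/-- The gradient of a polynomial at a point, as an element of degree `-1`. -/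
noncomputable def grad (p : MvPolynomial ι ℂ) (v : ι → ℂ) : L := ∑ j, eval v (pderiv j p) • S.f j

variable {S}

theorem grad_mem (p : MvPolynomial ι ℂ) (v : ι → ℂ) : S.grad p v ∈ S.lev (-1) :=
  sum_mem fun j _ ↦ Submodule.smul_mem _ _ (f_mem j)

theorem killing_e_grad (p : MvPolynomial ι ℂ) (v : ι → ℂ) (j : ι) :
    κ (S.e j) (S.grad p v) = eval v (pderiv j p) := by
  simp [grad, S.killing_e_f]

theorem eval_ell (x : L) {y : L} (hy : y ∈ S.lev (-1)) : eval (S.pt x) (S.ell y) = κ x y := by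
  conv_rhs => rw [eq_sum_of_mem hy]
  simp [ell_apply, smul_eq_C_mul, pt]

/-- At the point given by `x`, differentiating `p` along the action of `z'` amounts to pairing `z'`
with the bracket of `x` and the gradient. -/
theorem eval_der (p : MvPolynomial ι ℂ) (x : L) {z' : L} (hz : z' ∈ S.lev 0) :
    eval (S.pt x) (S.der z' p) = -κ z' ⁅x, S.grad p (S.pt x)⁆ := by
  have h (j : ι) : κ z' ⁅x, S.f j⁆ = -κ x ⁅z', S.f j⁆ := by rw [← killing_lie, killing_lie']
  rw [der_apply, grad, lie_sum, map_sum, map_sum, ← Finset.sum_neg_distrib]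
  refine Finset.sum_congr rfl fun j _ ↦ ?_
  rw [lie_smul, map_smul, h, map_mul,
    eval_ell x (lie_mem_lev_of_eq (by norm_num) hz (f_mem (S := S) j)), smul_eq_mul]
  ring

theorem exists_pt_eq (v : ι → ℂ) : ∃ x ∈ S.lev 1, S.pt x = v := by
  obtain ⟨x, hx, h⟩ := S.exists_of_eq_killing v
  exact ⟨x, hx, funext h⟩

theorem exists_eval_ne_zero {p : MvPolynomial ι ℂ} (hp : p ≠ 0) :
    ∃ x ∈ S.lev 1, eval (S.pt x) p ≠ 0 := by
  by_contra! h
  refine hp (MvPolynomial.funext fun v ↦ ?_)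
  obtain ⟨x, hx, rfl⟩ := S.exists_pt_eq v
  rw [h x hx, map_zero]

variable [IsKilling ℂ L]

/-- A point where a nonconstant semi-invariant does not vanish is completed to a grading element: up
to scaling, the logarithmic gradient of the semi-invariant is the inverse of the point. -/
theorem SemiInv.exists_lie_eq_z {n : ℕ} (hn : n ≠ 0) {p : MvPolynomial ι ℂ} (hp : S.SemiInv n p)
    {x : L} (hx : x ∈ S.lev 1) (h : eval (S.pt x) p ≠ 0) : ∃ y ∈ S.lev (-1), ⁅x, y⁆ = S.z := by
  set y := S.grad p (S.pt x) with hy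
  have hym : y ∈ S.lev (-1) := grad_mem _ _
  set c : ℂ := n / κ S.z S.z * eval (S.pt x) p with hc
  have hc0 : c ≠ 0 := mul_ne_zero (div_ne_zero (by exact_mod_cast hn) S.killing_z_z) h
  have key : ⁅x, y⁆ - c • S.z = 0 := by
    refine eq_zero_of_killing (S := S) (n := 0)
      (sub_mem (lie_mem_lev_of_eq (by norm_num) hx hym) (Submodule.smul_mem _ _ z_mem)) ?_
    intro z' hz'
    rw [neg_zero] at hz'
    have h1 := eval_der p x hz'
    rw [hp z' hz', smul_eval] at h1
    rw [map_sub, map_smul, killing_comm z' S.z, smul_eq_mul, ← neg_eq_iff_eq_neg.2 h1, hc]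
    ring
  refine ⟨c⁻¹ • y, Submodule.smul_mem _ _ hym, ?_⟩
  rw [lie_smul, sub_eq_zero.1 key, smul_smul, inv_mul_cancel₀ hc0, one_smul]

omit [IsKilling ℂ L] in
/-- If `⁅x, y⁆` is the grading element, then `ad x` is injective on the part of degree `-1`. -/
theorem eq_zero_of_lie_eq_zero {x y : L} (hy : y ∈ S.lev (-1)) (hxy : ⁅x, y⁆ = S.z) {w : L}
    (hw : w ∈ S.lev (-1)) (h : ⁅x, w⁆ = 0) : w = 0 := by
  have h1 := mem_lev_neg_one.1 hw
  rw [← hxy, lie_lie, h, lie_zero, sub_zero, lie_eq_zero_of_mem_neg_one hy hw, lie_zero] at h1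
  exact neg_eq_zero.1 h1.symm

/-- A semi-invariant is determined by its value at a point in the open orbit. -/
theorem SemiInv.eq_zero {n : ℕ} {p : MvPolynomial ι ℂ} (hp : S.SemiInv n p) {x y : L}
    (hx : x ∈ S.lev 1) (hy : y ∈ S.lev (-1)) (hxy : ⁅x, y⁆ = S.z) (h : eval (S.pt x) p = 0) :
    p = 0 := by
  refine eq_zero_of_common_eigenvector (φ := aeval (S.pt x)) (Z := S.lev 0)
    (fun w ↦ S.der w) (fun w j k ↦ ⟨_, by rw [der_X, pderiv_ell]⟩) Set.univ
    (fun j hj ↦ absurd (Set.mem_univ j) hj) ?_ ?_ p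
    (fun w ↦ -(n / κ S.z S.z) * κ S.z w) (fun w ↦ ?_) ?_
  · intro q hq _ k _
    have h0 : ⁅x, S.grad q (S.pt x)⁆ = 0 := by
      refine eq_zero_of_killing (S := S) (n := 0)
        (lie_mem_lev_of_eq (by norm_num) hx (grad_mem _ _)) fun w hw ↦ ?_
      rw [neg_zero] at hw
      have := hq ⟨w, hw⟩
      rw [aeval_eq_eval, eval_der q x hw, neg_eq_zero] at this
      exact this
    have h1 := eq_zero_of_lie_eq_zero hy hxy (grad_mem _ _) h0
    rw [aeval_eq_eval, ← killing_e_grad (S := S), h1, map_zero]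
  · intro g hg h0
    obtain ⟨c, rfl⟩ := eq_C_of_pderiv_eq_zero fun k ↦ hg k (Set.mem_univ k)
    rw [aeval_C] at h0
    rw [show c = 0 from h0, C_0]
  · rw [← smul_eq_C_mul]
    exact hp w w.2
  · rw [aeval_eq_eval]
    exact h

/-- Semi-invariants of equal degree are proportional as soon as some nonconstant semi-invariant
exists: a suitable combination vanishes at a point of the open orbit. -/
theorem SemiInv.exists_eq_smul {n m : ℕ} {p q g : MvPolynomial ι ℂ} (hm : m ≠ 0)
    (hg : S.SemiInv m g) (hg0 : g ≠ 0) (hp : S.SemiInv n p) (hq : S.SemiInv n q) (hq0 : q ≠ 0) :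
    ∃ c : ℂ, p = c • q := by
  obtain ⟨x, hx, hgx⟩ := S.exists_eval_ne_zero hg0
  obtain ⟨y, hy, hxy⟩ := hg.exists_lie_eq_z hm hx hgx
  have hqx : eval (S.pt x) q ≠ 0 := fun h ↦ hq0 (hq.eq_zero hx hy hxy h)
  refine ⟨eval (S.pt x) p / eval (S.pt x) q, sub_eq_zero.1 ?_⟩
  refine SemiInv.eq_zero (n := n) (S := S) (fun w hw ↦ ?_) hx hy hxy ?_
  · rw [map_sub, Derivation.map_smul, hp w hw, hq w hw, smul_sub, smul_comm]
  · rw [map_sub, smul_eval, div_mul_cancel₀ _ hqx, sub_self]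

omit [IsKilling ℂ L] in
theorem totalDegree_der_le (x : L) (p : MvPolynomial ι ℂ) :
    (S.der x p).totalDegree ≤ p.totalDegree := by
  rw [der_apply]
  refine (totalDegree_finsetSum _ _).trans (Finset.sup_le fun j _ ↦ ?_)
  by_cases h : pderiv j p = 0
  · simp [h]
  · refine (totalDegree_mul _ _).trans ?_
    have h1 : (S.ell ⁅x, S.f j⁆).totalDegree ≤ 1 := by
      rw [ell_apply]
      refine (totalDegree_finsetSum _ _).trans (Finset.sup_le fun j _ ↦ ?_)
      exact (totalDegree_smul_le _ _).trans (totalDegree_X _).le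
    have h2 := totalDegree_pderiv_lt h
    omega

omit [IsKilling ℂ L] in
/-- The irreducible factors of a semi-invariant are semi-invariants. -/
theorem SemiInv.of_irreducible {n : ℕ} {p q : MvPolynomial ι ℂ} (hq : S.SemiInv n q) (hq0 : q ≠ 0)
    (hp : Irreducible p) (hpq : p ∣ q) : ∃ m, S.SemiInv m p := by
  have hp' := UniqueFactorizationMonoid.irreducible_iff_prime.1 hp
  obtain ⟨e, s, hs, rfl⟩ := WfDvdMonoid.max_power_factor hq0 hp
  have he : e ≠ 0 := by
    rintro rfl
    rw [pow_zero, one_mul] at hpq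
    exact hs hpq
  obtain ⟨e, rfl⟩ := Nat.exists_eq_succ_of_ne_zero he
  -- `p` divides its derivative, which has no larger degree
  have key : ∀ x ∈ S.lev 0, ∃ c : ℂ, S.der x p = c • p := by
    intro x hx
    have h1 := hq x hx
    set c := -((n : ℂ) / κ S.z S.z) * κ S.z x
    rw [Derivation.leibniz, Derivation.leibniz_pow, Nat.succ_sub_one] at h1
    simp only [smul_eq_mul, smul_eq_C_mul, nsmul_eq_mul] at h1
    have h2 : ((e + 1 : ℕ) : MvPolynomial ι ℂ) * S.der x p * s = p * (C c * s - S.der x s) := by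
      refine mul_left_cancel₀ (pow_ne_zero e hp.ne_zero) ?_
      rw [Nat.succ_eq_add_one, pow_succ] at h1
      linear_combination h1
    have h3 : p ∣ S.der x p := by
      have h4 : p ∣ ((e + 1 : ℕ) : MvPolynomial ι ℂ) * S.der x p * s := ⟨_, h2⟩
      rcases hp'.dvd_or_dvd h4 with h5 | h5
      · rcases hp'.dvd_or_dvd h5 with h6 | h6
        · refine absurd (isUnit_of_dvd_unit h6 ?_) hp.not_isUnit
          rw [← map_natCast C]
          exact (isUnit_iff_ne_zero.2 (Nat.cast_ne_zero.2 (Nat.succ_ne_zero e))).map C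
        · exact h6
      · exact absurd h5 hs
    obtain ⟨t, ht⟩ := h3
    by_cases ht0 : t = 0
    · exact ⟨0, by rw [ht, ht0, mul_zero, zero_smul]⟩
    · have h6 := totalDegree_der_le (S := S) x p
      rw [ht, totalDegree_mul_of_isDomain hp.ne_zero ht0] at h6
      have h7 : t.totalDegree = 0 := by omega
      rw [totalDegree_eq_zero_iff_eq_C] at h7
      exact ⟨coeff 0 t, by rw [ht, smul_eq_C_mul, ← h7, mul_comm]⟩
  obtain ⟨c, hc⟩ := key S.z z_mem
  obtain ⟨m, -, hm⟩ := S.exists_isHomogeneous_of_der_z hp.ne_zero hc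
  refine ⟨m, semiInv_of_isHomogeneous hm fun x hx hzx ↦ ?_⟩
  -- brackets act trivially on a common eigenvector
  have hmem := S.mem_span_of_killing_z x (mem_lev_zero.1 hx) hzx
  clear hx hzx
  induction hmem using Submodule.span_induction with
  | mem t ht =>
    obtain ⟨a, b, ha, hb, rfl⟩ := ht
    rw [← mem_lev_zero] at ha hb
    obtain ⟨c, hc⟩ := key a ha
    obtain ⟨d, hd⟩ := key b hb
    rw [der_lie _ ha hb, hc, hd, Derivation.map_smul, Derivation.map_smul, hc, hd, smul_comm,
      sub_self]
  | zero => simp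
  | add _ _ _ _ h1 h2 => rw [map_add, Derivation.add_apply, h1, h2, add_zero]
  | smul c _ _ h1 => rw [map_smul, Derivation.smul_apply, h1, smul_zero]

omit [IsKilling ℂ L] in
theorem SemiInv.isUnit {p : MvPolynomial ι ℂ} (hp : S.SemiInv 0 p) (hp0 : p ≠ 0) : IsUnit p := by
  have h := hp.isHomogeneous.totalDegree hp0
  rw [totalDegree_eq_zero_iff_eq_C] at h
  rw [h]
  exact (isUnit_iff_ne_zero.2 fun h0 ↦ hp0 (by rw [h, h0, C_0])).map C

/-- If there is a nonconstant semi-invariant, then there is an irreducible one of which all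
semi-invariants are powers, up to scalars. -/
theorem exists_generator {m : ℕ} {g : MvPolynomial ι ℂ} (hm : m ≠ 0) (hg : S.SemiInv m g)
    (hg0 : g ≠ 0) : ∃ (d : ℕ) (w : MvPolynomial ι ℂ), d ≠ 0 ∧ Irreducible w ∧ S.SemiInv d w ∧
      ∀ n p, S.SemiInv n p → p ≠ 0 → ∃ (k : ℕ) (c : ℂ), n = k * d ∧ p = c • w ^ k := by
  classical
  have hex : ∃ d, d ≠ 0 ∧ ∃ w, w ≠ 0 ∧ S.SemiInv d w := ⟨m, hm, g, hg0, hg⟩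
  obtain ⟨hd, w, hw0, hw⟩ := Nat.find_spec hex
  have hmin : ∀ n p, S.SemiInv n p → p ≠ 0 → n ≠ 0 → Nat.find hex ≤ n :=
    fun n p hp hp0 hn ↦ Nat.find_min' hex ⟨hn, p, hp0, hp⟩
  set d := Nat.find hex
  clear_value d
  have hfac : ∀ n p, S.SemiInv n p → p ≠ 0 → n ≠ 0 →
      ∃ n' q, n' ≠ 0 ∧ Irreducible q ∧ q ∣ p ∧ S.SemiInv n' q := by
    intro n p hp hp0 hn
    have hu : ¬IsUnit p := by
      rw [isUnit_iff_totalDegree_of_isReduced, hp.isHomogeneous.totalDegree hp0]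
      exact fun h ↦ hn h.2
    obtain ⟨q, hq, hqp⟩ := WfDvdMonoid.exists_irreducible_factor hu hp0
    obtain ⟨n', hq'⟩ := hp.of_irreducible hp0 hq hqp
    refine ⟨n', q, ?_, hq, hqp, hq'⟩
    rintro rfl
    exact hq.not_isUnit (hq'.isUnit hq.ne_zero)
  -- a semi-invariant of minimal positive degree is associated to each of its irreducible factors
  have hwirr : Irreducible w := by
    obtain ⟨n', q, hn', hq, ⟨t, rfl⟩, hq'⟩ := hfac d w hw hw0 hd
    have ht0 : t ≠ 0 := right_ne_zero_of_mul hw0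
    obtain ⟨h1, h2⟩ := hq'.of_mul_right hw hq.ne_zero ht0
    have h3 := hmin _ _ hq' hq.ne_zero hn'
    have h4 : d - n' = 0 := by omega
    rw [h4] at h2
    exact (irreducible_mul_isUnit (h2.isUnit ht0)).2 hq
  refine ⟨d, w, hd, hwirr, hw, fun n ↦ ?_⟩
  induction n using Nat.strong_induction_on with
  | _ n ih =>
    intro p hp hp0
    rcases eq_or_ne n 0 with rfl | hn
    · have h := hp.isHomogeneous.totalDegree hp0
      rw [totalDegree_eq_zero_iff_eq_C] at h
      exact ⟨0, coeff 0 p, by simp, by rw [pow_zero, smul_eq_C_mul, mul_one]; exact h⟩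
    obtain ⟨n', q, hn', hq, hqp, hq'⟩ := hfac n p hp hp0 hn
    -- `w` divides the irreducible factor `q`, since suitable powers of both are proportional
    obtain ⟨c, hc⟩ := SemiInv.exists_eq_smul hd hw hw0 (hq'.pow d)
      (by rw [mul_comm]; exact hw.pow n') (pow_ne_zero _ hw0)
    have hwq : w ∣ q := by
      refine (UniqueFactorizationMonoid.irreducible_iff_prime.1 hwirr).dvd_of_dvd_pow (n := d) ?_
      rw [hc, smul_eq_C_mul]
      exact dvd_mul_of_dvd_right (dvd_pow_self w hn') _
    obtain ⟨p', rfl⟩ := hwq.trans hqp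
    have hp'0 : p' ≠ 0 := right_ne_zero_of_mul hp0
    obtain ⟨h1, h2⟩ := hw.of_mul_right hp hw0 hp'0
    obtain ⟨k, c, hk, hc⟩ := ih (n - d) (by omega) p' h2 hp'0
    refine ⟨k + 1, c, by rw [add_mul, one_mul]; omega, ?_⟩
    rw [hc, mul_smul_comm, pow_succ']

end ShortGrading

/-! ### The weight of the generator -/

namespace MvPolynomial

variable {σ : Type*}

theorem coeff_X_mul_pderiv (j : σ) (p : MvPolynomial σ ℂ) (s : σ →₀ ℕ) :
    coeff s (X j * pderiv j p) = s j * coeff s p := by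
  classical
  induction p using MvPolynomial.induction_on' with
  | monomial t c =>
    rw [X_mul_pderiv_monomial, coeff_smul, coeff_monomial, nsmul_eq_mul]
    split_ifs with h
    · rw [h]
    · simp
  | add p q hp hq => rw [map_add, mul_add, coeff_add, hp, hq, coeff_add, mul_add]

theorem X_mul_pderiv_iterate {j : σ} {c : ℂ} {p : MvPolynomial σ ℂ}
    (h : X j * pderiv j p = C c * p) (i : ℕ) :
    X j * pderiv j ((pderiv j)^[i] p) = C (c - i) * (pderiv j)^[i] p := by
  induction i with
  | zero => simpa using h
  | succ i ih =>
    have h1 := congrArg (pderiv j) ih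
    rw [pderiv_mul, pderiv_X_self, pderiv_mul, pderiv_C, one_mul, zero_mul, zero_add] at h1
    rw [Function.iterate_succ_apply']
    simp only [Nat.cast_succ, C_sub, C_add, C_1] at h1 ⊢
    linear_combination h1

theorem X_pow_mul_iterate_pderiv {j : σ} {n : ℕ} {p : MvPolynomial σ ℂ}
    (h : X j * pderiv j p = C (n : ℂ) * p) {i : ℕ} (hi : i ≤ n) :
    X j ^ i * (pderiv j)^[i] p = C (n.descFactorial i : ℂ) * p := by
  induction i with
  | zero => simp
  | succ i ih =>
    have h1 := X_mul_pderiv_iterate h i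
    rw [Function.iterate_succ_apply', pow_succ, mul_assoc, h1, mul_left_comm, ih (by omega),
      Nat.descFactorial_succ, Nat.cast_mul, Nat.cast_sub (by omega), C_mul, mul_assoc]

theorem totalDegree_pderiv_le (k : σ) (f : MvPolynomial σ ℂ) :
    (pderiv k f).totalDegree ≤ f.totalDegree := by
  by_cases h : pderiv k f = 0
  · simp [h]
  · exact (totalDegree_pderiv_lt h).le

theorem totalDegree_iterate_pderiv_lt {k : σ} {f : MvPolynomial σ ℂ} {n : ℕ}
    (h : (pderiv k)^[n + 1] f ≠ 0) : ((pderiv k)^[n + 1] f).totalDegree < f.totalDegree := by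
  rw [Function.iterate_succ_apply'] at h ⊢
  refine (totalDegree_pderiv_lt h).trans_le ?_
  clear h
  induction n with
  | zero => rfl
  | succ n ih =>
    rw [Function.iterate_succ_apply']
    exact (totalDegree_pderiv_le _ _).trans ih

end MvPolynomial

namespace ShortGrading

open MvPolynomial

variable {ι L : Type*} [Fintype ι] [DecidableEq ι] [LieRing L] [LieAlgebra ℂ L]

local notation "κ" => killingForm ℂ L

/-- The element `h` of degree `0` acts diagonally on the basis `f`, with eigenvalues `0`, `-1` and
`-2`, the last one only on `f j₀`, and it is part of an `𝔰𝔩₂`-triple spanned by `h`, `e j₀` and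
`f j₀`. -/
structure IsDiagonal (S : ShortGrading ι L) (h : L) (ε : ι → ℕ) (j₀ : ι) (a : ℂ) : Prop where
  mem : h ∈ S.lev 0
  lie_f : ∀ j, ⁅h, S.f j⁆ = -(ε j : ℂ) • S.f j
  le_two : ∀ j, ε j ≤ 2
  eq_two : ∀ j, ε j = 2 ↔ j = j₀
  lie_e_f : ⁅S.e j₀, S.f j₀⁆ = a • h
  ne_zero : a ≠ 0

namespace IsDiagonal

variable {S : ShortGrading ι L} {h : L} {ε : ι → ℕ} {j₀ : ι} {a : ℂ} (hS : IsDiagonal S h ε j₀ a)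
include hS

theorem eps : ε j₀ = 2 := (hS.eq_two j₀).2 rfl

theorem killing_z : κ S.z h ≠ 0 := by
  intro h0
  have h1 : κ S.z ⁅S.e j₀, S.f j₀⁆ = 1 := by
    rw [← killing_lie, S.lie_z_e, S.killing_e_f, if_pos rfl]
  rw [hS.lie_e_f, map_smul, h0, smul_zero] at h1
  exact zero_ne_one h1

theorem killing_f {u : L} {c : ℂ} (hc : ⁅h, u⁆ = c • u) (j : ι) :
    (c - ε j) * κ (S.f j) u = 0 := by
  have h1 := killing_lie' h (S.f j) u
  rw [hS.lie_f, hc, map_smul, map_smul, LinearMap.smul_apply, smul_eq_mul, smul_eq_mul] at h1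
  linear_combination h1

variable [IsKilling ℂ L]

omit hS in
theorem eq_zero_of_killing_f {u : L} (hu : u ∈ S.lev 1) (h : ∀ j, κ (S.f j) u = 0) : u = 0 := by
  refine eq_zero_of_killing hu fun y hy ↦ ?_
  rw [eq_sum_of_mem hy]
  simp [h]

theorem lie_e (j : ι) : ⁅h, S.e j⁆ = (ε j : ℂ) • S.e j := by
  rw [← sub_eq_zero]
  refine eq_zero_of_killing_f (S := S) (sub_mem (lie_mem_lev_of_eq (by norm_num) hS.mem (e_mem j))
    (Submodule.smul_mem _ _ (e_mem j))) fun k ↦ ?_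
  have h1 := killing_lie' h (S.f k) (S.e j)
  rw [hS.lie_f, map_smul, LinearMap.smul_apply, smul_eq_mul] at h1
  rw [map_sub, map_smul, ← neg_eq_iff_eq_neg.2 h1, killing_comm, S.killing_e_f, smul_eq_mul]
  split_ifs with hjk
  · rw [hjk]; ring
  · ring

theorem killing_e {u : L} {c : ℂ} (hc : ⁅h, u⁆ = c • u) (j : ι) :
    (c + ε j) * κ (S.e j) u = 0 := by
  have h1 := killing_lie' h (S.e j) u
  rw [hS.lie_e, hc, map_smul, map_smul, LinearMap.smul_apply, smul_eq_mul, smul_eq_mul] at h1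
  linear_combination h1

theorem eq_zero_neg {u : L} (hu : u ∈ S.lev (-1)) {c : ℂ} (hc : ⁅h, u⁆ = c • u)
    (h0 : ∀ j, c + ε j ≠ 0) : u = 0 := by
  rw [eq_sum_of_mem hu]
  exact Finset.sum_eq_zero fun j _ ↦ by
    rw [(mul_eq_zero.1 (hS.killing_e hc j)).resolve_left (h0 j), zero_smul]

theorem killing_e_lie {x : L} {c : ℂ} (hc : ⁅h, x⁆ = c • x) {j l : ι} (hne : c + ε j - ε l ≠ 0) :
    κ (S.e j) ⁅x, S.f l⁆ = 0 := by
  have h1 : ⁅h, ⁅x, S.f l⁆⁆ = (c - ε l) • ⁅x, S.f l⁆ := by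
    rw [leibniz_lie, hc, hS.lie_f, smul_lie, lie_smul, ← add_smul, sub_eq_add_neg]
  refine (mul_eq_zero.1 (hS.killing_e h1 j)).resolve_left fun h2 ↦ hne ?_
  rw [← h2]; ring

omit [IsKilling ℂ L] in
theorem ne_of_eq_one {k : ι} (hk : ε k = 1) : k ≠ j₀ := by
  rintro rfl
  have := hS.eps
  omega

/-- Restriction to the coordinates on which `h` has an even eigenvalue is injective on the
polynomials killed by the elements `[f j₀, e k]`. -/
theorem eq_zero_of_restrictZero {g : MvPolynomial ι ℂ}
    (hg : ∀ k, ε k = 1 → S.der ⁅S.f j₀, S.e k⁆ g = 0)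
    (h0 : restrictZero {k | ε k = 1} g = 0) : g = 0 := by
  have hj₀ : j₀ ∉ {k | ε k = 1} := fun hk ↦ hS.ne_of_eq_one hk rfl
  refine eq_zero_of_common_eigenvector (φ := restrictZero {k | ε k = 1}) (Z := {k | ε k = 1})
    (fun k ↦ S.der ⁅S.f j₀, S.e k⁆) (fun w j k ↦ ⟨_, by rw [der_X, pderiv_ell]⟩) {k | ε k = 1}
    (fun j hj e he ↦ by rw [restrictZero_pderiv hj, he, map_zero]) ?_
    (fun g hg h ↦ by rwa [restrictZero_eq_self hg] at h) g (fun _ ↦ 0)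
    (fun k ↦ by rw [hg k k.2, C_0, zero_mul]) h0
  intro e he h1 k hk
  have hx : ⁅h, ⁅S.f j₀, S.e k⁆⁆ = (-1 : ℂ) • ⁅S.f j₀, S.e k⁆ := by
    rw [leibniz_lie, hS.lie_f, hS.lie_e, smul_lie, lie_smul, ← add_smul, hS.eps, show ε k = 1 from hk]
    congr 1; norm_num
  have h2 := he ⟨k, hk⟩
  rw [der_apply, map_sum, Finset.sum_eq_single k] at h2
  · -- only the coordinate `j₀` survives in the coefficient of the derivative along `k`
    rw [map_mul, ell_apply, Finset.sum_eq_single j₀] at h2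
    · have h3 : κ (S.e j₀) ⁅⁅S.f j₀, S.e k⁆, S.f k⁆ = a := by
        rw [lie_lie, lie_eq_zero_of_mem_neg_one (f_mem j₀) (f_mem k), lie_zero, sub_zero,
          ← killing_lie, hS.lie_e_f, ← killing_lie, smul_lie, hS.lie_e, show ε k = 1 from hk]
        simp [S.killing_e_f]
      rw [h3, map_smul, restrictZero_X_of_notMem hj₀, smul_mul_assoc, smul_eq_zero,
        or_iff_right hS.ne_zero, mul_eq_zero, or_iff_right (X_ne_zero _)] at h2
      exact h2
    · intro j _ hj
      rw [hS.killing_e_lie hx, zero_smul]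
      intro h3
      rw [show ε k = 1 from hk] at h3
      have h4 : (ε j : ℂ) = (2 : ℕ) := by push_cast at h3 ⊢; linear_combination h3
      exact hj ((hS.eq_two j).1 (by exact_mod_cast h4))
    · simp
  · intro l _ hl
    by_cases hlK : ε l = 1
    · rw [ell_apply, Finset.sum_eq_zero, zero_mul, map_zero]
      intro j _
      by_cases hj : j = j₀
      · have h3 : κ (S.e j) ⁅⁅S.f j₀, S.e k⁆, S.f l⁆ = 0 := by
          rw [lie_lie, lie_eq_zero_of_mem_neg_one (f_mem j₀) (f_mem l), lie_zero, sub_zero, hj,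
            ← killing_lie, hS.lie_e_f, ← killing_lie, smul_lie, hS.lie_e]
          simp [S.killing_e_f, hl.symm]
        rw [h3, zero_smul]
      · rw [hS.killing_e_lie hx, zero_smul]
        intro h3
        rw [hlK] at h3
        have h4 : (ε j : ℂ) = (2 : ℕ) := by push_cast at h3 ⊢; linear_combination h3
        exact hj ((hS.eq_two j).1 (by exact_mod_cast h4))
    · rw [map_mul, h1 l hlK, mul_zero]
  · simp

omit [IsKilling ℂ L] in
/-- Along the even coordinates, the weight of a semi-invariant is twice its degree in the
coordinate `j₀`. -/
theorem exists_X_mul_pderiv {c : ℂ} {w : MvPolynomial ι ℂ} (hw : S.der h w = -c • w)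
    (h0 : restrictZero {k | ε k = 1} w ≠ 0) :
    ∃ n : ℕ, c = 2 * n ∧ X j₀ * pderiv j₀ (restrictZero {k | ε k = 1} w) =
      C (n : ℂ) * restrictZero {k | ε k = 1} w := by
  set K := {k | ε k = 1} with hK
  have hj₀ : j₀ ∉ K := fun hk ↦ hS.ne_of_eq_one hk rfl
  have h1 : (2 : ℂ) • (X j₀ * pderiv j₀ (restrictZero K w)) = c • restrictZero K w := by
    have h2 := congrArg (restrictZero K) hw
    rw [der_apply, map_sum, Finset.sum_eq_single j₀, map_smul] at h2
    · rw [hS.lie_f, map_smul, ell_f, hS.eps, smul_mul_assoc, map_smul, map_mul,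
        restrictZero_X_of_notMem hj₀, restrictZero_pderiv hj₀, neg_smul, neg_smul, neg_inj] at h2
      exact_mod_cast h2
    · intro j _ hj
      rw [hS.lie_f, map_smul, ell_f, smul_mul_assoc, map_smul, map_mul]
      have h2 := hS.le_two j
      have h3 := mt (hS.eq_two j).1 hj
      have h4 : ε j = 0 ∨ ε j = 1 := by omega
      rcases h4 with h4 | h4
      · rw [h4]; simp
      · rw [restrictZero_X_of_mem (show j ∈ K from h4)]; simp
    · simp
  obtain ⟨s, hs⟩ := ne_zero_iff.1 h0
  have h2 : c = 2 * s j₀ := by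
    have h3 := congrArg (coeff s) h1
    rw [coeff_smul, coeff_smul, coeff_X_mul_pderiv, smul_eq_mul, smul_eq_mul, ← mul_assoc] at h3
    exact (mul_right_cancel₀ hs h3).symm
  refine ⟨s j₀, h2, ?_⟩
  rw [h2, mul_smul] at h1
  rw [smul_right_injective _ (two_ne_zero (α := ℂ)) h1, smul_eq_C_mul]

theorem lie_sub_f {x : L} (hx : x ∈ S.lev 1) (hK : ∀ k, ε k = 1 → κ x (S.f k) = 0) :
    ⁅h, x - κ x (S.f j₀) • S.e j₀⁆ = 0 := by
  refine eq_zero_of_killing_f (S := S) (lie_mem_lev_of_eq (by norm_num) hS.mem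
    (sub_mem hx (Submodule.smul_mem _ _ (e_mem j₀)))) fun k ↦ ?_
  have h1 := killing_lie' h (S.f k) (x - κ x (S.f j₀) • S.e j₀)
  rw [← neg_eq_iff_eq_neg.2 h1, hS.lie_f, map_smul, LinearMap.smul_apply, map_sub, map_smul,
    killing_comm (S.f k) (S.e j₀), S.killing_e_f, killing_comm (S.f k) x]
  have h2 := hS.le_two k
  split_ifs with hk
  · rw [← hk]; simp
  · have h3 := mt (hS.eq_two k).1 (Ne.symm hk)
    have h4 : ε k = 0 ∨ ε k = 1 := by omega
    rcases h4 with h4 | h4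
    · rw [h4]; simp
    · rw [hK k h4]; simp

/-- If `x` has even coordinates only and is invertible, in the sense that `[x, y] = z` for some `y`,
then its component of weight zero acts injectively on the vectors of weight `-1`. -/
theorem eq_zero_of_lie_sub {x y u : L} (hx : x ∈ S.lev 1) (hK : ∀ k, ε k = 1 → κ x (S.f k) = 0)
    (hy : y ∈ S.lev (-1)) (hxy : ⁅x, y⁆ = S.z) (hu : u ∈ S.lev (-1)) (hhu : ⁅h, u⁆ = -u)
    (h0 : ⁅x - κ x (S.f j₀) • S.e j₀, u⁆ = 0) : u = 0 := by
  have hv := hS.lie_sub_f hx hK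
  set t := κ x (S.f j₀) with ht
  set v := x - t • S.e j₀ with hvdef
  have hvm : v ∈ S.lev 1 := sub_mem hx (Submodule.smul_mem _ _ (e_mem j₀))
  have hxv : x = t • S.e j₀ + v := by rw [hvdef]; abel
  have hz (w : L) (hw : w ∈ S.lev (-1)) : w = ⁅y, ⁅x, w⁆⁆ := by
    have h1 := mem_lev_neg_one.1 hw
    rw [← hxy, lie_lie, lie_eq_zero_of_mem_neg_one hy hw, lie_zero, zero_sub] at h1
    exact (neg_injective h1).symm
  have hvf : ⁅v, S.f j₀⁆ = 0 := by
    set q := ⁅v, S.f j₀⁆ with hq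
    have hqm : q ∈ S.lev 0 := lie_mem_lev_of_eq (by norm_num) hvm (f_mem j₀)
    have h1 : ⁅h, q⁆ = (-2 : ℂ) • q := by
      rw [hq, leibniz_lie, hv, zero_lie, zero_add, hS.lie_f, lie_smul, hS.eps]; norm_num
    have h2 : ⁅S.e j₀, q⁆ = 0 := by
      rw [hq, leibniz_lie, lie_eq_zero_of_mem_one (e_mem j₀) hvm, zero_lie, zero_add, hS.lie_e_f,
        lie_smul, ← lie_skew, hv, neg_zero, smul_zero]
    have h3 : ⁅S.f j₀, q⁆ = 0 := by
      refine hS.eq_zero_neg (c := -4) (lie_mem_lev_of_eq (by norm_num) (f_mem j₀) hqm) ?_ fun j h4 ↦ ?_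
      · rw [leibniz_lie, h1, hS.lie_f, smul_lie, lie_smul, ← add_smul, hS.eps]
        congr 1; norm_num
      · have h5 : (ε j : ℂ) = (4 : ℕ) := by push_cast; linear_combination h4
        have h6 : ε j = 4 := by exact_mod_cast h5
        have := hS.le_two j
        omega
    have h4 := leibniz_lie (S.e j₀) (S.f j₀) q
    rw [h2, h3, lie_zero, lie_zero, add_zero, hS.lie_e_f, smul_lie, h1, smul_smul] at h4
    exact (smul_eq_zero.1 h4.symm).resolve_left (mul_ne_zero hS.ne_zero (by norm_num))
  have hty : 2 * (t * a * κ (S.e j₀) y) = 1 := by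
    have h1 := congrArg (κ (S.e j₀)) (hz _ (f_mem j₀))
    have h2 := killing_lie' h (S.e j₀) y
    rw [hS.lie_e, map_smul, LinearMap.smul_apply, hS.eps, smul_eq_mul] at h2
    rw [S.killing_e_f, if_pos rfl, hxv, add_lie, hvf, add_zero, smul_lie, hS.lie_e_f, smul_smul,
      lie_smul, map_smul, ← lie_skew, map_neg, ← h2, smul_eq_mul] at h1
    rw [h1]; push_cast; ring
  have hu' : u = t • ⁅y, ⁅S.e j₀, u⁆⁆ := by
    conv_lhs => rw [hz u hu, hxv, add_lie, h0, add_zero, smul_lie, lie_smul]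
  have he : ⁅h, ⁅S.e j₀, u⁆⁆ = (1 : ℂ) • ⁅S.e j₀, u⁆ := by
    rw [leibniz_lie, hS.lie_e, hhu, hS.eps, smul_lie, lie_neg]; module
  rw [eq_sum_of_mem hu]
  refine Finset.sum_eq_zero fun k _ ↦ ?_
  rw [smul_eq_zero]
  left
  by_cases hk : ε k = 1
  · have h1 := congrArg (κ (S.e k)) hu'
    have h2 : κ (S.e k) ⁅y, ⁅S.e j₀, u⁆⁆ = κ (S.e j₀) y * (a * κ (S.e k) u) := by
      have h3 : ⁅S.f j₀, ⁅S.e j₀, u⁆⁆ = a • u := by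
        rw [leibniz_lie, lie_eq_zero_of_mem_neg_one (f_mem j₀) hu, lie_zero, add_zero,
          ← lie_skew (S.f j₀) (S.e j₀), hS.lie_e_f, neg_lie, smul_lie, hhu, smul_neg, neg_neg]
      conv_lhs => rw [eq_sum_of_mem hy, sum_lie, map_sum, Finset.sum_eq_single j₀
        (fun j _ hj ↦ by
          rw [smul_lie, map_smul, ← lie_skew, map_neg, hS.killing_e_lie he, neg_zero, smul_zero]
          intro h4
          rw [hk] at h4
          have h5 : (ε j : ℂ) = (2 : ℕ) := by push_cast at h4 ⊢; linear_combination -h4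
          exact hj ((hS.eq_two j).1 (by exact_mod_cast h5))) (by simp)]
      rw [smul_lie, map_smul, h3, map_smul, smul_eq_mul, smul_eq_mul]
    rw [map_smul, h2, smul_eq_mul] at h1
    linear_combination 2 * h1 + κ (S.e k) u * hty
  · have h1 : ⁅h, u⁆ = (-1 : ℂ) • u := by rw [hhu, neg_one_smul]
    refine (mul_eq_zero.1 (hS.killing_e h1 k)).resolve_left fun h2 ↦ hk ?_
    have h5 : (ε k : ℂ) = (1 : ℕ) := by push_cast; linear_combination h2
    exact_mod_cast h5

/-- Given a nonconstant semi-invariant, restriction to the even coordinates is injective on the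
polynomials killed by the elements `[e j₀, f k]`. -/
theorem eq_zero_of_restrictZero' {d : ℕ} (hd : d ≠ 0) {w : MvPolynomial ι ℂ} (hw : S.SemiInv d w)
    (hw0 : restrictZero {k | ε k = 1} w ≠ 0) {g : MvPolynomial ι ℂ}
    (hg : ∀ k, ε k = 1 → S.der ⁅S.e j₀, S.f k⁆ g = 0)
    (h0 : restrictZero {k | ε k = 1} g = 0) : g = 0 := by
  classical
  have hj₀ : j₀ ∉ {k | ε k = 1} := fun hk ↦ hS.ne_of_eq_one hk rfl
  refine eq_zero_of_common_eigenvector (φ := restrictZero {k | ε k = 1}) (Z := {k | ε k = 1})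
    (fun k ↦ S.der ⁅S.e j₀, S.f k⁆) (fun w j k ↦ ⟨_, by rw [der_X, pderiv_ell]⟩) {k | ε k = 1}
    (fun j hj e he ↦ by rw [restrictZero_pderiv hj, he, map_zero]) ?_
    (fun g hg h ↦ by rwa [restrictZero_eq_self hg] at h) g (fun _ ↦ 0)
    (fun k ↦ by rw [hg k k.2, C_0, zero_mul]) h0
  intro e he h1 k₀ hk₀
  by_contra hr
  -- choose a point with even coordinates where both the semi-invariant and the derivative are
  -- nonzero
  obtain ⟨v, hv⟩ : ∃ v, eval v (restrictZero {k | ε k = 1} (w * pderiv k₀ e)) ≠ 0 := by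
    by_contra! h2
    rw [map_mul] at h2
    exact mul_ne_zero hw0 hr (MvPolynomial.funext fun v ↦ by rw [h2, map_zero])
  obtain ⟨v', hv', hv⟩ : ∃ v' : ι → ℂ, (∀ k, ε k = 1 → v' k = 0) ∧
      eval v' (w * pderiv k₀ e) ≠ 0 := by
    rw [eval_restrictZero'] at hv
    exact ⟨_, fun k hk ↦ if_pos hk, hv⟩
  obtain ⟨x, hx, hxv⟩ := S.exists_pt_eq v'
  have hK : ∀ k, ε k = 1 → κ x (S.f k) = 0 := fun k hk ↦
    (congrFun hxv k : κ x (S.f k) = v' k).trans (hv' k hk)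
  have hev (q : MvPolynomial ι ℂ) : eval (S.pt x) (restrictZero {k | ε k = 1} q) = eval (S.pt x) q :=
    eval_restrictZero (fun k hk ↦ hK k hk) q
  rw [map_mul, ← hxv, mul_ne_zero_iff] at hv
  obtain ⟨y, hy, hxy⟩ := hw.exists_lie_eq_z hd hx hv.1
  set u := ∑ l, (if ε l = 1 then eval (S.pt x) (pderiv l e) else 0) • S.f l with hu
  have hum : u ∈ S.lev (-1) := sum_mem fun j _ ↦ Submodule.smul_mem _ _ (f_mem j)
  have hgrad : S.grad e (S.pt x) = u := by
    refine Finset.sum_congr rfl fun l _ ↦ ?_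
    split_ifs with hl
    · rfl
    · rw [← hev, h1 l hl, map_zero]
  have hhu : ⁅h, u⁆ = -u := by
    rw [hu, lie_sum, ← Finset.sum_neg_distrib]
    refine Finset.sum_congr rfl fun l _ ↦ ?_
    rw [lie_smul, hS.lie_f]
    split_ifs with hl
    · rw [hl]; simp
    · simp
  have hv0 := hS.lie_sub_f hx hK
  set t := κ x (S.f j₀)
  set v₀ := x - t • S.e j₀ with hv₀
  have hvm : v₀ ∈ S.lev 1 := sub_mem hx (Submodule.smul_mem _ _ (e_mem j₀))
  have hq : ⁅v₀, u⁆ = 0 := by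
    set q := ⁅v₀, u⁆ with hq
    have hqm : q ∈ S.lev 0 := lie_mem_lev_of_eq (by norm_num) hvm hum
    have hhq : ⁅h, q⁆ = (-1 : ℂ) • q := by
      rw [hq, leibniz_lie, hv0, zero_lie, zero_add, hhu, lie_neg, neg_one_smul]
    have h2 : ⁅S.f j₀, q⁆ = 0 := by
      refine hS.eq_zero_neg (c := -3) (lie_mem_lev_of_eq (by norm_num) (f_mem j₀) hqm) ?_ fun j h4 ↦ ?_
      · rw [leibniz_lie, hhq, hS.lie_f, smul_lie, lie_smul, ← add_smul, hS.eps]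
        congr 1; norm_num
      · have h5 : (ε j : ℂ) = (3 : ℕ) := by push_cast; linear_combination h4
        have h6 : ε j = 3 := by exact_mod_cast h5
        have := hS.le_two j
        omega
    have h3 : ⁅S.e j₀, q⁆ = 0 := by
      have hw1 : ⁅h, ⁅S.e j₀, q⁆⁆ = (1 : ℂ) • ⁅S.e j₀, q⁆ := by
        rw [leibniz_lie, hhq, hS.lie_e, hS.eps, smul_lie, lie_smul]; module
      refine eq_zero_of_killing_f (S := S) (lie_mem_lev_of_eq (by norm_num) (e_mem j₀) hqm) fun k ↦ ?_
      by_cases hk : ε k = 1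
      · -- this is the vanishing of the derivative along `[e j₀, f k]`
        have h4 := he ⟨k, hk⟩
        have h5 := congrArg (eval (S.pt x)) h4
        have hm : ⁅S.e j₀, S.f k⁆ ∈ S.lev 0 :=
          lie_mem_lev_of_eq (by norm_num) (e_mem j₀) (f_mem k)
        rw [hev, eval_der e x hm, map_zero, hgrad, neg_eq_zero] at h5
        have h6 : x = t • S.e j₀ + v₀ := by rw [hv₀]; abel
        have hek : ⁅h, ⁅S.e j₀, S.f k⁆⁆ = (1 : ℂ) • ⁅S.e j₀, S.f k⁆ := by
          rw [leibniz_lie, hS.lie_e, hS.lie_f, hS.eps, hk, smul_lie, lie_smul]; module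
        have hze : ⁅⁅S.e j₀, S.f k⁆, S.e j₀⁆ = 0 := by
          refine eq_zero_of_killing_f (S := S) (lie_mem_lev_of_eq (by norm_num) hm (e_mem j₀))
            fun j ↦ ?_
          have h7 : ⁅h, ⁅⁅S.e j₀, S.f k⁆, S.e j₀⁆⁆ = (3 : ℂ) • ⁅⁅S.e j₀, S.f k⁆, S.e j₀⁆ := by
            rw [leibniz_lie, hek, hS.lie_e, hS.eps, lie_smul, smul_lie]; module
          refine (mul_eq_zero.1 (hS.killing_f h7 j)).resolve_left fun h8 ↦ ?_
          have h9 : (ε j : ℂ) = (3 : ℕ) := by push_cast; linear_combination -h8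
          have h10 : ε j = 3 := by exact_mod_cast h9
          have := hS.le_two j
          omega
        rw [h6, add_lie, map_add, smul_lie, map_smul, ← killing_lie, hze, map_zero,
          LinearMap.zero_apply, smul_zero, zero_add] at h5
        have h7 := killing_lie' (S.e j₀) (S.f k) q
        rw [← neg_eq_iff_eq_neg.2 h7, h5, neg_zero]
      · refine (mul_eq_zero.1 (hS.killing_f hw1 k)).resolve_left fun h8 ↦ hk ?_
        have h9 : (ε k : ℂ) = (1 : ℕ) := by push_cast; linear_combination -h8
        exact_mod_cast h9
    have h4 := leibniz_lie (S.f j₀) (S.e j₀) q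
    rw [h3, h2, lie_zero, lie_zero, add_zero, ← lie_skew (S.f j₀) (S.e j₀), hS.lie_e_f, neg_lie,
      smul_lie, hhq, neg_one_smul, smul_neg, neg_neg] at h4
    exact (smul_eq_zero.1 h4.symm).resolve_left hS.ne_zero
  have hu0 := hS.eq_zero_of_lie_sub hx hK hy hxy hum hhu hq
  rw [← hgrad] at hu0
  have h2 := S.killing_e_grad e (S.pt x) k₀
  rw [hu0, map_zero] at h2
  exact hv.2 h2.symm

/-- An irreducible nonconstant semi-invariant `w` has weight `-2` under `h`. On the coordinates where
`h` has even eigenvalues, `w` is `X j₀ ^ n` times a polynomial that does not involve `X j₀`, and its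
weight is `-2n`. If `n` were at least `2`, then a power of the derivative of `w` of order `n - 1`
along `j₀` would be divisible by `w`, and so would be this derivative, which has smaller degree. -/
theorem weight_eq_two {d : ℕ} (hd : d ≠ 0) {w : MvPolynomial ι ℂ} (hw : S.SemiInv d w)
    (hirr : Irreducible w) : d / κ S.z S.z * κ S.z h = 2 := by
  set K := {k | ε k = 1} with hKdef
  have hj₀ : j₀ ∉ K := fun hk ↦ hS.ne_of_eq_one hk rfl
  have hkz (k : ι) (hk : ε k = 1) : κ S.z ⁅S.e j₀, S.f k⁆ = 0 := by
    rw [← killing_lie, S.lie_z_e, S.killing_e_f, if_neg (hS.ne_of_eq_one hk).symm]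
  have hW : restrictZero K w ≠ 0 := by
    refine fun h0 ↦ hirr.ne_zero (hS.eq_zero_of_restrictZero (fun k hk ↦ ?_) h0)
    refine hw.der_eq_zero (lie_mem_lev_of_eq (by norm_num) (f_mem j₀) (e_mem k)) ?_
    rw [← lie_skew, map_neg, ← killing_lie, S.lie_z_e, S.killing_e_f,
      if_neg (hS.ne_of_eq_one hk), neg_zero]
  obtain ⟨n, hn, hX⟩ := hS.exists_X_mul_pderiv (c := d / κ S.z S.z * κ S.z h)
    (by rw [hw _ hS.mem]; congr 1; ring) hW
  have hn0 : n ≠ 0 := by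
    rintro rfl
    rw [Nat.cast_zero, mul_zero] at hn
    exact mul_ne_zero (div_ne_zero (by exact_mod_cast hd) S.killing_z_z) hS.killing_z hn
  obtain ⟨n, rfl⟩ := Nat.exists_eq_succ_of_ne_zero hn0
  rcases n with _ | n
  · rw [hn]; norm_num
  exfalso
  have hres (i : ℕ) : restrictZero K ((pderiv j₀)^[i] w) = (pderiv j₀)^[i] (restrictZero K w) := by
    induction i with
    | zero => rfl
    | succ i ih =>
      rw [Function.iterate_succ_apply', Function.iterate_succ_apply', restrictZero_pderiv hj₀, ih]
  have hkill (i : ℕ) (k : ι) (hk : ε k = 1) : S.der ⁅S.e j₀, S.f k⁆ ((pderiv j₀)^[i] w) = 0 := by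
    induction i with
    | zero => exact hw.der_eq_zero (lie_mem_lev_of_eq (by norm_num) (e_mem j₀) (f_mem k)) (hkz k hk)
    | succ i ih =>
      have hek : ⁅h, ⁅S.e j₀, S.f k⁆⁆ = (1 : ℂ) • ⁅S.e j₀, S.f k⁆ := by
        rw [leibniz_lie, hS.lie_e, hS.lie_f, hS.eps, hk, smul_lie, lie_smul]; module
      rw [Function.iterate_succ_apply']
      have h1 := congrArg (pderiv j₀) ih
      rw [der_apply, map_sum, map_zero] at h1
      rw [der_apply, ← h1]
      refine Finset.sum_congr rfl fun l _ ↦ ?_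
      rw [pderiv_mul, pderiv_ell, hS.killing_e_lie hek, C_0, zero_mul, zero_add, pderiv_comm']
      intro h2
      rw [hS.eps] at h2
      have h3 : (ε l : ℂ) = (3 : ℕ) := by push_cast at h2 ⊢; linear_combination -h2
      have h4 : ε l = 3 := by exact_mod_cast h3
      have := hS.le_two l
      omega
  set l := (pderiv j₀)^[n + 1] w with hl
  set q := (pderiv j₀)^[n + 2] w with hq
  set c : ℂ := ((n + 2).factorial : ℂ) with hc
  have hc0 : c ≠ 0 := Nat.cast_ne_zero.2 (Nat.factorial_ne_zero _)
  have hl1 : X j₀ ^ (n + 1) * restrictZero K l = C c * restrictZero K w := by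
    rw [hl, hres, X_pow_mul_iterate_pderiv hX (by omega), Nat.descFactorial_eq_div (by omega)]
    simp [hc, ← hKdef]
  have hq1 : X j₀ ^ (n + 2) * restrictZero K q = C c * restrictZero K w := by
    rw [hq, hres, X_pow_mul_iterate_pderiv hX (by omega), Nat.descFactorial_self]
  have hl0 : l ≠ 0 := by
    intro h0
    rw [h0, map_zero, mul_zero] at hl1
    exact mul_ne_zero (C_ne_zero.2 hc0) hW hl1.symm
  -- a power of the derivative `l` is divisible by `w`, as can be seen on even coordinates
  have hpow : l ^ (n + 2) - C c * (w * q ^ (n + 1)) = 0 := by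
    refine hS.eq_zero_of_restrictZero' hd hw hW (fun k hk ↦ ?_) ?_
    · have h1 := hkill (n + 1) k hk
      have h2 := hkill (n + 2) k hk
      have h3 := hkill 0 k hk
      rw [← hl] at h1
      rw [← hq] at h2
      rw [Function.iterate_zero_apply] at h3
      rw [map_sub, Derivation.leibniz_pow, ← smul_eq_C_mul, Derivation.map_smul,
        Derivation.leibniz, Derivation.leibniz_pow, h1, h2, h3]
      simp
    · rw [map_sub, map_pow, map_mul, map_mul, map_pow, restrictZero_C, sub_eq_zero]
      refine mul_left_cancel₀ (pow_ne_zero ((n + 1) * (n + 2)) (X_ne_zero (R := ℂ) j₀)) ?_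
      rw [pow_mul, ← mul_pow, hl1]
      calc (C c * restrictZero K w) ^ (n + 2)
          = C c * restrictZero K w * (C c * restrictZero K w) ^ (n + 1) := by ring
        _ = C c * restrictZero K w * (X j₀ ^ (n + 2) * restrictZero K q) ^ (n + 1) := by rw [hq1]
        _ = _ := by ring
  have hdvd : w ∣ l := by
    refine (UniqueFactorizationMonoid.irreducible_iff_prime.1 hirr).dvd_of_dvd_pow (n := n + 2) ?_
    rw [sub_eq_zero.1 hpow]
    exact ⟨C c * q ^ (n + 1), by ring⟩
  obtain ⟨t, ht⟩ := hdvd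
  have ht0 : t ≠ 0 := by rintro rfl; exact hl0 (by rw [ht, mul_zero])
  have h1 := totalDegree_iterate_pderiv_lt hl0
  rw [← hl, ht, totalDegree_mul_of_isDomain hirr.ne_zero ht0] at h1
  omega

end IsDiagonal

end ShortGrading

/-! ### Lifting invariants from quotients -/

section trace

variable {E : Type*} [AddCommGroup E] [Module ℂ E]

theorem apply_aeval_eq_eval_mul {φ : Dual ℂ E} {T : Module.End ℂ E} {μ : ℂ}
    (h : ∀ v, φ (T v) = μ * φ v) (q : Polynomial ℂ) (v : E) :
    φ (Polynomial.aeval T q v) = q.eval μ * φ v := by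
  induction q using Polynomial.induction_on' generalizing v with
  | add p q hp hq => rw [map_add, LinearMap.add_apply, map_add, hp, hq, Polynomial.eval_add, add_mul]
  | monomial n a =>
    rw [Polynomial.aeval_monomial, Polynomial.eval_monomial, Module.End.mul_apply,
      Module.algebraMap_end_apply, map_smul, smul_eq_mul, mul_assoc]
    congr 1
    induction n generalizing v with
    | zero => simp
    | succ n ih => rw [pow_succ, Module.End.mul_apply, ih, h, pow_succ]; ring

/-- An endomorphism is diagonal with real eigenvalues if the members of a given family of linear
forms are eigenvectors of its transpose, with real eigenvalues. -/
def IsRealDiagonal {σ : Type*} (φ : σ → Dual ℂ E) (T : Module.End ℂ E) : Prop :=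
  ∀ i, ∃ c : ℝ, ∀ v, φ i (T v) = c * φ i v

variable [FiniteDimensional ℂ E] {σ : Type*} {φ : σ → Dual ℂ E}
  (hφ : ∀ v, (∀ i, φ i v = 0) → v = 0)
include hφ

theorem IsRealDiagonal.exists_trace_mul_self {T : Module.End ℂ E} (hT : IsRealDiagonal φ T) :
    ∃ r : ℝ, 0 ≤ r ∧ LinearMap.trace ℂ E (T * T) = r ∧ (r = 0 → T = 0) := by
  choose c hc using hT
  have hcc (i : σ) (v : E) : φ i ((T * T) v) = (c i * c i : ℂ) * φ i v := by
    rw [Module.End.mul_apply, hc, hc, mul_assoc]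
  have hr : ∀ μ ∈ (T * T).charpoly.roots, ∃ r : ℝ, 0 ≤ r ∧ (r : ℂ) = μ := by
    intro μ hμ
    have h1 := (Module.End.hasEigenvalue_iff_isRoot_charpoly _ _).2 (Polynomial.isRoot_of_mem_roots hμ)
    obtain ⟨v, hv⟩ := h1.exists_hasEigenvector
    obtain ⟨i, hi⟩ : ∃ i, φ i v ≠ 0 := by
      by_contra! h
      exact hv.2 (hφ v h)
    refine ⟨c i * c i, mul_self_nonneg _, mul_right_cancel₀ hi ?_⟩
    rw [← smul_eq_mul (a := μ), ← map_smul, ← hv.apply_eq_smul, hcc]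
    push_cast; ring
  choose! g hg0 hg using hr
  have hsum : LinearMap.trace ℂ E (T * T) = ((((T * T).charpoly.roots.map g).sum : ℝ) : ℂ) := by
    rw [Module.End.trace_eq_sum_roots_charpoly_of_splits (IsAlgClosed.splits _)]
    rw [← Complex.ofRealHom_eq_coe, map_multiset_sum, Multiset.map_map]
    conv_lhs => rw [← Multiset.map_id (T * T).charpoly.roots]
    congr 1
    exact Multiset.map_congr rfl fun μ hμ ↦ (hg μ hμ).symm
  have hnn : ∀ x ∈ (T * T).charpoly.roots.map g, 0 ≤ x := by
    intro x hx
    obtain ⟨μ, hμ, rfl⟩ := Multiset.mem_map.1 hx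
    exact hg0 μ hμ
  refine ⟨_, Multiset.sum_nonneg hnn, hsum, fun h0 ↦ ?_⟩
  ext v
  rw [LinearMap.zero_apply]
  refine hφ _ fun i ↦ ?_
  rw [hc]
  by_cases hv : φ i v = 0
  · rw [hv, mul_zero]
  -- `c i ^ 2` is a root of the characteristic polynomial, hence zero
  have h1 := apply_aeval_eq_eval_mul (hcc i) (T * T).charpoly v
  rw [LinearMap.aeval_self_charpoly, LinearMap.zero_apply, map_zero, eq_comm, mul_eq_zero,
    or_iff_left hv] at h1
  have hmem : (c i * c i : ℂ) ∈ (T * T).charpoly.roots :=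
    (Polynomial.mem_roots (LinearMap.charpoly_monic _).ne_zero).2 h1
  have h2 : g (c i * c i : ℂ) ≤ 0 := h0 ▸ Multiset.single_le_sum hnn _ (Multiset.mem_map_of_mem g hmem)
  have h3 := hg _ hmem
  rw [le_antisymm h2 (hg0 _ hmem), Complex.ofReal_zero, eq_comm, mul_self_eq_zero] at h3
  rw [h3, zero_mul]

/-- The contribution to a Casimir operator of a pair `(x, y)` that is part of an `𝔰𝔩₂`-triple. -/
theorem exists_trace_mul {x y : Module.End ℂ E} {r : ℝ} (hr : 0 < r)
    (hx : ⁅⁅x, y⁆, x⁆ = (r : ℂ) • x) (ht : IsRealDiagonal φ ⁅x, y⁆) :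
    ∃ s : ℝ, 0 ≤ s ∧ LinearMap.trace ℂ E (x * y) = s ∧ (s = 0 → x = 0) := by
  obtain ⟨s, hs0, hs, hs'⟩ := ht.exists_trace_mul_self hφ
  have hr' : (r : ℂ) ≠ 0 := by exact_mod_cast hr.ne'
  refine ⟨s / r, by positivity, ?_, fun h ↦ ?_⟩
  · have h1 : LinearMap.trace ℂ E (⁅x, y⁆ * ⁅x, y⁆) = r * LinearMap.trace ℂ E (x * y) := by
      have key (t : Module.End ℂ E) :
          LinearMap.trace ℂ E (t * ⁅x, y⁆) = LinearMap.trace ℂ E (⁅t, x⁆ * y) := by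
        rw [Ring.lie_def, Ring.lie_def, mul_sub, sub_mul, map_sub, map_sub, ← mul_assoc,
          ← mul_assoc, LinearMap.trace_mul_comm ℂ (t * y), mul_assoc x]
      rw [key, hx, smul_mul_assoc, map_smul, smul_eq_mul]
    rw [hs] at h1
    rw [Complex.ofReal_div, h1, mul_div_cancel_left₀ _ hr']
  · have h0 : s = 0 := by
      rcases div_eq_zero_iff.1 h with h | h
      · exact h
      · exact absurd h hr.ne'
    rw [hs' h0, zero_lie, eq_comm] at hx
    exact (smul_eq_zero.1 hx).resolve_left hr'

end trace

namespace ShortGrading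

open MvPolynomial

variable {ι L : Type*} [Fintype ι] [DecidableEq ι] [LieRing L] [LieAlgebra ℂ L]

local notation "κ" => killingForm ℂ L

/-- A pair of dual families, for the Killing form, in the part of degree `0` of the orthogonal
complement of the grading element, whose members are of two kinds: diagonal elements with real
eigenvalues, which are dual to themselves, and `𝔰𝔩₂`-pairs. -/
structure PositiveFrame (S : ShortGrading ι L) (I : Type*) [Fintype I] where
  /-- the first family -/
  a : I → L
  /-- the dual family -/
  b : I → L
  a_mem : ∀ i, a i ∈ S.lev 0
  b_mem : ∀ i, b i ∈ S.lev 0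
  killing_z_a : ∀ i, κ S.z (a i) = 0
  killing_z_b : ∀ i, κ S.z (b i) = 0
  expand_a : ∀ x ∈ S.lev 0, κ S.z x = 0 → x = ∑ i, κ (b i) x • a i
  expand_b : ∀ x ∈ S.lev 0, κ S.z x = 0 → x = ∑ i, κ (a i) x • b i
  positive : ∀ i, (b i = a i ∧ ∀ j, ∃ c : ℝ, ⁅a i, S.f j⁆ = (c : ℂ) • S.f j) ∨
    (∃ r : ℝ, 0 < r ∧ ⁅⁅a i, b i⁆, a i⁆ = (r : ℂ) • a i) ∧
      ∀ j, ∃ c : ℝ, ⁅⁅a i, b i⁆, S.f j⁆ = (c : ℂ) • S.f j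

namespace PositiveFrame

variable {S : ShortGrading ι L} {I : Type*} [Fintype I] (F : S.PositiveFrame I)

/-- The Casimir operator of a frame on polynomials. -/
noncomputable def casimir : Module.End ℂ (MvPolynomial ι ℂ) :=
  ∑ i, (S.der (F.a i)).toLinearMap * (S.der (F.b i)).toLinearMap

theorem casimir_apply (p : MvPolynomial ι ℂ) :
    F.casimir p = ∑ i, S.der (F.a i) (S.der (F.b i) p) := by
  simp [casimir]

omit F [Fintype I] in
theorem _root_.ShortGrading.der_sum_smul (J : Finset I) (c : I → ℂ) (y : I → L)
    (p : MvPolynomial ι ℂ) : S.der (∑ i ∈ J, c i • y i) p = ∑ i ∈ J, c i • S.der (y i) p := by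
  classical
  induction J using Finset.induction_on with
  | empty => simp
  | insert i J hi ih =>
    rw [Finset.sum_insert hi, Finset.sum_insert hi, map_add, Derivation.add_apply, ih, map_smul,
      Derivation.smul_apply]

/-- The Casimir operator commutes with the part of degree `0`: as the two families of the frame are
dual and the Killing form is invariant, the commutator cancels. -/
theorem casimir_der {x : L} (hx : x ∈ S.lev 0) (p : MvPolynomial ι ℂ) :
    F.casimir (S.der x p) = S.der x (F.casimir p) := by
  have hz (y : L) : κ S.z ⁅x, y⁆ = 0 := by
    rw [← killing_lie, mem_lev_zero.1 hx, map_zero, LinearMap.zero_apply]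
  have h1 (i : I) : S.der ⁅x, F.a i⁆ (S.der (F.b i) p) =
      ∑ j, κ (F.b j) ⁅x, F.a i⁆ • S.der (F.a j) (S.der (F.b i) p) := by
    conv_lhs => rw [F.expand_a _ (lie_mem_lev_of_eq (by norm_num) hx (F.a_mem i)) (hz _)]
    exact der_sum_smul _ _ _ _
  have h2 (i : I) : S.der (F.a i) (S.der ⁅x, F.b i⁆ p) =
      ∑ j, κ (F.a j) ⁅x, F.b i⁆ • S.der (F.a i) (S.der (F.b j) p) := by
    conv_lhs => rw [F.expand_b _ (lie_mem_lev_of_eq (by norm_num) hx (F.b_mem i)) (hz _)]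
    rw [der_sum_smul, map_sum]
    simp only [Derivation.map_smul]
  have h3 : ∑ i, S.der ⁅x, F.a i⁆ (S.der (F.b i) p) +
      ∑ i, S.der (F.a i) (S.der ⁅x, F.b i⁆ p) = 0 := by
    simp only [h1, h2]
    rw [Finset.sum_comm, ← Finset.sum_add_distrib]
    refine Finset.sum_eq_zero fun i _ ↦ ?_
    rw [← Finset.sum_add_distrib]
    refine Finset.sum_eq_zero fun j _ ↦ ?_
    rw [← add_smul, killing_comm (F.b i), killing_lie', neg_add_cancel, zero_smul]
  simp only [S.der_lie hx (F.a_mem _), S.der_lie hx (F.b_mem _), map_sub, Finset.sum_sub_distrib] at h3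
  rw [casimir_apply, casimir_apply, map_sum]
  linear_combination -h3

theorem casimir_isHomogeneous {n : ℕ} {p : MvPolynomial ι ℂ} (hp : p.IsHomogeneous n) :
    (F.casimir p).IsHomogeneous n := by
  rw [S.isHomogeneous_iff_der_z, ← F.casimir_der z_mem, S.isHomogeneous_iff_der_z.1 hp, map_smul]

end PositiveFrame

theorem isHomogeneous_der {S : ShortGrading ι L} {x : L} (hx : x ∈ S.lev 0) {n : ℕ}
    {p : MvPolynomial ι ℂ} (hp : p.IsHomogeneous n) : (S.der x p).IsHomogeneous n := by
  have h := S.der_lie z_mem hx p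
  rw [mem_lev_zero.1 hx, map_zero, Derivation.zero_apply, eq_comm, sub_eq_zero] at h
  rw [S.isHomogeneous_iff_der_z, h, S.isHomogeneous_iff_der_z.1 hp, Derivation.map_smul]

namespace PositiveFrame

variable {S : ShortGrading ι L} {I : Type*} [Fintype I] (F : S.PositiveFrame I)

/-- On the generalized kernel of the Casimir operator the trace of the latter vanishes. As this
trace is a sum of nonnegative contributions, all of them vanish, and the action is trivial. -/
theorem der_eq_zero_of_casimir_pow {m n : ℕ} {p : MvPolynomial ι ℂ} (hp : p.IsHomogeneous m)
    (h0 : (F.casimir ^ n) p = 0) {x : L} (hx : x ∈ S.lev 0) (hzx : κ S.z x = 0) :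
    S.der x p = 0 := by
  set E : Submodule ℂ (MvPolynomial ι ℂ) :=
    homogeneousSubmodule ι ℂ m ⊓ LinearMap.ker (F.casimir ^ n) with hE
  have hmem (q : MvPolynomial ι ℂ) : q ∈ E ↔ q.IsHomogeneous m ∧ (F.casimir ^ n) q = 0 := Iff.rfl
  have : Module.Finite ℂ (homogeneousSubmodule ι ℂ m) :=
    Module.Finite.iff_fg.2 (homogeneousSubmodule_fg ι ℂ m)
  have : FiniteDimensional ℂ E := Submodule.finiteDimensional_of_le inf_le_left
  have hpow (k : ℕ) {y : L} (hy : y ∈ S.lev 0) (q : MvPolynomial ι ℂ) :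
      (F.casimir ^ k) (S.der y q) = S.der y ((F.casimir ^ k) q) := by
    induction k with
    | zero => rfl
    | succ k ih =>
      rw [pow_succ', Module.End.mul_apply, ih, F.casimir_der hy, Module.End.mul_apply]
  have hst (y : L) (hy : y ∈ S.lev 0) (q : MvPolynomial ι ℂ) (hq : q ∈ E) :
      (S.der y).toLinearMap q ∈ E := by
    rw [hmem] at hq ⊢
    exact ⟨isHomogeneous_der hy hq.1, (hpow n hy q).trans (by rw [hq.2, map_zero])⟩
  set T : (y : L) → y ∈ S.lev 0 → Module.End ℂ E := fun y hy ↦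
    (S.der y).toLinearMap.restrict (hst y hy) with hT
  have hTa (y : L) (hy : y ∈ S.lev 0) (q : E) : (T y hy q : MvPolynomial ι ℂ) = S.der y q := rfl
  set φ : (ι →₀ ℕ) → Dual ℂ E := fun s ↦ lcoeff ℂ s ∘ₗ E.subtype with hφdef
  have hφ : ∀ v, (∀ s, φ s v = 0) → v = 0 := fun v hv ↦ Subtype.ext (MvPolynomial.ext _ _ fun s ↦ hv s)
  have hdiag (y : L) (hy : y ∈ S.lev 0) (h : ∀ j, ∃ c : ℝ, ⁅y, S.f j⁆ = (c : ℂ) • S.f j) :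
      IsRealDiagonal φ (T y hy) := by
    intro s
    choose c hc using h
    refine ⟨∑ j, s j * c j, fun v ↦ ?_⟩
    change coeff s (S.der y v) = _ * coeff s (v : MvPolynomial ι ℂ)
    rw [S.coeff_der_of_diagonal hc]
    push_cast
    rfl
  have hlie (i : I) : T ⁅F.a i, F.b i⁆ (lie_mem_lev_of_eq (by norm_num) (F.a_mem i) (F.b_mem i)) =
      ⁅T (F.a i) (F.a_mem i), T (F.b i) (F.b_mem i)⁆ :=
    LinearMap.ext fun q ↦ Subtype.ext (S.der_lie (F.a_mem i) (F.b_mem i) (q : MvPolynomial ι ℂ))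
  have htr (i : I) : ∃ s : ℝ, 0 ≤ s ∧
      LinearMap.trace ℂ E (T (F.a i) (F.a_mem i) * T (F.b i) (F.b_mem i)) = s ∧
        (s = 0 → T (F.a i) (F.a_mem i) = 0) := by
    rcases F.positive i with ⟨h1, h2⟩ | ⟨⟨r, hr, h1⟩, h2⟩
    · have h3 : T (F.b i) (F.b_mem i) = T (F.a i) (F.a_mem i) := by
        refine LinearMap.ext fun q ↦ Subtype.ext ?_
        change S.der (F.b i) q = S.der (F.a i) q
        rw [h1]
      rw [h3]
      exact (hdiag _ (F.a_mem i) h2).exists_trace_mul_self hφ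
    · refine exists_trace_mul hφ hr ?_ (hlie i ▸ hdiag _
        (lie_mem_lev_of_eq (by norm_num) (F.a_mem i) (F.b_mem i)) h2)
      rw [← hlie]
      refine LinearMap.ext fun q ↦ Subtype.ext ?_
      change S.der _ (S.der _ _) - S.der _ (S.der _ _) = _ • S.der _ _
      rw [← S.der_lie (lie_mem_lev_of_eq (by norm_num) (F.a_mem i) (F.b_mem i)) (F.a_mem i), h1,
        map_smul, Derivation.smul_apply]
  choose s hs0 hs hs' using htr
  have hnil : IsNilpotent (∑ i, T (F.a i) (F.a_mem i) * T (F.b i) (F.b_mem i)) := by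
    refine ⟨n, LinearMap.ext fun q ↦ Subtype.ext ?_⟩
    have hk (k : ℕ) : (((∑ i, T (F.a i) (F.a_mem i) * T (F.b i) (F.b_mem i)) ^ k) q :
        MvPolynomial ι ℂ) = (F.casimir ^ k) q := by
      induction k with
      | zero => rfl
      | succ k ih =>
        rw [pow_succ', pow_succ', Module.End.mul_apply, Module.End.mul_apply, ← ih, casimir_apply,
          LinearMap.sum_apply, AddSubmonoidClass.coe_finsetSum]
        rfl
    rw [hk]
    exact q.2.2
  have hsum : ∑ i, s i = 0 := by
    have h1 := (LinearMap.isNilpotent_trace_of_isNilpotent hnil).eq_zero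
    rw [map_sum] at h1
    simp only [hs] at h1
    exact_mod_cast h1
  have hz (i : I) : T (F.a i) (F.a_mem i) = 0 :=
    hs' i ((Finset.sum_eq_zero_iff_of_nonneg fun i _ ↦ hs0 i).1 hsum i (Finset.mem_univ i))
  rw [F.expand_a x hx hzx, der_sum_smul]
  have h1 (i : I) : S.der (F.a i) p = 0 :=
    congrArg Subtype.val (LinearMap.congr_fun (hz i) ⟨p, hp, h0⟩)
  simp [h1]

include F in
/-- Invariants of a quotient of the polynomial ring by a stable subspace lift to invariants: project
to the generalized kernel of the Casimir operator. -/
theorem exists_invariant {N : Submodule ℂ (MvPolynomial ι ℂ)}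
    (hN : ∀ x ∈ S.lev 0, κ S.z x = 0 → ∀ p ∈ N, S.der x p ∈ N) {m : ℕ} {p : MvPolynomial ι ℂ}
    (hp : p.IsHomogeneous m) (hpN : ∀ x ∈ S.lev 0, κ S.z x = 0 → S.der x p ∈ N) :
    ∃ q, p - q ∈ N ∧ q.IsHomogeneous m ∧ ∀ x ∈ S.lev 0, κ S.z x = 0 → S.der x q = 0 := by
  have hfin : Module.Finite ℂ (homogeneousSubmodule ι ℂ m) :=
    Module.Finite.iff_fg.2 (homogeneousSubmodule_fg ι ℂ m)
  set C : Module.End ℂ (homogeneousSubmodule ι ℂ m) :=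
    LinearMap.restrict F.casimir fun q hq ↦ F.casimir_isHomogeneous hq with hC
  have hCa (k : ℕ) (q : homogeneousSubmodule ι ℂ m) :
      ((C ^ k) q : MvPolynomial ι ℂ) = (F.casimir ^ k) q := by
    induction k with
    | zero => rfl
    | succ k ih => rw [pow_succ', pow_succ', Module.End.mul_apply, Module.End.mul_apply, ← ih]; rfl
  set N' := N.comap (homogeneousSubmodule ι ℂ m).subtype with hN'
  have hCN (q) (hq : q ∈ N') : C q ∈ N' := by
    change F.casimir (q : MvPolynomial ι ℂ) ∈ N
    rw [casimir_apply]
    exact sum_mem fun i _ ↦ hN _ (F.a_mem i) (F.killing_z_a i) _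
      (hN _ (F.b_mem i) (F.killing_z_b i) _ hq)
  have haeval (u : Polynomial ℂ) (q) (hq : q ∈ N') : Polynomial.aeval C u q ∈ N' := by
    induction u using Polynomial.induction_on' with
    | add _ _ h1 h2 => rw [map_add]; exact add_mem h1 h2
    | monomial k c =>
      rw [Polynomial.aeval_monomial, Module.End.mul_apply, Module.algebraMap_end_apply]
      refine Submodule.smul_mem _ _ ?_
      induction k with
      | zero => exact hq
      | succ k ih => rw [pow_succ', Module.End.mul_apply]; exact hCN _ ih
  set μ := Polynomial.X * C.charpoly with hμ
  have hμ0 : μ ≠ 0 := mul_ne_zero Polynomial.X_ne_zero (LinearMap.charpoly_monic _).ne_zero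
  obtain ⟨ν, hν, hXν⟩ := Polynomial.exists_eq_pow_rootMultiplicity_mul_and_not_dvd μ hμ0 0
  have hk : μ.rootMultiplicity 0 ≠ 0 := by
    rw [Ne, Polynomial.rootMultiplicity_eq_zero_iff]
    intro h
    exact hμ0 (h (by simp [hμ]))
  obtain ⟨k, hk⟩ := Nat.exists_eq_succ_of_ne_zero hk
  rw [Polynomial.C_0, sub_zero] at hν hXν
  rw [hk] at hν
  have hcop : IsCoprime (Polynomial.X ^ (k + 1)) ν :=
    ((Polynomial.irreducible_X.coprime_iff_not_dvd).2 hXν).pow_left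
  obtain ⟨u, v, huv⟩ := hcop
  set p' : homogeneousSubmodule ι ℂ m := ⟨p, hp⟩
  set q' := Polynomial.aeval C (v * ν) p' with hq'
  refine ⟨q', ?_, q'.2, fun x hx hzx ↦ F.der_eq_zero_of_casimir_pow (n := k + 1) q'.2 ?_ hx hzx⟩
  · have h1 : p' - q' = Polynomial.aeval C (u * Polynomial.X ^ k) (C p') := by
      have h2 := congrArg (fun r ↦ Polynomial.aeval C r p') huv
      simp only [map_add, map_one, LinearMap.add_apply, Module.End.one_apply] at h2
      rw [pow_succ, ← mul_assoc, map_mul _ _ Polynomial.X, Module.End.mul_apply,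
        Polynomial.aeval_X] at h2
      exact sub_eq_iff_eq_add.2 h2.symm
    have h2 : p' - q' ∈ N' := by
      rw [h1]
      refine haeval _ _ ?_
      change F.casimir p ∈ N
      rw [casimir_apply]
      exact sum_mem fun i _ ↦ hN _ (F.a_mem i) (F.killing_z_a i) _
        (hpN _ (F.b_mem i) (F.killing_z_b i))
    exact h2
  · have h1 : Polynomial.aeval C (Polynomial.X ^ (k + 1) : Polynomial ℂ) q' = 0 := by
      have h2 : Polynomial.aeval C μ = 0 := by
        rw [hμ, map_mul (Polynomial.aeval C), LinearMap.aeval_self_charpoly, mul_zero]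
      rw [hq', ← Module.End.mul_apply, ← map_mul (Polynomial.aeval C), mul_left_comm, ← hν,
        map_mul (Polynomial.aeval C), h2, mul_zero, LinearMap.zero_apply]
    rw [map_pow, Polynomial.aeval_X] at h1
    rw [← hCa, h1]
    rfl

end PositiveFrame

end ShortGrading

/-! ### Root vectors and the Killing form -/

namespace HermitianParabolic

variable {L : Type u} [LieRing L] [LieAlgebra ℂ L] [FiniteDimensional ℂ L]
  [LieAlgebra.IsSemisimple ℂ L]
  {H : LieSubalgebra ℂ L} [H.IsCartanSubalgebra]

local notation "κ" => killingForm ℂ L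

/-- The element of `H` that represents a root with respect to the Killing form. -/
noncomputable def dualVec (γ : H.root) : H := (IsKilling.cartanEquivDual H).symm γ.1.toLinear

theorem killing_dualVec (γ : H.root) (x : H) : κ (dualVec γ) x = γ.1 x :=
  LinearMap.BilinForm.apply_toDual_symm_apply
    (hB := IsKilling.traceForm_cartan_nondegenerate ℂ L H) _ _

theorem root_dualVec_comm (β γ : H.root) : β.1 (dualVec γ) = γ.1 (dualVec β) := by
  rw [← killing_dualVec, ← killing_dualVec, ShortGrading.killing_comm]

theorem exists_rootVec (β : H.root) : ∃ p : L × L, p.1 ∈ rootSpace H β.1 ∧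
    p.2 ∈ rootSpace H (-β.1) ∧ κ p.1 p.2 = 1 := by
  obtain ⟨e, heα : e ∈ rootSpace H β.1, he₀ : e ≠ 0⟩ := β.1.exists_ne_zero
  obtain ⟨f, hfα, hf⟩ : ∃ f ∈ rootSpace H (-β.1), κ e f ≠ 0 := by
    contrapose! he₀
    simpa using mem_ker_killingForm_of_mem_rootSpace_of_forall_rootSpace_neg ℂ L H heα he₀
  exact ⟨(e, (κ e f)⁻¹ • f), heα, Submodule.smul_mem _ _ hfα, by simp [hf]⟩

/-- A root vector. -/
noncomputable def rootVec (β : H.root) : L := (exists_rootVec β).choose.1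

/-- The vector of the opposite root space that is dual to the chosen root vector. -/
noncomputable def coVec (β : H.root) : L := (exists_rootVec β).choose.2

theorem rootVec_mem (β : H.root) : rootVec β ∈ rootSpace H β.1 :=
  (exists_rootVec β).choose_spec.1

theorem coVec_mem (β : H.root) : coVec β ∈ rootSpace H (-β.1) :=
  (exists_rootVec β).choose_spec.2.1

theorem killing_rootVec_coVec (β : H.root) : κ (rootVec β) (coVec β) = 1 :=
  (exists_rootVec β).choose_spec.2.2

theorem lie_rootVec (h : H) (β : H.root) : ⁅(h : L), rootVec β⁆ = β.1 h • rootVec β :=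
  IsKilling.lie_eq_smul_of_mem_rootSpace (rootVec_mem β) h

theorem lie_coVec (h : H) (β : H.root) : ⁅(h : L), coVec β⁆ = -β.1 h • coVec β :=
  IsKilling.lie_eq_smul_of_mem_rootSpace (coVec_mem β) h

theorem lie_rootVec_coVec (β : H.root) : ⁅rootVec β, coVec β⁆ = dualVec β := by
  rw [IsKilling.lie_eq_killingForm_smul_of_mem_rootSpace_of_mem_rootSpace_neg (rootVec_mem β)
    (coVec_mem β), killing_rootVec_coVec, one_smul]
  rfl

theorem killing_rootVec_coVec_of_ne {β γ : H.root} (h : β ≠ γ) : κ (rootVec β) (coVec γ) = 0 := by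
  refine killingForm_apply_eq_zero_of_mem_rootSpace_of_add_ne_zero ℂ L H (rootVec_mem β)
    (coVec_mem γ) fun h0 ↦ h (Subtype.ext (DFunLike.coe_injective ?_))
  rwa [add_neg_eq_zero] at h0

omit [LieAlgebra.IsSemisimple ℂ L] in
theorem mem_rootSpace_zero (h : H) : (h : L) ∈ rootSpace H (0 : H → ℂ) := by
  rw [rootSpace_zero_eq]
  exact h.2

omit [LieAlgebra.IsSemisimple ℂ L] in
theorem coe_root_ne_zero (β : H.root) : (β.1 : H → ℂ) ≠ 0 := H.isNonZero_coe_root β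

theorem killing_cartan_rootVec (h : H) (β : H.root) : κ h (rootVec β) = 0 :=
  killingForm_apply_eq_zero_of_mem_rootSpace_of_add_ne_zero ℂ L H (mem_rootSpace_zero h)
    (rootVec_mem β) (by rw [zero_add]; exact coe_root_ne_zero β)

theorem killing_cartan_coVec (h : H) (β : H.root) : κ h (coVec β) = 0 :=
  killingForm_apply_eq_zero_of_mem_rootSpace_of_add_ne_zero ℂ L H (mem_rootSpace_zero h)
    (coVec_mem β) (by rw [zero_add, neg_ne_zero]; exact coe_root_ne_zero β)

theorem killing_cartan (x y : H) : κ x y = ∑ γ : H.root, γ.1 x * γ.1 y := by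
  have h := congrArg (fun B : LinearMap.BilinForm ℂ H ↦ B x y)
    (IsKilling.restrict_killingForm_eq_sum (K := ℂ) (L := L) (H := H))
  simp only [LinearMap.sum_apply, LinearMap.smulRight_apply] at h
  rw [← Finset.sum_coe_sort] at h
  exact h

theorem cartan_eq_zero {x : H} (h : ∀ y : H, κ x y = 0) : x = 0 := by
  have := (IsKilling.cartanEquivDual H).map_eq_zero_iff.1 (LinearMap.ext h :
    IsKilling.cartanEquivDual H x = 0)
  exact this

theorem cartan_eq_sum (x : H) : (x : L) = ∑ γ : H.root, κ (dualVec γ) x • (dualVec γ : L) := by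
  have h : x - ∑ γ : H.root, γ.1 x • dualVec γ = 0 := by
    refine cartan_eq_zero fun y ↦ ?_
    rw [AddSubgroupClass.coe_sub, map_sub, LinearMap.sub_apply, killing_cartan, sub_eq_zero]
    simp only [AddSubmonoidClass.coe_finsetSum, map_sum, LinearMap.sum_apply]
    refine Finset.sum_congr rfl fun γ _ ↦ ?_
    rw [SetLike.val_smul, map_smul, LinearMap.smul_apply, killing_dualVec, smul_eq_mul]
  rw [sub_eq_zero] at h
  conv_lhs => rw [h]
  simp only [AddSubmonoidClass.coe_finsetSum, SetLike.val_smul, killing_dualVec]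

theorem rootSpace_eq_smul {β : H.root} {x : L} (hx : x ∈ rootSpace H β.1) :
    x = κ (coVec β) x • rootVec β := by
  have h0 : rootVec β ≠ 0 := by
    intro h
    have := killing_rootVec_coVec β
    rw [h, map_zero, LinearMap.zero_apply] at this
    exact zero_ne_one this
  have h1 := IsKilling.finrank_rootSpace_eq_one β.1 (H.isNonZero_coe_root β)
  obtain ⟨c, hc⟩ := (finrank_eq_one_iff_of_nonzero' (⟨rootVec β, rootVec_mem β⟩ : rootSpace H β.1)
    (fun h ↦ h0 (congrArg Subtype.val h))).1 h1 ⟨x, hx⟩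
  have hc' : c • rootVec β = x := congrArg Subtype.val hc
  rw [← hc', map_smul, ShortGrading.killing_comm, killing_rootVec_coVec, smul_eq_mul, mul_one]

theorem root_induction {p : L → Prop} (hadd : ∀ x y, p x → p y → p (x + y)) (h1 : ∀ h : H, p h)
    (h2 : ∀ (β : H.root) (c : ℂ), p (c • rootVec β)) (x : L) : p x := by
  have hx : x ∈ (⨆ χ : Weight ℂ H L, genWeightSpace L χ : LieSubmodule ℂ H L) := by
    rw [iSup_genWeightSpace_eq_top']; trivial
  induction hx using LieSubmodule.iSup_induction' with
  | zero => exact h1 0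
  | add _ _ _ _ hu hv => exact hadd _ _ hu hv
  | mem χ u hu =>
    by_cases hχ : χ.IsZero
    · have hu' : u ∈ rootSpace H (0 : H → ℂ) := by rw [← hχ.eq]; exact hu
      rw [rootSpace_zero_eq] at hu'
      exact h1 ⟨u, hu'⟩
    · rw [rootSpace_eq_smul (β := ⟨χ, by simpa [LieSubalgebra.root] using hχ⟩) hu]
      exact h2 _ _

/-- The expansion of a vector in root vectors and vectors representing the roots. -/
theorem eq_sum_rootVec (x : L) : x = ∑ γ : H.root, κ (dualVec γ) x • (dualVec γ : L) +
    ∑ β : H.root, κ (coVec β) x • rootVec β := by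
  induction x using root_induction (H := H) with
  | hadd x y hx hy =>
    simp only [map_add, add_smul, Finset.sum_add_distrib]
    conv_lhs => rw [hx, hy]
    abel
  | h1 h =>
    rw [← cartan_eq_sum]
    simp [ShortGrading.killing_comm _ (h : L), killing_cartan_coVec]
  | h2 β c =>
    rw [Finset.sum_eq_zero (fun γ _ ↦ by rw [map_smul, killing_cartan_rootVec, smul_zero, zero_smul]),
      zero_add, Finset.sum_eq_single β]
    · rw [map_smul, ShortGrading.killing_comm, killing_rootVec_coVec, smul_eq_mul, mul_one]
    · intro γ _ hγ
      rw [map_smul, ShortGrading.killing_comm, killing_rootVec_coVec_of_ne hγ.symm, smul_zero,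
        zero_smul]
    · simp

theorem eq_sum_coVec (x : L) : x = ∑ γ : H.root, κ (dualVec γ) x • (dualVec γ : L) +
    ∑ β : H.root, κ (rootVec β) x • coVec β := by
  rw [← sub_eq_zero]
  refine (IsKilling.killingForm_nondegenerate ℂ L).1 _ fun y ↦ ?_
  have h := congrArg (κ x) (eq_sum_rootVec (H := H) y)
  simp only [map_add, map_sum, map_smul, smul_eq_mul] at h
  rw [map_sub, LinearMap.sub_apply, h]
  simp only [map_add, map_sum, map_smul, LinearMap.add_apply, LinearMap.sum_apply,
    LinearMap.smul_apply, smul_eq_mul, ShortGrading.killing_comm x]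
  simp only [mul_comm, sub_self]

theorem dualVec_eq_smul_coroot (β : H.root) :
    dualVec β = (β.1 (dualVec β) / 2) • IsKilling.coroot β.1 := by
  have h0 : β.1 (dualVec β) ≠ 0 :=
    IsKilling.root_apply_cartanEquivDual_symm_ne_zero (H.isNonZero_coe_root β)
  have h : IsKilling.coroot β.1 = (2 * (β.1 (dualVec β))⁻¹) • dualVec β := by
    rw [mul_smul, ofNat_smul_eq_nsmul]; rfl
  rw [h, smul_smul, ← mul_assoc, div_mul_cancel₀ _ two_ne_zero, mul_inv_cancel₀ h0, one_smul]

theorem exists_root_coroot (β γ : H.root) : ∃ n : ℤ, γ.1 (IsKilling.coroot β.1) = n :=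
  ⟨_, IsKilling.apply_coroot_eq_cast β.1 γ.1⟩

/-- The squared length of a root is real and positive. -/
theorem exists_root_dualVec (β : H.root) : ∃ r : ℝ, 0 < r ∧ β.1 (dualVec β) = r := by
  set c := β.1 (dualVec β) with hc
  have h0 : c ≠ 0 := IsKilling.root_apply_cartanEquivDual_symm_ne_zero (H.isNonZero_coe_root β)
  choose n hn using exists_root_coroot β
  have h1 : c = (c / 2) * (c / 2) * ((∑ γ, n γ * n γ : ℤ) : ℂ) := by
    conv_lhs => rw [hc, ← killing_dualVec, killing_cartan]
    push_cast
    rw [Finset.mul_sum]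
    refine Finset.sum_congr rfl fun γ _ ↦ ?_
    rw [dualVec_eq_smul_coroot, ← Weight.toLinear_apply, map_smul, Weight.toLinear_apply, hn,
      smul_eq_mul]
    ring
  set N := ∑ γ, n γ * n γ with hN
  have hN0 : 0 ≤ N := Finset.sum_nonneg fun γ _ ↦ mul_self_nonneg _
  have hN1 : N ≠ 0 := by
    intro h
    rw [h, Int.cast_zero, mul_zero] at h1
    exact h0 h1
  have hN2 : (N : ℂ) ≠ 0 := by exact_mod_cast hN1
  have hNR : (0 : ℝ) < N := by exact_mod_cast lt_of_le_of_ne hN0 hN1.symm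
  refine ⟨4 / N, by positivity, ?_⟩
  push_cast
  rw [eq_div_iff hN2]
  refine mul_left_cancel₀ h0 ?_
  linear_combination -4 * h1

theorem exists_root_dualVec_real (β γ : H.root) : ∃ r : ℝ, β.1 (dualVec γ) = r := by
  obtain ⟨r, -, hr⟩ := exists_root_dualVec γ
  obtain ⟨n, hn⟩ := exists_root_coroot γ β
  refine ⟨r / 2 * n, ?_⟩
  rw [dualVec_eq_smul_coroot, ← Weight.toLinear_apply, map_smul, Weight.toLinear_apply, hn, hr]
  simp

end HermitianParabolic

/-! ### The grading attached to a simple root -/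

namespace HermitianParabolic

variable {L : Type u} [LieRing L] [LieAlgebra ℂ L] [FiniteDimensional ℂ L]
  [LieAlgebra.IsSemisimple ℂ L]
  {H : LieSubalgebra ℂ L} [H.IsCartanSubalgebra]
  (b : (IsKilling.rootSystem H).Base) (i : b.support)

local notation "κ" => killingForm ℂ L

/-- The element of `H` on which a linear form takes as value its coefficient along the simple root
`i`. -/
noncomputable def gradingElement : H := (Module.evalEquiv ℂ H).symm (b.toWeightBasis.coord i)

theorem apply_gradingElement (f : Dual ℂ H) : f (gradingElement b i) = b.toWeightBasis.coord i f :=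
  Module.apply_evalEquiv_symm_apply ℂ H f _

theorem mem_levels (f : Dual ℂ H) (A : Set ℤ) :
    (f : H → ℂ) ∈ levels b i A ↔ ∃ n ∈ A, f (gradingElement b i) = (n : ℂ) := by
  constructor
  · rintro ⟨g, hg, n, hn, h⟩
    obtain rfl : g = f := DFunLike.coe_injective hg
    exact ⟨n, hn, by rw [apply_gradingElement, h]⟩
  · rintro ⟨n, hn, h⟩
    exact ⟨f, rfl, n, hn, by rw [← apply_gradingElement, h]⟩

theorem root_mem_levels (β : H.root) (A : Set ℤ) :
    (β.1 : H → ℂ) ∈ levels b i A ↔ ∃ n ∈ A, β.1 (gradingElement b i) = (n : ℂ) :=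
  mem_levels b i β.1.toLinear A

theorem simple_apply_self : i.1.1 (gradingElement b i) = 1 := by
  have h := apply_gradingElement b i (b.toWeightBasis i)
  rw [Basis.coord_apply, Basis.repr_self, Finsupp.single_eq_same, b.toWeightBasis_apply] at h
  exact h

theorem simple_apply_of_ne {j : H.root} (hj : j ∈ b.support) (hij : j ≠ i) :
    j.1 (gradingElement b i) = 0 := by
  have h := apply_gradingElement b i (b.toWeightBasis ⟨j, hj⟩)
  rw [Basis.coord_apply, Basis.repr_self,
    Finsupp.single_eq_of_ne (fun h ↦ hij (congrArg Subtype.val h.symm)), b.toWeightBasis_apply] at h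
  exact h

theorem rootSpace_le_gradedPart {χ : H → ℂ} {A : Set ℤ} (hχ : χ ∈ levels b i A) :
    rootSpace H χ ≤ gradedPart b i A :=
  le_iSup₂_of_le χ hχ le_rfl

theorem lie_eq_zero (hHerm : IsHermitianSymmetric b i) {β γ : H.root}
    (hβ : β.1 (gradingElement b i) = 1) (hγ : γ.1 (gradingElement b i) = 1) :
    ⁅rootVec β, rootVec γ⁆ = 0 := by
  have h (β : H.root) (hβ : β.1 (gradingElement b i) = 1) : rootVec β ∈ uPlus b i :=
    rootSpace_le_gradedPart b i ((root_mem_levels b i β _).2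
      ⟨1, show (0 : ℤ) < 1 from one_pos, by rw [hβ, Int.cast_one]⟩) (rootVec_mem β)
  have : IsLieAbelian (uPlus b i) := hHerm
  exact congrArg Subtype.val (trivial_lie_zero (uPlus b i) (uPlus b i) ⟨_, h β hβ⟩ ⟨_, h γ hγ⟩)

/-- If the root vectors of `β` and `γ` commute and `β + γ` is a root, then the latter has a
nonpositive inner product with `γ`, as a lowest root vector for `β + γ` is primitive for `γ`. -/
theorem exists_root_dualVec_nonpos {β γ δ : H.root} (h : ⁅rootVec β, rootVec γ⁆ = 0)
    (hδ : (δ.1 : H → ℂ) = β.1 + γ.1) : ∃ r : ℝ, r ≤ 0 ∧ δ.1 (dualVec γ) = r := by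
  have h0 : ⁅rootVec γ, coVec δ⁆ = 0 := by
    have hm : ⁅rootVec γ, coVec δ⁆ ∈ rootSpace H (-β.1 : H → ℂ) := by
      have := lie_mem_genWeightSpace_of_mem_genWeightSpace (rootVec_mem γ) (coVec_mem δ)
      rwa [hδ, neg_add, add_comm, neg_add_cancel_right] at this
    rw [eq_sum_coVec (H := H) ⁅rootVec γ, coVec δ⁆]
    have h1 (ε : H.root) : κ (dualVec ε) ⁅rootVec γ, coVec δ⁆ = 0 :=
      killingForm_apply_eq_zero_of_mem_rootSpace_of_add_ne_zero ℂ L H (mem_rootSpace_zero _) hm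
        (by rw [zero_add, neg_ne_zero]; exact coe_root_ne_zero β)
    have h2 (ε : H.root) : κ (rootVec ε) ⁅rootVec γ, coVec δ⁆ = 0 := by
      by_cases hε : ε = β
      · rw [hε, ← ShortGrading.killing_lie, h, map_zero, LinearMap.zero_apply]
      · refine killingForm_apply_eq_zero_of_mem_rootSpace_of_add_ne_zero ℂ L H (rootVec_mem ε) hm
          fun h3 ↦ hε (Subtype.ext (DFunLike.coe_injective ?_))
        rwa [add_neg_eq_zero] at h3
    simp [h1, h2]
  have hne : coVec δ ≠ 0 := by
    intro h1
    have := killing_rootVec_coVec δ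
    rw [h1, map_zero] at this
    exact zero_ne_one this
  obtain ⟨h', e, f, ht, heγ, hfγ⟩ := IsKilling.exists_isSl2Triple_of_weight_isNonZero
    (H.isNonZero_coe_root γ)
  have hP : ht.HasPrimitiveVectorWith (coVec δ) (-δ.1 (IsKilling.coroot γ.1)) :=
    { ne_zero := hne
      lie_h := by
        rw [ht.h_eq_coroot (H.isNonZero_coe_root γ) heγ hfγ]
        exact lie_coVec _ _
      lie_e := by rw [rootSpace_eq_smul heγ, smul_lie, h0, smul_zero] }
  obtain ⟨n, hn⟩ := hP.exists_nat
  obtain ⟨r, hr, hr'⟩ := exists_root_dualVec γ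
  refine ⟨-(r / 2 * n), by rw [neg_nonpos]; positivity, ?_⟩
  rw [dualVec_eq_smul_coroot, ← Weight.toLinear_apply, map_smul, Weight.toLinear_apply, hr',
    ← neg_eq_iff_eq_neg.2 hn.symm]
  push_cast
  rw [smul_eq_mul]
  ring

/-- As the nilradical is abelian, the coefficient of a root along `i` is `-1`, `0` or `1`. -/
theorem root_level (hHerm : IsHermitianSymmetric b i) (β : H.root) :
    β.1 (gradingElement b i) = -1 ∨ β.1 (gradingElement b i) = 0 ∨
      β.1 (gradingElement b i) = 1 := by
  refine b.induction_add β (p := fun β ↦ β.1 (gradingElement b i) = -1 ∨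
    β.1 (gradingElement b i) = 0 ∨ β.1 (gradingElement b i) = 1) (fun β hβ ↦ ?_) (fun j hj ↦ ?_)
    fun β j γ h hβ hj ↦ ?_
  · have h : ((IsKilling.rootSystem H).reflectionPerm β β).1 (gradingElement b i) =
        -β.1 (gradingElement b i) :=
      congrArg (fun g : Dual ℂ H ↦ g (gradingElement b i))
        (((IsKilling.rootSystem H).root_reflectionPerm β β).trans
          ((IsKilling.rootSystem H).reflection_apply_self β))
    rw [h]
    rcases hβ with h | h | h <;> simp [h]
  · by_cases hij : j = i
    · rw [hij, simple_apply_self]; simp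
    · rw [simple_apply_of_ne b i hj hij]; simp
  · have h1 : γ.1 (gradingElement b i) = β.1 (gradingElement b i) + j.1 (gradingElement b i) :=
      congrArg (fun g : Dual ℂ H ↦ g (gradingElement b i)) h
    by_cases hij : j = i
    · subst hij
      rw [h1, simple_apply_self]
      rcases hβ with hβ | hβ | hβ
      · rw [hβ]; simp
      · rw [hβ]; simp
      · -- the root vectors of `β` and `γ - β` would commute
        exfalso
        have hj1 := simple_apply_self b i
        have hγ : (γ.1 : H → ℂ) = β.1 + i.1.1 := congrArg DFunLike.coe h
        obtain ⟨r, hr, hr'⟩ := exists_root_dualVec_nonpos (lie_eq_zero b i hHerm hβ hj1) hγ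
        obtain ⟨s, hs, hs'⟩ := exists_root_dualVec_nonpos (lie_eq_zero b i hHerm hj1 hβ)
          (hγ.trans (add_comm _ _))
        obtain ⟨t, ht, ht'⟩ := exists_root_dualVec γ
        have h2 : γ.1 (dualVec γ) = γ.1 (dualVec β) + γ.1 (dualVec i.1) := by
          rw [root_dualVec_comm γ β, root_dualVec_comm γ i.1]
          exact congrFun hγ _
        rw [ht', hr', hs'] at h2
        have h3 : t = s + r := by exact_mod_cast h2
        linarith
    · rw [h1, simple_apply_of_ne b i hj hij, add_zero]
      exact hβ

/-- A root whose coefficient along `i` is positive has natural coefficients. -/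
theorem exists_coord_eq_nat {β : H.root} (hβ : β.1 (gradingElement b i) = 1) (j : b.support) :
    ∃ n : ℕ, b.toWeightBasis.coord j β.1.toLinear = n := by
  obtain ⟨f, -, h⟩ := b.exists_root_eq_sum_nat_or_neg β
  have hs (j : b.support) :
      b.toWeightBasis.coord j (∑ k ∈ b.support, f k • (IsKilling.rootSystem H).root k) = f j := by
    rw [map_sum, ← Finset.sum_coe_sort, Finset.sum_eq_single j]
    · rw [map_nsmul, ← b.toWeightBasis_apply, Basis.coord_apply, Basis.repr_self,
        Finsupp.single_eq_same, nsmul_eq_mul, mul_one]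
    · intro k _ hk
      rw [map_nsmul, ← b.toWeightBasis_apply, Basis.coord_apply, Basis.repr_self,
        Finsupp.single_eq_of_ne hk.symm, smul_zero]
    · simp
  rcases h with h | h
  · exact ⟨f j, by rw [← hs j]; exact congrArg (b.toWeightBasis.coord j) h⟩
  · exfalso
    have h1 : β.1 (gradingElement b i) = -f i := by
      rw [← hs i, ← map_neg, ← Weight.toLinear_apply, apply_gradingElement]
      exact congrArg (b.toWeightBasis.coord i) h
    rw [hβ] at h1
    have h2 : ((1 + f i : ℕ) : ℂ) = 0 := by push_cast; linear_combination h1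
    have h3 : 1 + f i = 0 := by exact_mod_cast h2
    omega

theorem weight_level (hHerm : IsHermitianSymmetric b i) (χ : Weight ℂ H L) :
    χ (gradingElement b i) = -1 ∨ χ (gradingElement b i) = 0 ∨ χ (gradingElement b i) = 1 := by
  by_cases hχ : χ.IsZero
  · rw [hχ.eq]; simp
  · exact root_level b i hHerm ⟨χ, by simpa [LieSubalgebra.root] using hχ⟩

/-- The value on `h_α` of a root of the nilradical, where `α` is the noncompact simple root. -/
theorem exists_root_hAlpha (hHerm : IsHermitianSymmetric b i) {β : H.root}
    (hβ : β.1 (gradingElement b i) = 1) :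
    ∃ n : ℕ, n ≤ 2 ∧ β.1 (hAlpha b i) = n ∧ (n = 2 ↔ β = i.1) := by
  set α := i.1.1 with hα
  have hα0 : α.IsNonZero := H.isNonZero_coe_root i.1
  have hα1 : α (gradingElement b i) = 1 := simple_apply_self b i
  have hval (n : ℤ) : (n • (α : H → ℂ) + β.1) (gradingElement b i) = n + 1 := by
    rw [Pi.add_apply, Pi.smul_apply, hα1, hβ, zsmul_eq_mul, mul_one]
  have hlev (n : ℤ) (h : rootSpace H (n • (α : H → ℂ) + β.1) ≠ ⊥) :
      (n + 1 : ℂ) = -1 ∨ (n + 1 : ℂ) = 0 ∨ (n + 1 : ℂ) = 1 := by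
    rw [← hval]
    exact weight_level b i hHerm ⟨_, h⟩
  have htop : chainTopCoeff α β.1 = 0 := by
    by_contra h
    have h1 := (IsKilling.rootSpace_zsmul_add_ne_bot_iff α β.1 hα0 1).2 (by omega)
    have h2 := hlev _ h1
    norm_num at h2
  set q := chainBotCoeff α β.1 with hq
  have hqval : β.1 (hAlpha b i) = q := by
    rw [hAlpha, IsKilling.apply_coroot_eq_cast, htop]
    simp [hq, hα]
  have hw := (IsKilling.rootSpace_zsmul_add_ne_bot_iff α β.1 hα0 (-q)).2 (by omega)
  refine ⟨q, ?_, hqval, fun hq2 ↦ ?_, fun h ↦ ?_⟩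
  · rcases hlev _ hw with h | h | h
    · have h1 : (q : ℂ) = (2 : ℕ) := by push_cast at h ⊢; linear_combination -h
      exact (Nat.cast_injective h1).le
    · have h1 : (q : ℂ) = (1 : ℕ) := by push_cast at h ⊢; linear_combination -h
      have h2 : q = 1 := Nat.cast_injective h1
      omega
    · have h1 : (q : ℂ) = (0 : ℕ) := by push_cast at h ⊢; linear_combination -h
      have h2 : q = 0 := Nat.cast_injective h1
      omega
  · -- both `β` and `2 α - β` are sums of simple roots, so `β` is a multiple of `α`
    rw [hq2] at hw
    set χ : Weight ℂ H L := -⟨_, hw⟩ with hχ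
    have hχv : (χ : H → ℂ) = (2 : ℕ) • (α : H → ℂ) - β.1 := by
      change -(-((2 : ℕ) : ℤ) • (α : H → ℂ) + β.1) = _
      rw [neg_smul, natCast_zsmul]
      abel
    have hχ1 : χ (gradingElement b i) = 1 := by
      rw [hχv, Pi.sub_apply, Pi.smul_apply, hα1, hβ]
      norm_num
    have hχ0 : χ.IsNonZero := fun h ↦ by
      rw [h.eq] at hχ1
      exact zero_ne_one hχ1
    have hχl : χ.toLinear = (2 : ℕ) • α.toLinear - β.1.toLinear := LinearMap.ext (congrFun hχv)
    have hlin : β.1.toLinear = α.toLinear := by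
      refine b.toWeightBasis.ext_elem fun j ↦ ?_
      rw [← Basis.coord_apply, ← Basis.coord_apply]
      by_cases hj : j = i
      · subst hj
        rw [← apply_gradingElement, ← apply_gradingElement]
        exact hβ.trans hα1.symm
      · obtain ⟨m, hm⟩ := exists_coord_eq_nat b i hβ j
        obtain ⟨n, hn⟩ := exists_coord_eq_nat b i
          (β := ⟨χ, by simpa [LieSubalgebra.root] using hχ0⟩) hχ1 j
        have hαj : b.toWeightBasis.coord j α.toLinear = 0 := by
          have h1 := b.toWeightBasis_apply i
          change _ = α.toLinear at h1
          rw [← h1, Basis.coord_apply, Basis.repr_self, Finsupp.single_eq_of_ne hj]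
        change b.toWeightBasis.coord j χ.toLinear = n at hn
        rw [hχl, map_sub, map_nsmul, hαj, hm, smul_zero, zero_sub] at hn
        have h1 : ((m + n : ℕ) : ℂ) = 0 := by push_cast; linear_combination -hn
        have h2 : m + n = 0 := by exact_mod_cast h1
        rw [hαj, hm, show m = 0 by omega, Nat.cast_zero]
    exact Subtype.ext (DFunLike.coe_injective (funext (LinearMap.congr_fun hlin)))
  · rw [h, hAlpha, IsKilling.root_apply_coroot hα0] at hqval
    exact_mod_cast hqval.symm

end HermitianParabolic

/-! ### The short grading of a Lie algebra of Hermitian type -/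

namespace HermitianParabolic

variable {L : Type u} [LieRing L] [LieAlgebra ℂ L] [FiniteDimensional ℂ L]
  [LieAlgebra.IsSemisimple ℂ L]
  {H : LieSubalgebra ℂ L} [H.IsCartanSubalgebra]
  (b : (IsKilling.rootSystem H).Base) (i : b.support)

local notation "κ" => killingForm ℂ L

/-- The roots of the nilradical: those whose coefficient along `i` is `1`. -/
abbrev NilRoot : Type u := {β : H.root // β.1 (gradingElement b i) = 1}

noncomputable instance : Fintype (NilRoot b i) := Fintype.ofFinite _

noncomputable instance : DecidableEq (NilRoot b i) := Classical.decEq _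

theorem lie_cartan (x y : H) : ⁅(x : L), (y : L)⁆ = 0 :=
  congrArg Subtype.val (trivial_lie_zero H H x y)

theorem lie_gradingElement_cube (hHerm : IsHermitianSymmetric b i) (x : L) :
    ⁅(gradingElement b i : L), ⁅(gradingElement b i : L), ⁅(gradingElement b i : L), x⁆⁆⁆ =
      ⁅(gradingElement b i : L), x⁆ := by
  induction x using root_induction (H := H) with
  | hadd x y hx hy => simp only [lie_add, hx, hy]
  | h1 h => simp only [lie_cartan, lie_zero]
  | h2 β c =>
    simp only [lie_smul, lie_rootVec]
    rcases root_level b i hHerm β with h | h | h <;> simp [h]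

theorem killing_dualVec_eq_zero {x : L} {c : ℂ} (hc : c ≠ 0)
    (hx : ⁅(gradingElement b i : L), x⁆ = c • x) (h : H) : κ h x = 0 := by
  have h1 := ShortGrading.killing_lie' (gradingElement b i : L) h x
  rw [lie_cartan, map_zero, LinearMap.zero_apply, hx, map_smul, smul_eq_mul, zero_eq_neg] at h1
  exact (mul_eq_zero.1 h1).resolve_left hc

/-- A vector of degree `c` is orthogonal to the root vectors of degree other than `-c`. -/
theorem killing_rootVec_of_lie {x : L} {c : ℂ} (hx : ⁅(gradingElement b i : L), x⁆ = c • x)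
    (β : H.root) : (β.1 (gradingElement b i) + c) * κ (rootVec β) x = 0 := by
  have h1 := ShortGrading.killing_lie' (gradingElement b i : L) (rootVec β) x
  rw [lie_rootVec, map_smul, LinearMap.smul_apply, hx, map_smul, smul_eq_mul, smul_eq_mul] at h1
  linear_combination h1

theorem killing_coVec_of_lie {x : L} {c : ℂ} (hx : ⁅(gradingElement b i : L), x⁆ = c • x)
    (β : H.root) : (c - β.1 (gradingElement b i)) * κ (coVec β) x = 0 := by
  have h1 := ShortGrading.killing_lie' (gradingElement b i : L) (coVec β) x
  rw [lie_coVec, map_smul, LinearMap.smul_apply, hx, map_smul, smul_eq_mul, smul_eq_mul] at h1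
  linear_combination h1

/-- The Killing form is real and positive on the grading element. -/
theorem exists_killing_gradingElement (hHerm : IsHermitianSymmetric b i) :
    ∃ r : ℝ, 0 < r ∧ κ (gradingElement b i) (gradingElement b i) = r := by
  have h (β : H.root) : ∃ n : ℤ, β.1 (gradingElement b i) = n := by
    rcases root_level b i hHerm β with h | h | h
    exacts [⟨-1, by rw [h]; simp⟩, ⟨0, by rw [h]; simp⟩, ⟨1, by rw [h]; simp⟩]
  choose n hn using h
  refine ⟨∑ β, (n β : ℝ) * n β, ?_, ?_⟩
  · refine Finset.sum_pos' (fun β _ ↦ mul_self_nonneg _) ⟨i, Finset.mem_univ _, ?_⟩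
    have h1 := hn i
    rw [simple_apply_self] at h1
    have h2 : n i = 1 := by exact_mod_cast h1.symm
    rw [h2]
    norm_num
  · rw [killing_cartan]
    push_cast
    simp only [hn]

theorem killing_gradingElement_ne_zero (hHerm : IsHermitianSymmetric b i) :
    κ (gradingElement b i) (gradingElement b i) ≠ 0 := by
  obtain ⟨r, hr, h⟩ := exists_killing_gradingElement b i hHerm
  rw [h]
  exact_mod_cast hr.ne'

/-- The elements of degree `0` that are orthogonal to the grading element are sums of brackets of
elements of degree `0`: they are combinations of root vectors of degree `0` and of coroots of simple
roots other than `i`. -/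
theorem mem_span_of_lie_gradingElement_eq_zero (x : L)
    (hx : ⁅(gradingElement b i : L), x⁆ = 0) (hzx : κ (gradingElement b i) x = 0) :
    x ∈ Submodule.span ℂ {t | ∃ a b' : L, ⁅(gradingElement b i : L), a⁆ = 0 ∧
      ⁅(gradingElement b i : L), b'⁆ = 0 ∧ ⁅a, b'⁆ = t} := by
  set T := Submodule.span ℂ {t | ∃ a b' : L, ⁅(gradingElement b i : L), a⁆ = 0 ∧
    ⁅(gradingElement b i : L), b'⁆ = 0 ∧ ⁅a, b'⁆ = t} with hT
  have hx' : ⁅(gradingElement b i : L), x⁆ = (0 : ℂ) • x := by rw [hx, zero_smul]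
  have hroot (β : H.root) (hβ : β.1 (gradingElement b i) = 0) :
      rootVec β ∈ T ∧ (IsKilling.coroot β.1 : L) ∈ T := by
    have h1 : ⁅(gradingElement b i : L), rootVec β⁆ = 0 := by rw [lie_rootVec, hβ, zero_smul]
    have h2 : ⁅(gradingElement b i : L), coVec β⁆ = 0 := by rw [lie_coVec, hβ, neg_zero, zero_smul]
    constructor
    · have h3 : rootVec β = (2 : ℂ)⁻¹ • ⁅(IsKilling.coroot β.1 : L), rootVec β⁆ := by
        rw [lie_rootVec, IsKilling.root_apply_coroot (H.isNonZero_coe_root β), smul_smul,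
          inv_mul_cancel₀ two_ne_zero, one_smul]
      rw [h3]
      exact Submodule.smul_mem _ _ (Submodule.subset_span ⟨_, _, lie_cartan _ _, h1, rfl⟩)
    · have h3 : (dualVec β : L) ∈ T :=
        Submodule.subset_span ⟨_, _, h1, h2, lie_rootVec_coVec β⟩
      obtain ⟨r, hr, hr'⟩ := exists_root_dualVec β
      have hr0 : (r : ℂ) / 2 ≠ 0 := div_ne_zero (by exact_mod_cast hr.ne') two_ne_zero
      rw [dualVec_eq_smul_coroot, hr', SetLike.val_smul] at h3
      exact (Submodule.smul_mem_iff _ hr0).1 h3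
  set y : H := ∑ γ : H.root, κ (dualVec γ) x • dualVec γ with hy
  have hxy : x = y + ∑ β : H.root, κ (coVec β) x • rootVec β := by
    conv_lhs => rw [eq_sum_rootVec (H := H) x]
    simp [hy]
  have hzy : κ (gradingElement b i) y = 0 := by
    rw [hxy, map_add, map_sum, Finset.sum_eq_zero, add_zero] at hzx
    · exact hzx
    · intro β _
      rw [map_smul, killing_cartan_rootVec, smul_zero]
  rw [hxy]
  refine add_mem ?_ (sum_mem fun β _ ↦ ?_)
  · rw [← b.toCoweightBasis.sum_repr y, AddSubmonoidClass.coe_finsetSum]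
    have hk (j : b.support) : κ (gradingElement b i) (b.toCoweightBasis j) =
        2 * (j.1.1 (dualVec j.1))⁻¹ * j.1.1 (gradingElement b i) := by
      have h1 := IsKilling.traceForm_coroot j.1.1 (gradingElement b i)
      rw [b.toCoweightBasis_apply, ShortGrading.killing_comm]
      refine h1.trans ?_
      rw [nsmul_eq_mul, smul_eq_mul, mul_assoc]
      rfl
    have hi : b.toCoweightBasis.repr y i = 0 := by
      have h1 := hzy
      rw [← b.toCoweightBasis.sum_repr y, AddSubmonoidClass.coe_finsetSum, map_sum,
        Finset.sum_eq_single i] at h1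
      · rw [SetLike.val_smul, map_smul, hk, simple_apply_self, mul_one, smul_eq_mul] at h1
        refine (mul_eq_zero.1 h1).resolve_right (mul_ne_zero two_ne_zero (inv_ne_zero ?_))
        exact IsKilling.root_apply_cartanEquivDual_symm_ne_zero (H.isNonZero_coe_root i.1)
      · intro j _ hj
        rw [SetLike.val_smul, map_smul, hk,
          simple_apply_of_ne b i j.2 (fun h ↦ hj (Subtype.ext h)), mul_zero, smul_zero]
      · simp
    refine sum_mem fun j _ ↦ ?_
    by_cases hj : j = i
    · rw [hj, hi, zero_smul]; exact zero_mem _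
    · rw [SetLike.val_smul, b.toCoweightBasis_apply]
      exact Submodule.smul_mem _ _
        (hroot j.1 (simple_apply_of_ne b i j.2 fun h ↦ hj (Subtype.ext h))).2
  · by_cases hβ : β.1 (gradingElement b i) = 0
    · exact Submodule.smul_mem _ _ (hroot β hβ).1
    · have h1 := killing_coVec_of_lie b i hx' β
      rw [zero_sub, mul_eq_zero, neg_eq_zero, or_iff_right hβ] at h1
      rw [h1, zero_smul]
      exact zero_mem _

/-- The short grading attached to a simple root of Hermitian type. -/
noncomputable def shortGrading (hHerm : IsHermitianSymmetric b i) :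
    ShortGrading (NilRoot b i) L where
  z := gradingElement b i
  f β := coVec β.1
  e β := rootVec β.1
  lie_z_cube := lie_gradingElement_cube b i hHerm
  lie_z_f β := by rw [lie_coVec, β.2, neg_one_smul]
  lie_z_e β := by rw [lie_rootVec, β.2, one_smul]
  killing_e_f β γ := by
    split_ifs with h
    · rw [h, killing_rootVec_coVec]
    · exact killing_rootVec_coVec_of_ne fun h' ↦ h (Subtype.ext h')
  expand y hy := by
    have hy' : ⁅(gradingElement b i : L), y⁆ = (-1 : ℂ) • y := by rw [hy, neg_one_smul]
    conv_lhs => rw [eq_sum_coVec (H := H) y]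
    rw [Finset.sum_eq_zero (fun γ _ ↦ by
      rw [killing_dualVec_eq_zero b i (neg_ne_zero.2 one_ne_zero) hy', zero_smul]), zero_add]
    symm
    refine Finset.sum_of_injOn (fun β ↦ β.1) Subtype.val_injective.injOn
      (fun _ _ ↦ Finset.mem_univ _) (fun β _ hβ ↦ ?_) fun _ _ ↦ rfl
    have h1 := killing_rootVec_of_lie b i hy' β
    rw [mul_eq_zero, or_iff_right] at h1
    · rw [h1, zero_smul]
    · intro h2
      refine hβ ⟨⟨β, ?_⟩, by simp, rfl⟩
      linear_combination h2
  killing_z_z := killing_gradingElement_ne_zero b i hHerm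
  mem_span_of_killing_z := mem_span_of_lie_gradingElement_eq_zero b i

theorem cartan_mem_lev_zero (hHerm : IsHermitianSymmetric b i) (h : H) :
    (h : L) ∈ (shortGrading b i hHerm).lev 0 :=
  ShortGrading.mem_lev_zero.2 (lie_cartan (gradingElement b i) h)

/-- The projection to the orthogonal complement of the grading element of the vector that
represents a root. -/
noncomputable def semisimpleDualVec (γ : H.root) : H :=
  dualVec γ - (γ.1 (gradingElement b i) / κ (gradingElement b i) (gradingElement b i)) •
    gradingElement b i

theorem killing_semisimpleDualVec (γ : H.root) (x : L) :
    κ (semisimpleDualVec b i γ) x = κ (dualVec γ) x -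
      γ.1 (gradingElement b i) / κ (gradingElement b i) (gradingElement b i) *
        κ (gradingElement b i) x := by
  simp [semisimpleDualVec]

theorem exists_root_semisimpleDualVec (hHerm : IsHermitianSymmetric b i) (β γ : H.root) :
    ∃ r : ℝ, β.1 (semisimpleDualVec b i γ) = r := by
  obtain ⟨r, hr⟩ := exists_root_dualVec_real β γ
  obtain ⟨s, -, hs⟩ := exists_killing_gradingElement b i hHerm
  have h (β : H.root) : ∃ n : ℝ, β.1 (gradingElement b i) = n := by
    rcases root_level b i hHerm β with h | h | h
    exacts [⟨-1, by rw [h]; simp⟩, ⟨0, by rw [h]; simp⟩, ⟨1, by rw [h]; simp⟩]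
  obtain ⟨m, hm⟩ := h β
  obtain ⟨n, hn⟩ := h γ
  refine ⟨r - n / s * m, ?_⟩
  rw [semisimpleDualVec, ← Weight.toLinear_apply, map_sub, map_smul, Weight.toLinear_apply,
    Weight.toLinear_apply, hr, hs, hm, hn]
  simp

/-- On the orthogonal complement of the grading element, the projected vectors give the same
expansion as the vectors that represent the roots. -/
theorem sum_killing_semisimpleDualVec {x : L} (hzx : κ (gradingElement b i) x = 0) :
    ∑ γ : H.root, κ (semisimpleDualVec b i γ) x • (semisimpleDualVec b i γ : L) =
      ∑ γ : H.root, κ (dualVec γ) x • (dualVec γ : L) := by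
  have h1 : ∑ γ : H.root, κ (dualVec γ) x * γ.1 (gradingElement b i) = 0 := by
    have h3 := congrArg (κ (gradingElement b i)) (eq_sum_rootVec (H := H) x)
    have h4 (γ : H.root) : κ (gradingElement b i) (dualVec γ) = γ.1 (gradingElement b i) := by
      rw [ShortGrading.killing_comm, killing_dualVec]
    simp only [hzx, map_add, map_sum, map_smul, killing_cartan_rootVec, h4, smul_eq_mul, mul_zero,
      Finset.sum_const_zero, add_zero] at h3
    exact h3.symm
  have h2 : ∑ γ : H.root, κ (dualVec γ) x • ((γ.1 (gradingElement b i) /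
      κ (gradingElement b i) (gradingElement b i)) • (gradingElement b i : L)) = 0 := by
    simp only [smul_smul, ← Finset.sum_smul, div_eq_mul_inv, ← mul_assoc, ← Finset.sum_mul]
    rw [h1, zero_mul, zero_smul]
  rw [← sub_zero (∑ γ : H.root, κ (dualVec γ) x • (dualVec γ : L)), ← h2, ← Finset.sum_sub_distrib]
  refine Finset.sum_congr rfl fun γ _ ↦ ?_
  rw [killing_semisimpleDualVec, hzx, mul_zero, sub_zero, ← smul_sub]
  rfl

/-- The frame of the semisimple part of the Levi factor made up of the projections of the vectors
that represent the roots, and of the root vectors. -/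
noncomputable def positiveFrame (hHerm : IsHermitianSymmetric b i) :
    (shortGrading b i hHerm).PositiveFrame
      (H.root ⊕ {β : H.root // β.1 (gradingElement b i) = 0}) where
  a := Sum.elim (fun γ ↦ semisimpleDualVec b i γ) fun β ↦ rootVec β.1
  b := Sum.elim (fun γ ↦ semisimpleDualVec b i γ) fun β ↦ coVec β.1
  a_mem := by
    rintro (γ | β)
    · exact cartan_mem_lev_zero b i hHerm _
    · refine ShortGrading.mem_lev_zero.2 ((lie_rootVec _ _).trans ?_)
      rw [β.2, zero_smul]
  b_mem := by
    rintro (γ | β)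
    · exact cartan_mem_lev_zero b i hHerm _
    · refine ShortGrading.mem_lev_zero.2 ((lie_coVec _ _).trans ?_)
      rw [β.2, neg_zero, zero_smul]
  killing_z_a := by
    rintro (γ | β)
    · refine (ShortGrading.killing_comm _ _).trans ((killing_semisimpleDualVec b i γ _).trans ?_)
      change κ (dualVec γ) (gradingElement b i) - _ / _ * κ (gradingElement b i)
        (gradingElement b i) = 0
      rw [killing_dualVec, div_mul_cancel₀ _ (killing_gradingElement_ne_zero b i hHerm), sub_self]
    · exact killing_cartan_rootVec _ _
  killing_z_b := by
    rintro (γ | β)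
    · refine (ShortGrading.killing_comm _ _).trans ((killing_semisimpleDualVec b i γ _).trans ?_)
      change κ (dualVec γ) (gradingElement b i) - _ / _ * κ (gradingElement b i)
        (gradingElement b i) = 0
      rw [killing_dualVec, div_mul_cancel₀ _ (killing_gradingElement_ne_zero b i hHerm), sub_self]
    · exact killing_cartan_coVec _ _
  expand_a x hx hzx := by
    have hx' : ⁅(gradingElement b i : L), x⁆ = (0 : ℂ) • x := by
      rw [zero_smul]; exact ShortGrading.mem_lev_zero.1 hx
    rw [Fintype.sum_sum_type]
    simp only [Sum.elim_inl, Sum.elim_inr]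
    rw [sum_killing_semisimpleDualVec b i hzx]
    conv_lhs => rw [eq_sum_rootVec (H := H) x]
    congr 1
    symm
    refine Finset.sum_of_injOn (fun β ↦ β.1) Subtype.val_injective.injOn
      (fun _ _ ↦ Finset.mem_univ _) (fun β _ hβ ↦ ?_) fun _ _ ↦ rfl
    have h1 := killing_coVec_of_lie b i hx' β
    rw [mul_eq_zero, or_iff_right] at h1
    · rw [h1, zero_smul]
    · intro h2
      refine hβ ⟨⟨β, ?_⟩, by simp, rfl⟩
      linear_combination -h2
  expand_b x hx hzx := by
    have hx' : ⁅(gradingElement b i : L), x⁆ = (0 : ℂ) • x := by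
      rw [zero_smul]; exact ShortGrading.mem_lev_zero.1 hx
    rw [Fintype.sum_sum_type]
    simp only [Sum.elim_inl, Sum.elim_inr]
    rw [sum_killing_semisimpleDualVec b i hzx]
    conv_lhs => rw [eq_sum_coVec (H := H) x]
    congr 1
    symm
    refine Finset.sum_of_injOn (fun β ↦ β.1) Subtype.val_injective.injOn
      (fun _ _ ↦ Finset.mem_univ _) (fun β _ hβ ↦ ?_) fun _ _ ↦ rfl
    have h1 := killing_rootVec_of_lie b i hx' β
    rw [mul_eq_zero, or_iff_right] at h1
    · rw [h1, zero_smul]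
    · intro h2
      refine hβ ⟨⟨β, ?_⟩, by simp, rfl⟩
      linear_combination h2
  positive := by
    rintro (γ | β)
    · refine Or.inl ⟨rfl, fun β ↦ ?_⟩
      obtain ⟨r, hr⟩ := exists_root_semisimpleDualVec b i hHerm β.1 γ
      refine ⟨-r, (lie_coVec _ _).trans ?_⟩
      rw [hr, Complex.ofReal_neg]
      rfl
    · refine Or.inr ⟨?_, fun γ ↦ ?_⟩
      · obtain ⟨r, hr, h⟩ := exists_root_dualVec β.1
        refine ⟨r, hr, ?_⟩
        simp only [Sum.elim_inr]
        rw [lie_rootVec_coVec, lie_rootVec, h]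
      · obtain ⟨r, h⟩ := exists_root_dualVec_real γ.1 β.1
        refine ⟨-r, ?_⟩
        simp only [Sum.elim_inr]
        rw [lie_rootVec_coVec, Complex.ofReal_neg, ← h]
        exact lie_coVec _ _

/-- The coroot of the noncompact simple root acts diagonally on the nilradical. -/
theorem exists_isDiagonal (hHerm : IsHermitianSymmetric b i) : ∃ (ε : NilRoot b i → ℕ) (c : ℂ),
    (shortGrading b i hHerm).IsDiagonal (hAlpha b i : L) ε ⟨i.1, simple_apply_self b i⟩ c := by
  choose ε h2 hε h using fun β : NilRoot b i ↦ exists_root_hAlpha b i hHerm β.2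
  refine ⟨ε, i.1.1 (dualVec i.1) / 2, cartan_mem_lev_zero b i hHerm _, fun β ↦ ?_, h2, fun β ↦ ?_,
    ?_, ?_⟩
  · rw [← hε]
    exact lie_coVec _ _
  · rw [h]
    exact Subtype.coe_inj (b := ⟨i.1, simple_apply_self b i⟩)
  · exact (lie_rootVec_coVec _).trans (congrArg Subtype.val (dualVec_eq_smul_coroot i.1))
  · exact div_ne_zero
      (IsKilling.root_apply_cartanEquivDual_symm_ne_zero (H.isNonZero_coe_root i.1)) two_ne_zero

end HermitianParabolic

/-! ### The parabolic subalgebra and its characters in terms of the short grading -/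

namespace HermitianParabolic

variable {L : Type u} [LieRing L] [LieAlgebra ℂ L] [FiniteDimensional ℂ L]
  [LieAlgebra.IsSemisimple ℂ L]
  {H : LieSubalgebra ℂ L} [H.IsCartanSubalgebra]
  {b : (IsKilling.rootSystem H).Base} {i : b.support}

local notation "κ" => killingForm ℂ L

theorem mem_lev_of_mem_gradedPart (hHerm : IsHermitianSymmetric b i) {A : Set ℤ} {n : ℤ}
    (hA : ∀ m ∈ A, m = -1 ∨ m = 0 ∨ m = 1 → m = n) {x : L} (hx : x ∈ gradedPart b i A) :
    x ∈ (shortGrading b i hHerm).lev n := by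
  unfold gradedPart at hx
  induction hx using LieSubmodule.iSup_induction' with
  | zero => exact zero_mem _
  | add _ _ _ _ hu hv => exact add_mem hu hv
  | mem χ u hu =>
    by_cases hχ : χ ∈ levels b i A; swap
    · simp_all
    replace hu : u ∈ rootSpace H χ := by simpa [hχ] using hu
    by_cases h0 : u = 0
    · rw [h0]; exact zero_mem _
    obtain ⟨f, rfl, hf⟩ := hχ
    have hχ' : ((⟨f, fun h ↦ h0 (by simpa [h] using hu)⟩ : Weight ℂ H L) : H → ℂ) = f := rfl
    have hl := weight_level b i hHerm ⟨f, fun h ↦ h0 (by simpa [h] using hu)⟩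
    obtain ⟨m, hm, hfm⟩ := (mem_levels b i f A).1 ⟨f, rfl, hf⟩
    rw [hχ', hfm] at hl
    have hmn : m = n := hA m hm (by exact_mod_cast hl)
    have e : ⁅(gradingElement b i : L), u⁆ = f (gradingElement b i) • u :=
      IsKilling.lie_eq_smul_of_mem_rootSpace hu _
    rw [hfm, hmn] at e
    exact ShortGrading.mem_lev.2 e

theorem mem_gradedPart_of_mem_lev (hHerm : IsHermitianSymmetric b i) {A : Set ℤ} {n : ℤ}
    (hn : n ∈ A) {x : L} (hx : x ∈ (shortGrading b i hHerm).lev n) : x ∈ gradedPart b i A := by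
  have hx' : ⁅(gradingElement b i : L), x⁆ = (n : ℂ) • x := ShortGrading.mem_lev.1 hx
  rw [eq_sum_rootVec (H := H) x]
  refine add_mem (sum_mem fun γ _ ↦ ?_) (sum_mem fun β _ ↦ ?_)
  · by_cases h0 : n = 0
    · refine (gradedPart b i A).smul_mem _ (rootSpace_le_gradedPart b i ?_ (mem_rootSpace_zero _))
      exact ⟨0, rfl, n, hn, by simp [h0]⟩
    · rw [killing_dualVec_eq_zero b i (by exact_mod_cast h0) hx', zero_smul]
      exact zero_mem _
  · by_cases h0 : (n : ℂ) - β.1 (gradingElement b i) = 0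
    · refine (gradedPart b i A).smul_mem _ (rootSpace_le_gradedPart b i ?_ (rootVec_mem β))
      exact (root_mem_levels b i β A).2 ⟨n, hn, (sub_eq_zero.1 h0).symm⟩
    · rw [(mul_eq_zero.1 (killing_coVec_of_lie b i hx' β)).resolve_left h0, zero_smul]
      exact zero_mem _

theorem mem_uPlus (hHerm : IsHermitianSymmetric b i) {x : L} :
    x ∈ uPlus b i ↔ x ∈ (shortGrading b i hHerm).lev 1 :=
  ⟨fun h ↦ mem_lev_of_mem_gradedPart hHerm (A := Set.Ioi 0)
    (fun m (hm : 0 < m) h ↦ by omega) h,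
    fun h ↦ mem_gradedPart_of_mem_lev hHerm (A := Set.Ioi 0) (show (0 : ℤ) < 1 by norm_num) h⟩

theorem mem_uMinus (hHerm : IsHermitianSymmetric b i) {x : L} :
    x ∈ uMinus b i ↔ x ∈ (shortGrading b i hHerm).lev (-1) :=
  ⟨fun h ↦ mem_lev_of_mem_gradedPart hHerm (A := Set.Iio 0)
    (fun m (hm : m < 0) h ↦ by omega) h,
    fun h ↦ mem_gradedPart_of_mem_lev hHerm (A := Set.Iio 0) (show (-1 : ℤ) < 0 by norm_num) h⟩

theorem mem_levi (hHerm : IsHermitianSymmetric b i) {x : L} :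
    x ∈ levi b i ↔ x ∈ (shortGrading b i hHerm).lev 0 :=
  ⟨fun h ↦ mem_lev_of_mem_gradedPart hHerm (A := {0}) (fun _ hm _ ↦ hm) h,
    fun h ↦ mem_gradedPart_of_mem_lev hHerm (A := {0}) rfl h⟩

/-- The derived algebra of the Levi factor is the orthogonal complement of the grading element. -/
theorem mem_gS (hHerm : IsHermitianSymmetric b i) {x : L} :
    x ∈ gS b i ↔ x ∈ (shortGrading b i hHerm).lev 0 ∧ κ (gradingElement b i) x = 0 := by
  constructor
  · refine fun hx ↦ ⟨(mem_levi hHerm).1 (gS_le_levi b i hx), ?_⟩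
    induction hx using Submodule.span_induction with
    | mem t ht =>
      obtain ⟨x, hx, y, hy, rfl⟩ := ht
      have h1 : ⁅(gradingElement b i : L), x⁆ = 0 :=
        ShortGrading.mem_lev_zero.1 ((mem_levi hHerm).1 hx)
      rw [← ShortGrading.killing_lie, h1, map_zero, LinearMap.zero_apply]
    | zero => simp
    | add _ _ _ _ h₁ h₂ => rw [map_add, h₁, h₂, add_zero]
    | smul c _ _ h₁ => rw [map_smul, h₁, smul_zero]
  · rintro ⟨hx, hzx⟩
    refine Submodule.span_mono ?_ (mem_span_of_lie_gradingElement_eq_zero b i x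
      (ShortGrading.mem_lev_zero.1 hx) hzx)
    rintro t ⟨x, y, hx, hy, rfl⟩
    exact ⟨x, (mem_levi hHerm).2 (ShortGrading.mem_lev_zero.2 hx), y,
      (mem_levi hHerm).2 (ShortGrading.mem_lev_zero.2 hy), rfl⟩

theorem killing_hAlpha_ne_zero (hHerm : IsHermitianSymmetric b i) :
    κ (gradingElement b i) (hAlpha b i) ≠ 0 := by
  obtain ⟨ε, c, h⟩ := exists_isDiagonal b i hHerm
  exact h.killing_z

variable (b i) in
/-- The number `a` for which the character `lam ∘ pr` of the parabolic subalgebra is `a κ(z, ·)`,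
where `z` is the grading element. -/
noncomputable def charParam (lam : Dual ℂ (CartanQuot b i)) : ℂ :=
  lam (toQuot b i (hAlpha b i)) / κ (gradingElement b i) (hAlpha b i)

/-- As `𝔥 / (𝔥 ∩ 𝔤_S)` is a line, every form on it is determined by its value on the coroot. -/
theorem apply_pr (hHerm : IsHermitianSymmetric b i) (lam : Dual ℂ (CartanQuot b i))
    (x : parabolic b i) : lam (pr b i x) = charParam b i lam * κ (gradingElement b i) x := by
  set c := κ (gradingElement b i) x / κ (gradingElement b i) (hAlpha b i) with hc
  have h0 := killing_hAlpha_ne_zero hHerm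
  have hmem : (hAlpha b i : L) ∈ parabolic b i :=
    levi_le_parabolic b i (cartan_le_levi b i (hAlpha b i).2)
  have h1 : pr b i (x - c • ⟨hAlpha b i, hmem⟩) = 0 := by
    refine pr_eq_zero b i _ ?_
    change (x : L) - c • (hAlpha b i : L) ∈ prKer b i
    obtain ⟨u, hu, r, hr, h⟩ := Submodule.mem_sup.1 (parabolic_le b i x.2)
    have hzu : κ (gradingElement b i) u = 0 :=
      ShortGrading.killing_eq_zero (S := shortGrading b i hHerm) (m := 0) (n := 1) (by norm_num)
        ShortGrading.z_mem ((mem_uPlus hHerm).1 hu)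
    rw [← h, add_sub_assoc]
    refine Submodule.add_mem_sup hu ((mem_gS hHerm).2 ⟨sub_mem ((mem_levi hHerm).1 hr)
      (Submodule.smul_mem _ _ (cartan_mem_lev_zero b i hHerm _)), ?_⟩)
    rw [map_sub, map_smul, hc, ← h, map_add, hzu, zero_add, smul_eq_mul, div_mul_cancel₀ _ h0,
      sub_self]
  rw [map_sub, map_smul, pr_cartan, sub_eq_zero] at h1
  rw [h1, map_smul, charParam, hc, smul_eq_mul]
  ring

theorem apply_toQuot (hHerm : IsHermitianSymmetric b i) (lam : Dual ℂ (CartanQuot b i)) (h : H) :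
    lam (toQuot b i h) = charParam b i lam * κ (gradingElement b i) h := by
  rw [← pr_cartan, apply_pr hHerm]

theorem charParam_smul_omega (c : ℂ) :
    charParam b i (c • omega b i) = c / κ (gradingElement b i) (hAlpha b i) := by
  rw [charParam, LinearMap.smul_apply, omega_hAlpha, smul_eq_mul, mul_one]

theorem charParam_injective (hHerm : IsHermitianSymmetric b i) :
    Function.Injective (charParam b i) := by
  intro lam lam' h
  ext x
  exact (apply_toQuot hHerm lam x).trans (h ▸ (apply_toQuot hHerm lam' x).symm)

theorem eq_smul_omega_iff (hHerm : IsHermitianSymmetric b i) (lam : Dual ℂ (CartanQuot b i))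
    (c : ℂ) : lam = c • omega b i ↔
      charParam b i lam = c / κ (gradingElement b i) (hAlpha b i) := by
  rw [← charParam_smul_omega]
  exact (charParam_injective hHerm).eq_iff.symm

theorem omega_toQuot (hHerm : IsHermitianSymmetric b i) (h : H) : omega b i (toQuot b i h) =
    κ (gradingElement b i) h / κ (gradingElement b i) (hAlpha b i) := by
  rw [apply_toQuot hHerm, charParam, omega_hAlpha, one_div, inv_mul_eq_div]

/-- The trace of `h_α` on `𝔲⁻` gives the value of `ρ^S`. -/
theorem rhoS_hAlpha (hHerm : IsHermitianSymmetric b i) : rhoS b i (hAlpha b i) =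
    Fintype.card (NilRoot b i) / (2 * κ (gradingElement b i) (gradingElement b i)) *
      κ (gradingElement b i) (hAlpha b i) := by
  classical
  have h1 := (shortGrading b i hHerm).sum_killing_lie (cartan_mem_lev_zero b i hHerm (hAlpha b i))
  have h2 (β : NilRoot b i) : κ ((shortGrading b i hHerm).e β)
      ⁅(hAlpha b i : L), (shortGrading b i hHerm).f β⁆ = -β.1.1 (hAlpha b i) := by
    change κ (rootVec β.1) ⁅(hAlpha b i : L), coVec β.1⁆ = _
    rw [lie_coVec, map_smul, killing_rootVec_coVec, smul_eq_mul, mul_one]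
  have hz : (shortGrading b i hHerm).z = gradingElement b i := rfl
  simp only [h2, Finset.sum_neg_distrib, hz] at h1
  have h3 : ∑ β ∈ H.root.filter
      (fun β : Weight ℂ H L ↦ (β : H → ℂ) ∈ levels b i (Set.Ioi 0)), β (hAlpha b i) =
      ∑ β : NilRoot b i, β.1.1 (hAlpha b i) := by
    symm
    refine Finset.sum_bij (fun β _ ↦ β.1.1) (fun β _ ↦ ?_) (fun β _ γ _ h ↦ ?_) (fun β hβ ↦ ?_)
      fun _ _ ↦ rfl
    · exact Finset.mem_filter.2 ⟨β.1.2, (root_mem_levels b i β.1 _).2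
        ⟨1, show (0 : ℤ) < 1 by norm_num, by rw [β.2, Int.cast_one]⟩⟩
    · exact Subtype.ext (Subtype.ext h)
    · obtain ⟨hβ, hl⟩ := Finset.mem_filter.1 hβ
      obtain ⟨n, hn, h⟩ := (root_mem_levels b i ⟨β, hβ⟩ _).1 hl
      have hn : 0 < n := hn
      refine ⟨⟨⟨β, hβ⟩, ?_⟩, Finset.mem_univ _, rfl⟩
      have hl := root_level b i hHerm ⟨β, hβ⟩
      rw [h] at hl ⊢
      have hl' : n = -1 ∨ n = 0 ∨ n = 1 := by exact_mod_cast hl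
      have : n = 1 := by omega
      rw [this, Int.cast_one]
  rw [rhoS]
  convert_to (1 / 2 : ℂ) * (∑ β ∈ H.root.filter
      (fun β : Weight ℂ H L ↦ (β : H → ℂ) ∈ levels b i (Set.Ioi 0)), β (hAlpha b i)) = _
  · rw [LinearMap.smul_apply, LinearMap.sum_apply, smul_eq_mul]
    rfl
  · rw [h3]
    have h4 : ∑ β : NilRoot b i, β.1.1 (hAlpha b i) = Fintype.card (NilRoot b i) /
      κ (gradingElement b i) (gradingElement b i) * κ (gradingElement b i) (hAlpha b i) := by
      linear_combination -h1
    rw [h4]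
    have := killing_gradingElement_ne_zero b i hHerm
    field_simp

end HermitianParabolic

/-! ### Modules over the enveloping algebra that are generated by a highest weight vector -/

/-- Induction principle: the enveloping algebra is generated by the image of the Lie algebra. -/
theorem UniversalEnvelopingAlgebra.induction_ι {L : Type*} [LieRing L] [LieAlgebra ℂ L]
    {p : UniversalEnvelopingAlgebra ℂ L → Prop} (hι : ∀ x, p (ι ℂ x))
    (halg : ∀ c, p (algebraMap ℂ _ c)) (hadd : ∀ a b, p a → p b → p (a + b))
    (hmul : ∀ a b, p a → p b → p (a * b)) (a : UniversalEnvelopingAlgebra ℂ L) : p a := by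
  let A : Subalgebra ℂ (UniversalEnvelopingAlgebra ℂ L) :=
    { carrier := {a | p a}
      mul_mem' := fun ha hb ↦ hmul _ _ ha hb
      add_mem' := fun ha hb ↦ hadd _ _ ha hb
      algebraMap_mem' := halg }
  let j : L →ₗ⁅ℂ⁆ A :=
    { toFun := fun x ↦ ⟨ι ℂ x, hι x⟩
      map_add' := fun x y ↦ Subtype.ext (map_add _ _ _)
      map_smul' := fun c x ↦ Subtype.ext (map_smul _ _ _)
      map_lie' := fun {x y} ↦ Subtype.ext (LieHom.map_lie _ _ _) }
  have h : A.val.comp (lift ℂ j) = AlgHom.id ℂ _ := by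
    ext x
    simp [j]
  have h1 := DFunLike.congr_fun h a
  rw [AlgHom.id_apply] at h1
  rw [← h1]
  exact (lift ℂ j a).2

theorem UniversalEnvelopingAlgebra.ι_mul_ι {L : Type*} [LieRing L] [LieAlgebra ℂ L] (x y : L) :
    ι ℂ x * ι ℂ y = ι ℂ ⁅x, y⁆ + ι ℂ y * ι ℂ x := by
  rw [LieHom.map_lie, LieRing.of_associative_ring_bracket, sub_add_cancel]

/-- Eigenvectors for distinct eigenvalues are independent. -/
theorem eq_zero_of_sum_eigenvectors {I E : Type*} [AddCommGroup E] [Module ℂ E]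
    {T : Module.End ℂ E} {c : I → ℂ} (hc : Function.Injective c) (s : Finset I) (v : I → E)
    (hv : ∀ m ∈ s, T (v m) = c m • v m) (hs : ∑ m ∈ s, v m = 0) : ∀ m ∈ s, v m = 0 := by
  classical
  induction s using Finset.induction_on generalizing v with
  | empty => simp
  | insert a s ha ih =>
    rw [Finset.sum_insert ha] at hs
    have h1 : ∀ m ∈ s, v m = 0 := by
      intro m hm
      have h2 := ih (fun m ↦ (c m - c a) • v m)
        (fun m hm ↦ by rw [map_smul, hv m (Finset.mem_insert_of_mem hm), smul_comm]) ?_ m hm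
      · refine (smul_eq_zero.1 h2).resolve_left (sub_ne_zero.2 fun h ↦ ha ?_)
        rwa [← hc h]
      · have h3 := congrArg T hs
        rw [map_add, map_sum, hv a (Finset.mem_insert_self _ _), map_zero,
          Finset.sum_congr rfl fun m hm ↦ hv m (Finset.mem_insert_of_mem hm)] at h3
        simp only [sub_smul, Finset.sum_sub_distrib, ← Finset.smul_sum]
        rw [eq_neg_of_add_eq_zero_right hs, smul_neg, sub_neg_eq_add, add_comm, h3]
    rw [Finset.sum_eq_zero h1, add_zero] at hs
    intro m hm
    rcases Finset.mem_insert.1 hm with rfl | hm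
    exacts [hs, h1 m hm]

namespace ShortGrading

open MvPolynomial

variable {ι L : Type*} [Fintype ι] [DecidableEq ι] [LieRing L] [LieAlgebra ℂ L]
  (S : ShortGrading ι L)

local notation "κ" => killingForm ℂ L
local notation "UL" => UniversalEnvelopingAlgebra ℂ L
local notation "inc" => UniversalEnvelopingAlgebra.ι ℂ

theorem inc_f_comm : ∀ x ∈ Set.range (fun j ↦ (inc (S.f j) : UL)),
    ∀ y ∈ Set.range (fun j ↦ (inc (S.f j) : UL)), x * y = y * x := by
  rintro _ ⟨j, rfl⟩ _ ⟨k, rfl⟩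
  simp only
  rw [UniversalEnvelopingAlgebra.ι_mul_ι,
    lie_eq_zero_of_mem_neg_one (f_mem j) (f_mem k), map_zero, zero_add]

/-- The subalgebra generated by the part of degree `-1`, as a commutative ring. -/
abbrev adjoinCommRing :
    CommRing (Algebra.adjoin ℂ (Set.range fun j ↦ (inc (S.f j) : UL))) where
  mul_comm := (Algebra.isMulCommutative_adjoin ℂ S.inc_f_comm).is_comm.comm

/-- The homomorphism from polynomials to the enveloping algebra that sends `X j` to `f j`; its image
is the subalgebra generated by the part of degree `-1`. -/
noncomputable def theta : MvPolynomial ι ℂ →ₐ[ℂ] UL :=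
  let _ := S.adjoinCommRing
  (Algebra.adjoin ℂ (Set.range fun j ↦ (inc (S.f j) : UL))).val.comp
    (aeval fun j ↦ ⟨inc (S.f j), Algebra.subset_adjoin ⟨j, rfl⟩⟩)

theorem theta_X (j : ι) : S.theta (X j) = inc (S.f j) := by
  let _ := S.adjoinCommRing
  simp [theta]

theorem theta_C (c : ℂ) : S.theta (C c) = algebraMap ℂ UL c := S.theta.commutes c

variable {S} in
theorem theta_ell {x : L} (hx : x ∈ S.lev (-1)) : S.theta (S.ell x) = inc x := by
  conv_rhs => rw [eq_sum_of_mem hx]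
  simp [ell_apply, theta_X]

variable {S} in
/-- The adjoint action of the part of degree `0` on the enveloping algebra. -/
theorem inc_mul_theta {x : L} (hx : x ∈ S.lev 0) (p : MvPolynomial ι ℂ) :
    inc x * S.theta p = S.theta (S.der x p) + S.theta p * inc x := by
  induction p using MvPolynomial.induction_on with
  | C c =>
    rw [← algebraMap_eq, Derivation.map_algebraMap, map_zero, zero_add, algebraMap_eq, theta_C,
      Algebra.commutes]
  | add p q hp hq => rw [map_add, map_add, map_add, mul_add, hp, hq, add_mul]; abel
  | mul_X p j hp =>
    have h1 : S.theta (S.ell ⁅x, S.f j⁆) = inc ⁅x, S.f j⁆ :=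
      theta_ell (lie_mem_lev_of_eq (by norm_num) hx (f_mem j))
    rw [map_mul, ← mul_assoc, hp, add_mul, mul_assoc _ (inc x), theta_X,
      UniversalEnvelopingAlgebra.ι_mul_ι, Derivation.leibniz, der_X, smul_eq_mul, smul_eq_mul,
      map_add, map_mul, h1, mul_comm (X j), map_mul, theta_X, mul_add]
    simp only [mul_assoc]
    abel

/-- A vector on which the part of degree `0` acts by the character `a κ(z, ·)` and which is killed by
the part of degree `1`. -/
def IsVacuum (a : ℂ) {V : Type*} [AddCommGroup V] [Module UL V] (v : V) : Prop :=
  (∀ x ∈ S.lev 0, (inc x : UL) • v = algebraMap ℂ UL (a * κ S.z x) • v) ∧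
    ∀ x ∈ S.lev 1, (inc x : UL) • v = 0

/-- The polynomials, as a module over the enveloping algebra: this is the scalar generalized Verma
module. -/
def PolyModel (_S : ShortGrading ι L) (_a : ℂ) : Type _ := MvPolynomial ι ℂ

noncomputable instance (a : ℂ) : AddCommGroup (S.PolyModel a) :=
  inferInstanceAs (AddCommGroup (MvPolynomial ι ℂ))

noncomputable instance (a : ℂ) : Module UL (S.PolyModel a) :=
  Module.compHom (MvPolynomial ι ℂ)
    (UniversalEnvelopingAlgebra.lift ℂ (S.rhoHom a)).toRingHom

/-- The constant polynomial `1` in the polynomial model. -/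
noncomputable def polyModelOne (a : ℂ) : S.PolyModel a := (1 : MvPolynomial ι ℂ)

theorem smul_polyModel (a : ℂ) (u : UL) (p : MvPolynomial ι ℂ) :
    (u • (show S.PolyModel a from p) : S.PolyModel a) =
      (UniversalEnvelopingAlgebra.lift ℂ (S.rhoHom a) u p : MvPolynomial ι ℂ) := rfl

theorem isVacuum_polyModelOne (a : ℂ) : S.IsVacuum a (S.polyModelOne a) := by
  constructor
  all_goals
    intro x hx
    refine (S.smul_polyModel a _ _).trans ?_
    rw [UniversalEnvelopingAlgebra.lift_ι_apply]
    refine (S.rho_apply_one a x).trans ?_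
  · refine Eq.trans ?_ (S.smul_polyModel a _ 1).symm
    rw [ell_eq_zero (by norm_num) hx, zero_add, AlgHom.commutes, Module.algebraMap_end_apply,
      smul_eq_C_mul, mul_one]
  · rw [ell_eq_zero (by norm_num) hx, killing_eq_zero (by norm_num) z_mem hx, mul_zero, C_0,
      zero_add]
    rfl

theorem theta_smul_polyModelOne (a : ℂ) (p : MvPolynomial ι ℂ) :
    S.theta p • S.polyModelOne a = (show S.PolyModel a from p) := by
  have h (p q : MvPolynomial ι ℂ) :
      UniversalEnvelopingAlgebra.lift ℂ (S.rhoHom a) (S.theta p) q = p * q := by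
    induction p using MvPolynomial.induction_on generalizing q with
    | C c => rw [theta_C, AlgHom.commutes, Module.algebraMap_end_apply, smul_eq_C_mul]
    | add p p' hp hp' => rw [map_add, map_add, LinearMap.add_apply, hp, hp', add_mul]
    | mul_X p j hp =>
      rw [map_mul, map_mul, Module.End.mul_apply, theta_X, UniversalEnvelopingAlgebra.lift_ι_apply,
        hp, mul_assoc]
      exact congrArg _ (S.rho_f a j q)
  exact (h p 1).trans (mul_one p)

/-- Letting the image of `p` act on `1` in the polynomial model gives `p` back; this takes the place
of the Poincaré–Birkhoff–Witt theorem. -/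
theorem theta_injective : Function.Injective S.theta := by
  intro p q h
  have h1 := S.theta_smul_polyModelOne 0 p
  rw [h, theta_smul_polyModelOne] at h1
  exact h1.symm

namespace IsVacuum

variable {S} {a : ℂ} {V : Type*} [AddCommGroup V] [Module (UniversalEnvelopingAlgebra ℂ L) V]
  {e : V}

/-- The map `p ↦ θ(p) e` intertwines the polynomial model with the module that contains `e`. -/
theorem map_rho (he : S.IsVacuum a e) (x : L) (p : MvPolynomial ι ℂ) :
    S.theta (S.rho a x p) • e = (inc x : UL) • S.theta p • e := by
  have h1 (x : L) : S.theta (S.rho a x 1) • e = (inc x : UL) • e := by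
    refine S.lev_induction (p := fun x ↦ S.theta (S.rho a x 1) • e = (inc x : UL) • e)
      (fun x y hx hy ↦ ?_) (fun x hx ↦ ?_) (fun x hx ↦ ?_) (fun x hx ↦ ?_) x
    · rw [map_add, LinearMap.add_apply, map_add, add_smul, hx, hy, map_add, add_smul]
    · rw [rho_neg_one a hx, mul_one, theta_ell hx]
    · rw [rho_apply_one, ell_eq_zero (by norm_num) hx, zero_add, theta_C, he.1 x hx]
    · rw [rho_apply_one, ell_eq_zero (by norm_num) hx, killing_eq_zero (by norm_num) z_mem hx,
        mul_zero, C_0, zero_add, map_zero, zero_smul, he.2 x hx]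
  induction p using MvPolynomial.induction_on generalizing x with
  | C c =>
    have h2 : (C c : MvPolynomial ι ℂ) = c • 1 := by rw [smul_eq_C_mul, mul_one]
    rw [h2, map_smul, map_smul, Algebra.smul_def, mul_smul, h1, map_smul, map_one,
      Algebra.smul_def, mul_one, ← mul_smul, ← mul_smul, Algebra.commutes]
  | add p q hp hq => rw [map_add, map_add, add_smul, hp, hq, map_add, add_smul, smul_add]
  | mul_X p j hp =>
    have h2 := compat_f (S := S) a x j p
    rw [rho_f, rho_f, eq_sub_iff_add_eq] at h2
    rw [mul_comm, ← h2, map_add, map_mul, add_smul, mul_smul, hp, hp, map_mul, theta_X, mul_smul,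
      ← mul_smul (inc x) (inc (S.f j)), UniversalEnvelopingAlgebra.ι_mul_ι x, add_smul, mul_smul]

/-- The images of `e` under `U(𝔲⁻)` fill the submodule generated by `e`. -/
theorem exists_theta (he : S.IsVacuum a e) (hgen : Submodule.span UL {e} = ⊤) (v : V) :
    ∃ p, S.theta p • e = v := by
  have h : ∀ (u : UL) (p : MvPolynomial ι ℂ), ∃ q, S.theta q • e = u • S.theta p • e := by
    intro u
    induction u using UniversalEnvelopingAlgebra.induction_ι with
    | hι x => exact fun p ↦ ⟨_, he.map_rho x p⟩
    | halg c => exact fun p ↦ ⟨C c * p, by rw [map_mul, theta_C, mul_smul]⟩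
    | hadd u u' hu hu' =>
      intro p
      obtain ⟨q, hq⟩ := hu p
      obtain ⟨q', hq'⟩ := hu' p
      exact ⟨q + q', by rw [map_add, add_smul, hq, hq', add_smul]⟩
    | hmul u u' hu hu' =>
      intro p
      obtain ⟨q, hq⟩ := hu' p
      obtain ⟨q', hq'⟩ := hu q
      exact ⟨q', by rw [hq', hq, mul_smul]⟩
  have hv : v ∈ Submodule.span UL {e} := hgen ▸ Submodule.mem_top
  obtain ⟨u, rfl⟩ := Submodule.mem_span_singleton.1 hv
  obtain ⟨q, hq⟩ := h u 1
  exact ⟨q, by rw [hq, map_one, one_smul]⟩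

/-- The polynomials that annihilate a vacuum vector. -/
noncomputable def annihilator (S : ShortGrading ι L) (e : V) : Submodule ℂ (MvPolynomial ι ℂ) where
  carrier := {p | S.theta p • e = 0}
  add_mem' {p q} hp hq := by
    rw [Set.mem_ofPred_eq] at hp hq ⊢
    rw [map_add, add_smul, hp, hq, add_zero]
  zero_mem' := by rw [Set.mem_ofPred_eq, map_zero, zero_smul]
  smul_mem' c p hp := by
    rw [Set.mem_ofPred_eq] at hp ⊢
    rw [map_smul, Algebra.smul_def, mul_smul, hp, smul_zero]

theorem mem_annihilator {p : MvPolynomial ι ℂ} : p ∈ annihilator S e ↔ S.theta p • e = 0 := Iff.rfl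

theorem theta_der_smul (he : S.IsVacuum a e) {x : L} (hx : x ∈ S.lev 0) (p : MvPolynomial ι ℂ) :
    S.theta (S.der x p) • e =
      (inc x : UL) • S.theta p • e - algebraMap ℂ UL (a * κ S.z x) • S.theta p • e := by
  rw [← he.map_rho, rho_zero a hx, map_add, add_smul, map_smul, Algebra.smul_def, mul_smul,
    add_sub_cancel_right]

theorem der_mem_annihilator (he : S.IsVacuum a e) {x : L} (hx : x ∈ S.lev 0)
    {p : MvPolynomial ι ℂ} (hp : p ∈ annihilator S e) : S.der x p ∈ annihilator S e := by
  rw [mem_annihilator] at hp ⊢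
  rw [he.theta_der_smul hx, hp, smul_zero, smul_zero, sub_zero]

theorem mul_mem_annihilator {p : MvPolynomial ι ℂ} (hp : p ∈ annihilator S e)
    (q : MvPolynomial ι ℂ) : q * p ∈ annihilator S e := by
  rw [mem_annihilator] at hp ⊢
  rw [map_mul, mul_smul, hp, smul_zero]

/-- A nonzero vector `e'` of this kind in the module is represented by a homogeneous polynomial,
whose degree is read off from the action of the grading element. -/
theorem exists_isHomogeneous (he : S.IsVacuum a e) {a' : ℂ} {e' : V} (he' : S.IsVacuum a' e')
    (h0 : e' ≠ 0) {p : MvPolynomial ι ℂ} (hp : S.theta p • e = e') :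
    ∃ (m : ℕ) (q : MvPolynomial ι ℂ), q.IsHomogeneous m ∧ S.theta q • e = e' ∧
      a' = a - m / κ S.z S.z := by
  let _ : Module ℂ V := Module.compHom V (algebraMap ℂ UL)
  have hsm (c : ℂ) (v : V) : c • v = algebraMap ℂ UL c • v := rfl
  let T : Module.End ℂ V :=
    { toFun := fun v ↦ (inc S.z : UL) • v
      map_add' := fun v w ↦ smul_add _ _ _
      map_smul' := fun c v ↦ by
        rw [hsm, hsm, ← mul_smul, ← mul_smul, RingHom.id_apply, Algebra.commutes] }
  have hT (v : V) : T v = (inc S.z : UL) • v := rfl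
  set κ₀ := κ S.z S.z with hκ₀
  have hκ : κ₀ ≠ 0 := S.killing_z_z
  have hhom (m : ℕ) : T (S.theta (homogeneousComponent m p) • e) =
      (a * κ₀ - m) • S.theta (homogeneousComponent m p) • e := by
    rw [hT, ← he.map_rho, rho_zero a z_mem,
      S.isHomogeneous_iff_der_z.1 (homogeneousComponent_isHomogeneous m p), ← add_smul, map_smul,
      hsm, Algebra.smul_def, mul_smul, neg_add_eq_sub]
  have hT' : T e' = (a' * κ₀) • e' := he'.1 _ z_mem
  have hinj : Function.Injective fun m : ℕ ↦ a * κ₀ - m := fun m n h ↦ by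
    simpa using h
  have hsum (s : Finset ℕ) (hs : Finset.range (p.totalDegree + 1) ⊆ s) :
      ∑ m ∈ s, S.theta (homogeneousComponent m p) • e = e' := by
    rw [← Finset.sum_smul, ← map_sum, ← Finset.sum_subset hs, sum_homogeneousComponent, hp]
    intro m _ hm
    refine homogeneousComponent_eq_zero _ _ ?_
    simpa [Nat.lt_succ_iff] using hm
  -- the eigenvalue of the vector has to be that of a homogeneous component: otherwise its negative
  -- and the components would be eigenvectors, for distinct eigenvalues, with sum zero
  by_cases hm : ∃ m : ℕ, a' = a - m / κ₀
  · obtain ⟨m, hm⟩ := hm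
    refine ⟨m, homogeneousComponent m p, homogeneousComponent_isHomogeneous m p, ?_, hm⟩
    have hm' : a' * κ₀ = a * κ₀ - m := by rw [hm]; field_simp
    have h1 := eq_zero_of_sum_eigenvectors (T := T) hinj
      (insert m (Finset.range (p.totalDegree + 1)))
      (fun n ↦ S.theta (homogeneousComponent n p) • e - if n = m then e' else 0)
      (fun n _ ↦ ?_) ?_ m (Finset.mem_insert_self _ _)
    · rwa [if_pos rfl, sub_eq_zero] at h1
    · rw [map_sub, hhom, smul_sub]
      congr 1
      split_ifs with h
      · rw [hT', hm', h]
      · rw [map_zero, smul_zero]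
    · rw [Finset.sum_sub_distrib, hsum _ (Finset.subset_insert _ _), Finset.sum_ite_eq',
        if_pos (Finset.mem_insert_self _ _), sub_self]
  · refine absurd (neg_eq_zero.1 (eq_zero_of_sum_eigenvectors (T := T)
      (c := fun o : Option ℕ ↦ o.elim (a' * κ₀) fun m ↦ a * κ₀ - m) ?_
      (Finset.insertNone (Finset.range (p.totalDegree + 1)))
      (fun o ↦ o.elim (-e') fun m ↦ S.theta (homogeneousComponent m p) • e) ?_ ?_ none
      (by simp))) h0
    · have hne (m : ℕ) : a' * κ₀ ≠ a * κ₀ - m := fun h ↦ hm ⟨m, by field_simp; exact h⟩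
      rintro (_ | m) (_ | n) h
      · rfl
      · exact absurd h (hne n)
      · exact absurd h.symm (hne m)
      · exact congrArg some (hinj h)
    · rintro (_ | m) _
      · exact (map_neg T e').trans (by rw [hT', ← smul_neg]; rfl)
      · exact hhom m
    · rw [Finset.sum_insertNone]
      exact (congrArg _ (hsum _ subset_rfl)).trans (neg_add_cancel e')

/-- A nonzero vector `e'` of this kind in the module is represented by a semi-invariant. -/
theorem exists_semiInv {I : Type*} [Fintype I] (F : S.PositiveFrame I) (he : S.IsVacuum a e)
    (hgen : Submodule.span UL {e} = ⊤) {a' : ℂ} {e' : V} (he' : S.IsVacuum a' e') (h0 : e' ≠ 0) :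
    ∃ (m : ℕ) (q : MvPolynomial ι ℂ), S.SemiInv m q ∧ S.theta q • e = e' ∧
      a' = a - m / κ S.z S.z := by
  obtain ⟨p, hp⟩ := he.exists_theta hgen e'
  obtain ⟨m, p, hpm, hp, ha⟩ := he.exists_isHomogeneous he' h0 hp
  obtain ⟨q, hpq, hqm, hq⟩ := F.exists_invariant (N := annihilator S e)
    (fun x hx _ p hp ↦ he.der_mem_annihilator hx hp) hpm (fun x hx hzx ↦ by
      rw [mem_annihilator, he.theta_der_smul hx, hp, he'.1 x hx, hzx, mul_zero, mul_zero, sub_self])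
  refine ⟨m, q, semiInv_of_isHomogeneous hqm hq, ?_, ha⟩
  rw [mem_annihilator, map_sub, sub_smul, sub_eq_zero] at hpq
  rw [← hpq, hp]

/-- The part of degree `1` acts on a semi-invariant of degree `m` by a multiple of a derivative. The
scalar vanishes for exactly one value of `a`. -/
theorem rho_semiInv {m : ℕ} {q : MvPolynomial ι ℂ} (hq : S.SemiInv m q) {x : L} (hx : x ∈ S.lev 1) :
    S.rho a x q = (a - (m - Fintype.card ι) / (2 * κ S.z S.z)) •
      ∑ j, κ x (S.f j) • pderiv j q := by
  rw [rho_one a hx, S.sec_eq_smul_sum a (-(m / κ S.z S.z)) hq hx]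
  congr 1
  have := S.killing_z_z
  field_simp
  ring

/-- A semi-invariant of degree `m` gives rise to a nonzero vector that is killed by the part of degree
`1` for one value of `a` only: for other values all its first derivatives would annihilate `e`, and
then so would the semi-invariant, by the Euler identity. -/
theorem eq_of_semiInv (he : S.IsVacuum a e) {a' : ℂ} {e' : V} (he' : S.IsVacuum a' e') (h0 : e' ≠ 0)
    {m : ℕ} (hm : m ≠ 0) {q : MvPolynomial ι ℂ} (hq : S.SemiInv m q) (hqe : S.theta q • e = e') :
    a = (m - Fintype.card ι) / (2 * κ S.z S.z) := by
  by_contra hne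
  have h1 (k : ι) : pderiv k q ∈ annihilator S e := by
    have h2 : S.rho a (S.e k) q ∈ annihilator S e := by
      rw [mem_annihilator, he.map_rho, hqe, he'.2 _ (e_mem k)]
    rw [rho_semiInv hq (e_mem k), Submodule.smul_mem_iff _ (sub_ne_zero.2 hne)] at h2
    simpa [S.killing_e_f] using h2
  have h3 : (m : ℂ) • q ∈ annihilator S e := by
    have h4 : ∑ k, X k * pderiv k q = m • q := hq.isHomogeneous.sum_X_mul_pderiv
    rw [Nat.cast_smul_eq_nsmul, ← h4]
    exact sum_mem fun k _ ↦ mul_mem_annihilator (h1 k) _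
  rw [Submodule.smul_mem_iff _ (by exact_mod_cast hm), mem_annihilator, hqe] at h3
  exact h0 h3

/-- For the value of `a` in `eq_of_semiInv`, semi-invariants of degree `m` do give rise to vectors
that are killed by the part of degree `1`. -/
theorem theta_semiInv (he : S.IsVacuum a e) {m : ℕ} {q : MvPolynomial ι ℂ} (hq : S.SemiInv m q)
    (ha : a = (m - Fintype.card ι) / (2 * κ S.z S.z)) :
    S.IsVacuum (a - m / κ S.z S.z) (S.theta q • e) := by
  constructor
  all_goals
    intro x hx
    rw [← he.map_rho]
  · rw [rho_zero a hx, hq x hx, ← add_smul, map_smul, Algebra.smul_def, mul_smul]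
    congr 2
    ring
  · rw [rho_semiInv hq hx, ← ha, sub_self, zero_smul, map_zero, zero_smul]

end IsVacuum

end ShortGrading

/-! ### Scalar generalized Verma modules and invariants -/

namespace HermitianParabolic

open MvPolynomial

variable {L : Type u} [LieRing L] [LieAlgebra ℂ L] [FiniteDimensional ℂ L]
  [LieAlgebra.IsSemisimple ℂ L]
  {H : LieSubalgebra ℂ L} [H.IsCartanSubalgebra]
  {b : (IsKilling.rootSystem H).Base} {i : b.support}

local notation "κ" => killingForm ℂ L

section Verma

variable {lam : Dual ℂ (CartanQuot b i)} {V : Type*} [AddCommGroup V] [Module (U L) V] {v : V}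

theorem smul_tens (lam : Dual ℂ (CartanQuot b i)) (a c : U L) :
    a • tens b i lam c = tens b i lam (a * c) := rfl

/-- The condition (Hol wt `λ`) in terms of the short grading. -/
theorem isHolWt_iff (hHerm : IsHermitianSymmetric b i) :
    IsHolWt b i lam v ↔ (shortGrading b i hHerm).IsVacuum (charParam b i lam) v := by
  constructor
  · intro h
    constructor
    · intro x hx
      have h1 := h ⟨x, levi_le_parabolic b i ((mem_levi hHerm).2 hx)⟩
      rw [apply_pr hHerm] at h1
      exact h1
    · intro x hx
      have h1 := h ⟨x, gradedPart_mono b i (A := Set.Ioi 0) (B := Set.Ici 0)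
        (fun n (hn : 0 < n) ↦ hn.le) ((mem_uPlus hHerm).2 hx)⟩
      rw [pr_eq_zero b i _ (Submodule.mem_sup_left ((mem_uPlus hHerm).2 hx)), map_zero, map_zero,
        zero_smul] at h1
      exact h1
  · rintro ⟨h0, h1⟩ X
    obtain ⟨u, hu, r, hr, h⟩ := Submodule.mem_sup.1 (parabolic_le b i X.2)
    have hzu : κ (gradingElement b i) u = 0 :=
      ShortGrading.killing_eq_zero (S := shortGrading b i hHerm) (m := 0) (n := 1) (by norm_num)
        ShortGrading.z_mem ((mem_uPlus hHerm).1 hu)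
    rw [apply_pr hHerm, ← h, inj, map_add, add_smul, h1 u ((mem_uPlus hHerm).1 hu), zero_add,
      map_add, hzu, zero_add]
    exact h0 r ((mem_levi hHerm).1 hr)

theorem IsHolWt.map {V' : Type*} [AddCommGroup V'] [Module (U L) V'] (h : IsHolWt b i lam v)
    (φ : V →ₗ[U L] V') : IsHolWt b i lam (φ v) := fun X ↦ by
  rw [← map_smul, h X, map_smul]

theorem IsHolWt.envIncl_smul (h : IsHolWt b i lam v) (p : U (parabolic b i)) :
    envIncl _ p • v = algebraMap ℂ (U L) (scalarAction b i lam p) • v := by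
  induction p using UniversalEnvelopingAlgebra.induction_ι with
  | hι X =>
    rw [envIncl, scalarAction, UniversalEnvelopingAlgebra.lift_ι_apply,
      UniversalEnvelopingAlgebra.lift_ι_apply]
    exact h X
  | halg c => rw [AlgHom.commutes, AlgHom.commutes]; rfl
  | hadd p q hp hq => rw [map_add, map_add, map_add, add_smul, add_smul, hp, hq]
  | hmul p q hp hq =>
    rw [map_mul, mul_smul, hq, ← mul_smul, ← Algebra.commutes, mul_smul, hp, ← mul_smul, ← map_mul,
      mul_comm, ← map_mul]

/-- The homomorphism from a scalar generalized Verma module that is given by a vector of type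
(Hol wt). -/
noncomputable def vermaLift (h : IsHolWt b i lam v) : ScalarVerma b i lam →ₗ[U L] V :=
  (vermaRel b i lam).liftQ
    (LinearMap.toSpanSingleton (U L) V v ∘ₗ
      (TensorProduct.AlgebraTensorModule.rid ℂ (U L) (U L)).toLinearMap) <| by
    refine Submodule.span_le.2 ?_
    rintro _ ⟨a, p, z, rfl⟩
    rw [SetLike.mem_coe, LinearMap.mem_ker, map_sub, sub_eq_zero]
    simp only [LinearMap.comp_apply, LinearEquiv.coe_coe,
      TensorProduct.AlgebraTensorModule.rid_tmul, LinearMap.toSpanSingleton_apply]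
    rw [Algebra.smul_def, Algebra.smul_def, mul_smul, mul_smul, mul_smul, h.envIncl_smul,
      mul_comm (scalarAction b i lam p), map_mul, mul_smul, ← mul_smul a,
      ← Algebra.commutes, mul_smul]

theorem vermaLift_tens (h : IsHolWt b i lam v) (a : U L) :
    vermaLift h (tens b i lam a) = a • v := by
  refine (Submodule.liftQ_apply _ _ _).trans ?_
  simp

theorem mkQ_tmul (lam : Dual ℂ (CartanQuot b i)) (a : U L) (c : ℂ) :
    (vermaRel b i lam).mkQ (a ⊗ₜ[ℂ] c) = (algebraMap ℂ (U L) c * a) • tens b i lam 1 := by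
  rw [smul_tens, mul_one, tens, ← Algebra.smul_def, TensorProduct.smul_tmul, smul_eq_mul, mul_one]

theorem isHolWt_tens (lam : Dual ℂ (CartanQuot b i)) : IsHolWt b i lam (tens b i lam 1) := by
  intro X
  have h1 : (vermaRel b i lam).mkQ ((1 * envIncl _ (UniversalEnvelopingAlgebra.ι ℂ X)) ⊗ₜ[ℂ] 1) =
      (vermaRel b i lam).mkQ
        (1 ⊗ₜ[ℂ] (scalarAction b i lam (UniversalEnvelopingAlgebra.ι ℂ X) * 1)) := by
    rw [← sub_eq_zero, ← map_sub, Submodule.mkQ_apply, Submodule.Quotient.mk_eq_zero]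
    exact Submodule.subset_span ⟨1, _, 1, rfl⟩
  rw [one_mul, mul_one, mkQ_tmul, mkQ_tmul, map_one, one_mul, mul_one, envIncl, scalarAction,
    UniversalEnvelopingAlgebra.lift_ι_apply, UniversalEnvelopingAlgebra.lift_ι_apply] at h1
  exact h1

theorem span_tens (lam : Dual ℂ (CartanQuot b i)) : Submodule.span (U L) {tens b i lam 1} = ⊤ := by
  rw [eq_top_iff]
  intro x _
  obtain ⟨x, rfl⟩ := Submodule.mkQ_surjective _ x
  induction x using TensorProduct.induction_on with
  | zero => rw [map_zero]; exact zero_mem _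
  | add x y hx hy => rw [map_add]; exact add_mem (hx trivial) (hy trivial)
  | tmul a c =>
    rw [mkQ_tmul]
    exact Submodule.smul_mem _ _ (Submodule.mem_span_singleton_self _)

theorem vermaHom_ext {φ ψ : ScalarVerma b i lam →ₗ[U L] V}
    (h : φ (tens b i lam 1) = ψ (tens b i lam 1)) : φ = ψ :=
  LinearMap.ext_on_range (v := fun _ : Unit ↦ tens b i lam 1)
    (by rw [Set.range_const]; exact span_tens lam) fun _ ↦ h

/-- The homomorphism from the generalized Verma module to the polynomial model shows that `U(𝔲⁻)`
acts freely on the canonical generator. -/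
theorem theta_smul_tens_ne_zero (hHerm : IsHermitianSymmetric b i)
    (lam : Dual ℂ (CartanQuot b i)) {p : MvPolynomial (NilRoot b i) ℂ} (hp : p ≠ 0) :
    (shortGrading b i hHerm).theta p • tens b i lam 1 ≠ 0 := by
  intro h
  have h1 := congrArg (vermaLift ((isHolWt_iff hHerm).2
    ((shortGrading b i hHerm).isVacuum_polyModelOne (charParam b i lam)))) h
  rw [map_smul, vermaLift_tens, one_smul, map_zero, ShortGrading.theta_smul_polyModelOne] at h1
  exact hp h1

end Verma

section Invariants

variable (hHerm : IsHermitianSymmetric b i)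

/-- The homomorphism from `U(𝔲⁻)` to the polynomials on the roots of the nilradical that sends `f j`
to `X j`; as `𝔲⁻` is abelian, it is bijective. -/
noncomputable def toPoly : U (uMinus b i) →ₐ[ℂ] MvPolynomial (NilRoot b i) ℂ :=
  UniversalEnvelopingAlgebra.lift ℂ
    { (shortGrading b i hHerm).ell ∘ₗ (uMinus b i).toSubmodule.subtype with
      map_lie' := fun {x y} ↦ by
        have h : ⁅(x : L), (y : L)⁆ = 0 := ShortGrading.lie_eq_zero_of_mem_neg_one
          ((mem_uMinus hHerm).1 x.2) ((mem_uMinus hHerm).1 y.2)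
        change (shortGrading b i hHerm).ell ⁅(x : L), (y : L)⁆ = _
        rw [h, map_zero, LieRing.of_associative_ring_bracket, mul_comm, sub_self] }

theorem toPoly_ι (x : uMinus b i) :
    toPoly hHerm (UniversalEnvelopingAlgebra.ι ℂ x) = (shortGrading b i hHerm).ell x :=
  UniversalEnvelopingAlgebra.lift_ι_apply _ _ _

theorem theta_toPoly (u : U (uMinus b i)) :
    (shortGrading b i hHerm).theta (toPoly hHerm u) = envIncl _ u := by
  have h : (shortGrading b i hHerm).theta.comp (toPoly hHerm) = envIncl _ := by
    refine UniversalEnvelopingAlgebra.hom_ext _ (LieHom.ext fun x ↦ ?_)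
    change (shortGrading b i hHerm).theta (toPoly hHerm (UniversalEnvelopingAlgebra.ι ℂ x)) =
      envIncl _ (UniversalEnvelopingAlgebra.ι ℂ x)
    rw [toPoly_ι, ShortGrading.theta_ell ((mem_uMinus hHerm).1 x.2), envIncl,
      UniversalEnvelopingAlgebra.lift_ι_apply]
    rfl
  exact DFunLike.congr_fun h u

theorem toPoly_surjective : Function.Surjective (toPoly hHerm) := by
  intro p
  induction p using MvPolynomial.induction_on with
  | C c => exact ⟨algebraMap ℂ _ c, AlgHom.commutes _ c⟩
  | add p q hp hq =>
    obtain ⟨u, rfl⟩ := hp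
    obtain ⟨v, rfl⟩ := hq
    exact ⟨u + v, map_add _ _ _⟩
  | mul_X p j hp =>
    obtain ⟨u, rfl⟩ := hp
    refine ⟨u * UniversalEnvelopingAlgebra.ι ℂ ⟨(shortGrading b i hHerm).f j,
      (mem_uMinus hHerm).2 (ShortGrading.f_mem j)⟩, ?_⟩
    rw [map_mul, toPoly_ι, ShortGrading.ell_f]

theorem toPoly_injective : Function.Injective (toPoly hHerm) := by
  have hcomm (u v : U (uMinus b i)) : u * v = v * u := by
    have h1 (x y : uMinus b i) : (UniversalEnvelopingAlgebra.ι ℂ x : U (uMinus b i)) *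
        UniversalEnvelopingAlgebra.ι ℂ y =
        UniversalEnvelopingAlgebra.ι ℂ y * UniversalEnvelopingAlgebra.ι ℂ x := by
      have h2 : ⁅x, y⁆ = 0 := Subtype.ext (ShortGrading.lie_eq_zero_of_mem_neg_one
        ((mem_uMinus hHerm).1 x.2) ((mem_uMinus hHerm).1 y.2))
      rw [UniversalEnvelopingAlgebra.ι_mul_ι, h2, map_zero, zero_add]
    induction u using UniversalEnvelopingAlgebra.induction_ι with
    | hι x =>
      induction v using UniversalEnvelopingAlgebra.induction_ι with
      | hι y => exact h1 x y
      | halg c => exact (Algebra.commutes c _).symm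
      | hadd u v hu hv => rw [mul_add, add_mul, hu, hv]
      | hmul u v hu hv => rw [← mul_assoc, hu, mul_assoc, hv, mul_assoc]
    | halg c => exact Algebra.commutes c _
    | hadd u v hu hv => rw [mul_add, add_mul, hu, hv]
    | hmul u v hu hv => rw [mul_assoc, hv, ← mul_assoc, hu, mul_assoc]
  let _ : CommRing (U (uMinus b i)) := { (inferInstance : Ring (U (uMinus b i))) with
    mul_comm := hcomm }
  let Ψ : MvPolynomial (NilRoot b i) ℂ →ₐ[ℂ] U (uMinus b i) :=
    aeval fun j ↦ UniversalEnvelopingAlgebra.ι ℂ ⟨(shortGrading b i hHerm).f j,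
      (mem_uMinus hHerm).2 (ShortGrading.f_mem j)⟩
  have h : Ψ.comp (toPoly hHerm) = AlgHom.id ℂ _ := by
    refine UniversalEnvelopingAlgebra.hom_ext _ (LieHom.ext fun x ↦ ?_)
    change Ψ (toPoly hHerm (UniversalEnvelopingAlgebra.ι ℂ x)) = UniversalEnvelopingAlgebra.ι ℂ x
    rw [toPoly_ι, ShortGrading.ell_apply, map_sum]
    simp only [map_smul, Ψ, aeval_X]
    simp only [← map_smul, ← map_sum]
    congr 1
    refine Subtype.ext ?_
    rw [AddSubmonoidClass.coe_finsetSum]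
    exact (ShortGrading.eq_sum_of_mem ((mem_uMinus hHerm).1 x.2)).symm
  intro u v huv
  have h1 := DFunLike.congr_fun h u
  rw [AlgHom.comp_apply, huv] at h1
  exact h1.symm.trans (DFunLike.congr_fun h v)

/-- The commutator with `x` in the enveloping algebra corresponds to the derivation `der x`. -/
theorem mem_invariants (u : U (uMinus b i)) : u ∈ invariants b i ↔
    ∀ x ∈ (shortGrading b i hHerm).lev 0, κ (gradingElement b i) x = 0 →
      (shortGrading b i hHerm).der x (toPoly hHerm u) = 0 := by
  rw [invariants, Subalgebra.mem_comap, Subalgebra.mem_centralizer_iff]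
  constructor
  · intro h x hx hzx
    have h1 := h _ ⟨x, (mem_gS hHerm).2 ⟨hx, hzx⟩, rfl⟩
    rw [← theta_toPoly hHerm, ShortGrading.inc_mul_theta hx,
      add_eq_right] at h1
    exact (shortGrading b i hHerm).theta_injective (h1.trans (map_zero _).symm)
  · rintro h _ ⟨x, hx, rfl⟩
    obtain ⟨hx, hzx⟩ := (mem_gS hHerm).1 hx
    rw [← theta_toPoly hHerm, ShortGrading.inc_mul_theta hx, h x hx hzx, map_zero, zero_add]

end Invariants

end HermitianParabolic

/-! ### Generators of the algebra of invariants -/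

theorem MvPolynomial.IsHomogeneous.transcendental {σ : Type*} {w : MvPolynomial σ ℂ} {d : ℕ}
    (hw : w.IsHomogeneous d) (hd : d ≠ 0) (h0 : w ≠ 0) : Transcendental ℂ w := by
  rw [transcendental_iff]
  intro q hq
  ext n
  rw [Polynomial.coeff_zero]
  have h1 := congrArg (homogeneousComponent (d * n)) hq
  rw [Polynomial.aeval_eq_sum_range, map_sum, map_zero] at h1
  have h2 (k : ℕ) : homogeneousComponent (d * n) (q.coeff k • w ^ k) =
      if k = n then q.coeff k • w ^ k else 0 := by
    rw [map_smul, homogeneousComponent_of_mem (hw.pow k)]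
    by_cases h : k = n
    · rw [if_pos (by rw [h]), if_pos h]
    · rw [if_neg (fun h' ↦ h (Nat.eq_of_mul_eq_mul_left (Nat.pos_of_ne_zero hd) h').symm),
        if_neg h, smul_zero]
  simp only [h2, Finset.sum_ite_eq'] at h1
  split_ifs at h1 with h
  · exact (smul_eq_zero.1 h1).resolve_right (pow_ne_zero _ h0)
  · refine Polynomial.coeff_eq_zero_of_natDegree_lt ?_
    simpa using h

namespace ShortGrading

open MvPolynomial

variable {ι L : Type*} [Fintype ι] [DecidableEq ι] [LieRing L] [LieAlgebra ℂ L]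
  {S : ShortGrading ι L}

local notation "κ" => killingForm ℂ L

theorem der_homogeneousComponent {x : L} (hx : x ∈ S.lev 0) (n : ℕ) (p : MvPolynomial ι ℂ) :
    S.der x (homogeneousComponent n p) = homogeneousComponent n (S.der x p) := by
  conv_rhs => rw [← sum_homogeneousComponent p, map_sum, map_sum,
    Finset.sum_congr rfl fun m _ ↦ homogeneousComponent_of_mem
      (isHomogeneous_der hx (homogeneousComponent_isHomogeneous m p))]
  rw [Finset.sum_ite_eq]
  split_ifs with h
  · rfl
  · rw [homogeneousComponent_eq_zero _ _ (by simpa using h), map_zero]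

theorem semiInv_homogeneousComponent {p : MvPolynomial ι ℂ}
    (hp : ∀ x ∈ S.lev 0, κ S.z x = 0 → S.der x p = 0) (n : ℕ) :
    S.SemiInv n (homogeneousComponent n p) :=
  semiInv_of_isHomogeneous (homogeneousComponent_isHomogeneous n p) fun x hx hzx ↦ by
    rw [der_homogeneousComponent hx, hp x hx hzx, map_zero]

end ShortGrading

namespace HermitianParabolic

open MvPolynomial

variable {L : Type u} [LieRing L] [LieAlgebra ℂ L] [FiniteDimensional ℂ L]
  [LieAlgebra.IsSemisimple ℂ L]
  {H : LieSubalgebra ℂ L} [H.IsCartanSubalgebra]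
  {b : (IsKilling.rootSystem H).Base} {i : b.support}

local notation "κ" => killingForm ℂ L

/-- If there is a nonconstant semi-invariant polynomial, then the invariants form a polynomial
algebra in one generator, and the degree of the latter is determined by its weight. -/
theorem exists_isPolyGenerator (hHerm : IsHermitianSymmetric b i) {m : ℕ} (hm : m ≠ 0)
    {g : MvPolynomial (NilRoot b i) ℂ} (hg : (shortGrading b i hHerm).SemiInv m g) (hg0 : g ≠ 0) :
    ∃ (d : ℕ) (w : U (uMinus b i)), IsPolyGenerator b i w ∧ d ≠ 0 ∧
      (shortGrading b i hHerm).SemiInv d (toPoly hHerm w) ∧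
      d / κ (gradingElement b i) (gradingElement b i) * κ (gradingElement b i) (hAlpha b i) = 2 ∧
      ∀ n p, (shortGrading b i hHerm).SemiInv n p → p ≠ 0 →
        ∃ (k : ℕ) (c : ℂ), n = k * d ∧ p = c • toPoly hHerm w ^ k := by
  obtain ⟨d, w, hd, hirr, hw, hgen⟩ := ShortGrading.exists_generator hm hg hg0
  obtain ⟨w, rfl⟩ := toPoly_surjective hHerm w
  obtain ⟨ε, c, hdiag⟩ := exists_isDiagonal b i hHerm
  refine ⟨d, w, ⟨?_, ?_⟩, hd, hw, hdiag.weight_eq_two hd hw hirr, hgen⟩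
  · exact fun h ↦ hw.isHomogeneous.transcendental hd hirr.ne_zero
      ((isAlgebraic_algHom_iff (toPoly hHerm) (toPoly_injective hHerm)).2 h)
  · refine le_antisymm (fun u hu ↦ ?_) (Algebra.adjoin_le ?_)
    · rw [mem_invariants hHerm] at hu
      have h1 : toPoly hHerm u ∈ (Algebra.adjoin ℂ {w}).map (toPoly hHerm) := by
        rw [AlgHom.map_adjoin, Set.image_singleton, ← sum_homogeneousComponent (toPoly hHerm u)]
        refine sum_mem fun n _ ↦ ?_
        by_cases h0 : homogeneousComponent n (toPoly hHerm u) = 0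
        · rw [h0]; exact zero_mem _
        obtain ⟨k, c, -, h⟩ := hgen n _ (ShortGrading.semiInv_homogeneousComponent hu n) h0
        rw [h]
        exact Subalgebra.smul_mem _ (pow_mem (Algebra.self_mem_adjoin_singleton _ _) _) _
      obtain ⟨u', hu', h⟩ := h1
      rwa [← toPoly_injective hHerm h]
    · rintro _ rfl
      rw [SetLike.mem_coe, mem_invariants hHerm]
      exact fun x hx hzx ↦ hw.der_eq_zero hx hzx

/-- A polynomial algebra of invariants contains a nonconstant semi-invariant. -/
theorem exists_semiInv_of_isPolyGenerator (hHerm : IsHermitianSymmetric b i)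
    {w : U (uMinus b i)} (hw : IsPolyGenerator b i w) :
    ∃ (m : ℕ) (g : MvPolynomial (NilRoot b i) ℂ), m ≠ 0 ∧
      (shortGrading b i hHerm).SemiInv m g ∧ g ≠ 0 := by
  have hinv : w ∈ invariants b i := hw.2 ▸ Algebra.self_mem_adjoin_singleton ℂ w
  rw [mem_invariants hHerm] at hinv
  by_contra! h
  have h1 : toPoly hHerm w = C (coeff 0 (toPoly hHerm w)) := by
    rw [← homogeneousComponent_zero]
    conv_lhs => rw [← sum_homogeneousComponent (toPoly hHerm w)]
    refine Finset.sum_eq_single 0 (fun n _ hn ↦ ?_) (by simp)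
    exact h n _ hn (ShortGrading.semiInv_homogeneousComponent hinv n)
  have h2 : w = algebraMap ℂ _ (coeff 0 (toPoly hHerm w)) :=
    toPoly_injective hHerm (h1.trans (AlgHom.commutes (toPoly hHerm) _).symm)
  exact hw.1 (h2 ▸ isAlgebraic_algebraMap _)

theorem hasWeightNegTwoOmega_iff (hHerm : IsHermitianSymmetric b i) {w : U (uMinus b i)} :
    HasWeightNegTwoOmega b i w ↔ ∀ h : H, (shortGrading b i hHerm).der h (toPoly hHerm w) =
      (-2 * omega b i (toQuot b i h)) • toPoly hHerm w := by
  refine forall_congr' fun h ↦ ?_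
  rw [← theta_toPoly hHerm, ShortGrading.inc_mul_theta (cartan_mem_lev_zero b i hHerm h),
    add_sub_cancel_right, ← map_smul, (shortGrading b i hHerm).theta_injective.eq_iff]

theorem hasWeightNegTwoOmega_of_semiInv (hHerm : IsHermitianSymmetric b i) {w : U (uMinus b i)}
    {d : ℕ} (hw : (shortGrading b i hHerm).SemiInv d (toPoly hHerm w))
    (hd : d / κ (gradingElement b i) (gradingElement b i) *
      κ (gradingElement b i) (hAlpha b i) = 2) : HasWeightNegTwoOmega b i w := by
  rw [hasWeightNegTwoOmega_iff hHerm]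
  intro h
  rw [hw _ (cartan_mem_lev_zero b i hHerm h), omega_toQuot hHerm]
  congr 1
  change -(d / κ (gradingElement b i) (gradingElement b i)) * κ (gradingElement b i) h = _
  rw [← hd]
  have := killing_hAlpha_ne_zero hHerm
  field_simp

/-- The Levi factor is spanned by `𝔤_S` and `h_α`, so that invariance and the weight determine its
action. -/
theorem semiInv_of_hasWeightNegTwoOmega (hHerm : IsHermitianSymmetric b i) {w : U (uMinus b i)}
    {d : ℕ} (hw : HasWeightNegTwoOmega b i w) (hinv : w ∈ invariants b i)
    (hd : d / κ (gradingElement b i) (gradingElement b i) *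
      κ (gradingElement b i) (hAlpha b i) = 2) :
    (shortGrading b i hHerm).SemiInv d (toPoly hHerm w) := by
  rw [mem_invariants hHerm] at hinv
  rw [hasWeightNegTwoOmega_iff hHerm] at hw
  intro x hx
  have h0 := killing_hAlpha_ne_zero hHerm
  set c := κ (gradingElement b i) x / κ (gradingElement b i) (hAlpha b i) with hc
  have h1 := hinv (x - c • (hAlpha b i : L))
    (sub_mem hx (Submodule.smul_mem _ _ (cartan_mem_lev_zero b i hHerm _)))
    (by rw [map_sub, map_smul, hc, smul_eq_mul, div_mul_cancel₀ _ h0, sub_self])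
  rw [map_sub, map_smul, Derivation.sub_apply, Derivation.smul_apply, hw, omega_hAlpha,
    sub_eq_zero] at h1
  rw [h1, smul_smul]
  congr 1
  change _ = -(d / κ (gradingElement b i) (gradingElement b i)) * κ (gradingElement b i) x
  have h2 : κ (gradingElement b i) x = c * κ (gradingElement b i) (hAlpha b i) := by
    rw [hc, div_mul_cancel₀ _ h0]
  rw [h2]
  linear_combination c * hd

/-! ### The homomorphisms between scalar generalized Verma modules -/

/-- The shift by `ρ^S` accounts for the number of variables in `eq_of_semiInv`. -/
theorem eq_smul_omega_iff_charParam (hHerm : IsHermitianSymmetric b i) {d : ℕ}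
    (hd : d / κ (gradingElement b i) (gradingElement b i) *
      κ (gradingElement b i) (hAlpha b i) = 2) (lam : Dual ℂ (CartanQuot b i)) (c : ℂ) :
    lam = (c - rhoS b i (hAlpha b i)) • omega b i ↔ charParam b i lam =
      (c * d - Fintype.card (NilRoot b i)) /
        (2 * κ (gradingElement b i) (gradingElement b i)) := by
  rw [eq_smul_omega_iff hHerm, rhoS_hAlpha hHerm]
  have h0 := killing_hAlpha_ne_zero hHerm
  have h1 := killing_gradingElement_ne_zero b i hHerm
  have h2 : (c - Fintype.card (NilRoot b i) / (2 * κ (gradingElement b i) (gradingElement b i)) *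
      κ (gradingElement b i) (hAlpha b i)) / κ (gradingElement b i) (hAlpha b i) =
      (c * d - Fintype.card (NilRoot b i)) /
        (2 * κ (gradingElement b i) (gradingElement b i)) := by
    have h3 : d * κ (gradingElement b i) (hAlpha b i) =
      2 * κ (gradingElement b i) (gradingElement b i) := by
      field_simp at hd
      linear_combination hd
    field_simp
    linear_combination -c * h3
  rw [h2]

/-- The two weights of a module generated by a vector of type (Hol wt `λ`) that contains a vector of
type (Hol wt `λ'`): the semi-invariant that represents the latter is a multiple of the `k`-th power
of the generator, which fixes its degree, and the degree fixes both weights. -/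
theorem exists_eq_of_isHolWt (hHerm : IsHermitianSymmetric b i)
    {lam lam' : Dual ℂ (CartanQuot b i)} (hne : lam ≠ lam') {V : Type*} [AddCommGroup V]
    [Module (U L) V] {e e' : V} (he : IsHolWt b i lam e) (hgen : Submodule.span (U L) {e} = ⊤)
    (h0 : e' ≠ 0) (he' : IsHolWt b i lam' e') :
    (∃ w : U (uMinus b i), IsPolyGenerator b i w) ∧
      ∃ k : ℕ, lam = ((k : ℂ) - rhoS b i (hAlpha b i)) • omega b i ∧
        lam' = (-(k : ℂ) - rhoS b i (hAlpha b i)) • omega b i := by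
  rw [isHolWt_iff hHerm] at he he'
  obtain ⟨m, q, hq, hqe, ha⟩ := he.exists_semiInv (positiveFrame b i hHerm) hgen he' h0
  have hm : m ≠ 0 := by
    rintro rfl
    refine hne (charParam_injective hHerm ?_)
    rw [ha, Nat.cast_zero, zero_div, sub_zero]
  have hq0 : q ≠ 0 := by
    rintro rfl
    rw [map_zero, zero_smul] at hqe
    exact h0 hqe.symm
  have ha' := he.eq_of_semiInv he' h0 hm hq hqe
  obtain ⟨d, w, hw, -, -, hd, hall⟩ := exists_isPolyGenerator hHerm hm hq hq0
  obtain ⟨k, -, rfl, -⟩ := hall m q hq hq0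
  refine ⟨⟨w, hw⟩, k, ?_, ?_⟩
  · rw [eq_smul_omega_iff_charParam hHerm hd, ha']
    push_cast
    rfl
  · rw [eq_smul_omega_iff_charParam hHerm hd, ha, ha']
    change _ - _ / κ (gradingElement b i) (gradingElement b i) = _
    change (_ - _) / (2 * κ (gradingElement b i) (gradingElement b i)) - _ = _
    have h1 := killing_gradingElement_ne_zero b i hHerm
    push_cast
    field_simp
    ring

theorem charParam_sub (hHerm : IsHermitianSymmetric b i) {lam lam' : Dual ℂ (CartanQuot b i)}
    {d k : ℕ} (hd : d / κ (gradingElement b i) (gradingElement b i) *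
      κ (gradingElement b i) (hAlpha b i) = 2)
    (hlam : lam = ((k : ℂ) - rhoS b i (hAlpha b i)) • omega b i)
    (hlam' : lam' = (-(k : ℂ) - rhoS b i (hAlpha b i)) • omega b i) :
    charParam b i lam' =
      charParam b i lam - (k * d : ℕ) / κ (gradingElement b i) (gradingElement b i) := by
  rw [(eq_smul_omega_iff_charParam hHerm hd _ _).1 hlam,
    (eq_smul_omega_iff_charParam hHerm hd _ _).1 hlam']
  have h1 := killing_gradingElement_ne_zero b i hHerm
  push_cast
  field_simp
  ring

/-- The homomorphism that sends the canonical generator to the `k`-th power of the generator of the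
invariants. -/
theorem exists_linearMap_ne_zero (hHerm : IsHermitianSymmetric b i)
    {lam lam' : Dual ℂ (CartanQuot b i)} {w : U (uMinus b i)} (hw : IsPolyGenerator b i w) {k : ℕ}
    (hlam : lam = ((k : ℂ) - rhoS b i (hAlpha b i)) • omega b i)
    (hlam' : lam' = (-(k : ℂ) - rhoS b i (hAlpha b i)) • omega b i) :
    ∃ φ : ScalarVerma b i lam' →ₗ[U L] ScalarVerma b i lam, φ ≠ 0 := by
  obtain ⟨m, g, hm, hg, hg0⟩ := exists_semiInv_of_isPolyGenerator hHerm hw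
  obtain ⟨d, w, hw, hd0, hsw, hd, -⟩ := exists_isPolyGenerator hHerm hm hg hg0
  have hw0 : toPoly hHerm w ≠ 0 := by
    rw [Ne, map_eq_zero_iff _ (toPoly_injective hHerm)]
    rintro rfl
    exact hw.1 isAlgebraic_zero
  have h1 := ((isHolWt_iff hHerm).1 (isHolWt_tens lam)).theta_semiInv (hsw.pow k)
    (((eq_smul_omega_iff_charParam hHerm hd _ _).1 hlam).trans (by push_cast; rfl))
  rw [show charParam b i lam - (k * d : ℕ) / κ (shortGrading b i hHerm).z
    (shortGrading b i hHerm).z = charParam b i lam' from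
      (charParam_sub hHerm hd hlam hlam').symm, ← isHolWt_iff hHerm] at h1
  refine ⟨vermaLift h1, fun h ↦ ?_⟩
  have h2 := vermaLift_tens h1 1
  rw [h, LinearMap.zero_apply, one_smul] at h2
  exact theta_smul_tens_ne_zero hHerm lam (pow_ne_zero k hw0) h2.symm

/-- Vectors of type (Hol wt `λ'`) are unique up to scalars, since semi-invariants of given degree
are. -/
theorem exists_eq_smul_pow_smul (hHerm : IsHermitianSymmetric b i)
    {lam lam' : Dual ℂ (CartanQuot b i)} {w : U (uMinus b i)}
    (hw : IsPolyGenerator b i w) (hw' : HasWeightNegTwoOmega b i w) {k : ℕ}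
    (hlam : lam = ((k : ℂ) - rhoS b i (hAlpha b i)) • omega b i)
    (hlam' : lam' = (-(k : ℂ) - rhoS b i (hAlpha b i)) • omega b i) {V : Type*} [AddCommGroup V]
    [Module (U L) V] {e e' : V} (he : IsHolWt b i lam e) (hgen : Submodule.span (U L) {e} = ⊤)
    (he' : IsHolWt b i lam' e') :
    ∃ c : ℂ, e' = algebraMap ℂ (U L) c • envIncl (uMinus b i) w ^ k • e := by
  by_cases h0 : e' = 0
  · exact ⟨0, by rw [h0, map_zero, zero_smul]⟩
  obtain ⟨m, g, hm, hg, hg0⟩ := exists_semiInv_of_isPolyGenerator hHerm hw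
  obtain ⟨d, w₀, -, hd0, -, hd, hall⟩ := exists_isPolyGenerator hHerm hm hg hg0
  have hw0 : toPoly hHerm w ≠ 0 := by
    rw [Ne, map_eq_zero_iff _ (toPoly_injective hHerm)]
    rintro rfl
    exact hw.1 isAlgebraic_zero
  have hsw := semiInv_of_hasWeightNegTwoOmega hHerm hw'
    (hw.2 ▸ Algebra.self_mem_adjoin_singleton ℂ w) hd
  rw [isHolWt_iff hHerm] at he he'
  obtain ⟨n, q, hq, hqe, ha⟩ := he.exists_semiInv (positiveFrame b i hHerm) hgen he' h0
  have hn : n = k * d := by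
    have h1 := charParam_sub hHerm hd hlam hlam'
    rw [ha, sub_right_inj] at h1
    have h2 := (div_left_inj' (killing_gradingElement_ne_zero b i hHerm)).1 h1
    exact_mod_cast h2
  obtain ⟨c, rfl⟩ := ShortGrading.SemiInv.exists_eq_smul hm hg hg0 (hn ▸ hq) (hsw.pow k)
    (pow_ne_zero k hw0)
  refine ⟨c, ?_⟩
  rw [← hqe, map_smul, map_pow, theta_toPoly, Algebra.smul_def, mul_smul]

end HermitianParabolic

open HermitianParabolic
theorem mainTheorem5 {L : Type u} [LieRing L] [LieAlgebra ℂ L] [FiniteDimensional ℂ L]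
    [LieAlgebra.IsSemisimple ℂ L] (H : LieSubalgebra ℂ L) [H.IsCartanSubalgebra]
    (b : (LieAlgebra.IsKilling.rootSystem H).Base) (i : b.support)
    (hHerm : IsHermitianSymmetric b i)
    (lam lam' : Module.Dual ℂ (CartanQuot b i)) (hne : lam ≠ lam') :
    List.TFAE [
      ∃ (V : Type u) (_ : AddCommGroup V) (_ : Module (U L) V) (e e' : V),
        IsHolWt b i lam e ∧ Submodule.span (U L) {e} = ⊤ ∧ e' ≠ 0 ∧ IsHolWt b i lam' e',
      ∃ φ : ScalarVerma b i lam' →ₗ[U L] ScalarVerma b i lam, φ ≠ 0,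
      (∃ w : U (uMinus b i), IsPolyGenerator b i w) ∧
        ∃ k : ℕ, lam = ((k : ℂ) - rhoS b i (hAlpha b i)) • omega b i ∧
          lam' = (-(k : ℂ) - rhoS b i (hAlpha b i)) • omega b i] ∧
    ((∃ w : U (uMinus b i), IsPolyGenerator b i w) →
      ∃ w : U (uMinus b i), IsPolyGenerator b i w ∧ HasWeightNegTwoOmega b i w) ∧
    (∀ w : U (uMinus b i), IsPolyGenerator b i w → HasWeightNegTwoOmega b i w →
      ∀ k : ℕ, lam = ((k : ℂ) - rhoS b i (hAlpha b i)) • omega b i →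
        lam' = (-(k : ℂ) - rhoS b i (hAlpha b i)) • omega b i →
        (∀ (V : Type v) [AddCommGroup V] [Module (U L) V] (e e' : V),
          IsHolWt b i lam e → Submodule.span (U L) {e} = ⊤ → IsHolWt b i lam' e' →
            ∃ c : ℂ, e' = algebraMap ℂ (U L) c • envIncl (uMinus b i) w ^ k • e) ∧
        (∀ φ : ScalarVerma b i lam' →ₗ[U L] ScalarVerma b i lam,
          (∃ c : ℂ, φ (tens b i lam' 1) =
            algebraMap ℂ (U L) c • tens b i lam (envIncl (uMinus b i) w ^ k)) ∧
          ∀ ψ : ScalarVerma b i lam' →ₗ[U L] ScalarVerma b i lam,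
            ψ (tens b i lam' 1) = φ (tens b i lam' 1) → ψ = φ)) := by
  refine ⟨?_, ?_, ?_⟩
  · tfae_have 1 → 3 := by
      rintro ⟨V, _, _, e, e', he, hgen, h0, he'⟩
      exact exists_eq_of_isHolWt hHerm hne he hgen h0 he'
    tfae_have 3 → 2 := by
      rintro ⟨⟨w, hw⟩, k, hlam, hlam'⟩
      exact exists_linearMap_ne_zero hHerm hw hlam hlam'
    tfae_have 2 → 1 := by
      rintro ⟨φ, hφ⟩
      refine ⟨ScalarVerma b i lam, inferInstance, inferInstance, tens b i lam 1,
        φ (tens b i lam' 1), isHolWt_tens lam, span_tens lam, fun h ↦ hφ (vermaHom_ext ?_),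
        (isHolWt_tens lam').map φ⟩
      rw [h, LinearMap.zero_apply]
    tfae_finish
  · rintro ⟨w, hw⟩
    obtain ⟨m, g, hm, hg, hg0⟩ := exists_semiInv_of_isPolyGenerator hHerm hw
    obtain ⟨d, w₀, hw₀, -, hsw, hd, -⟩ := exists_isPolyGenerator hHerm hm hg hg0
    exact ⟨w₀, hw₀, hasWeightNegTwoOmega_of_semiInv hHerm hsw hd⟩
  · intro w hw hw' k hlam hlam'
    refine ⟨fun V _ _ e e' he hgen he' ↦
      exists_eq_smul_pow_smul hHerm hw hw' hlam hlam' he hgen he', fun φ ↦ ⟨?_, fun ψ ↦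
      vermaHom_ext⟩⟩
    obtain ⟨c, hc⟩ := exists_eq_smul_pow_smul hHerm hw hw' hlam hlam' (isHolWt_tens lam)
      (span_tens lam) ((isHolWt_tens lam').map φ)
    exact ⟨c, by rw [hc, smul_tens, mul_one]⟩
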